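/- **Setting.** Let $n\ge 1$ and let $(D,\omega_D)$ be a compact connected Kähler manifold of complex dimension $n-1$ (for instance a toric Kähler–Einstein Fano manifold). Let $\widehat M=\mathbb C\times D$, let $z$ be the coordinate on $\mathbb C$, and for $\lambda>0$ put $r:=|z|^{\lambda}$ and $\widehat\omega:=\frac i2\partial\bar\partial|z|^{2\lambda}+\omega_D$. Let $M$ be a toric manifold of complex dimension $n$: a complex manifold with an effective holomorphic action of $(\mathbb C^*)^n$ whose fixed point set is compact and which has an open dense orbit. Let $J$ be its complex structure, $T=T^n\subset(\mathbb C^*)^n$ the real torus, and $\mathfrak t$ its Lie algebra, identified with the vector fields on $M$ generated by the action of $T$. (For instance, $M=\overline M\setminus\pi^{-1}(\{\infty\}\times D)$ for a toric Fano manifold $\overline M$ obtained by a torus-equivariant, possibly iterated, blowup $\pi:\overline M\to\mathbb P^1\times D$ along smooth torus-invariant subvarieties contained in $\{0\}\times D$, where $D$ is a toric Kähler–Einstein Fano manifold.) Let $\omega$ be the Kähler form of a complete $T$-invariant Kähler metric on $M$, let $X$ be a vector field on $M$ with $JX\in\mathfrak t$, and let $\nu:M\setminus K\to\widehat M\setminus\widehat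 K$, with $K\subset M$ and $\widehat K\subset\widehat M$ compact, be a biholomorphism such that $$d\nu(X)=\tfrac{2}{\lambda}\operatorname{Re}(z\partial_z)\qquad\text{and}\qquad \omega=\nu^*\widehat\omega\quad\text{on } M\setminus K .$$ Write $\omega\lrcorner Y=\omega(Y,\cdot)$ and $\Delta_\omega f=\operatorname{tr}_\omega(i\partial\bar\partial f)$. **Lemma.** There exists a unique smooth $T$-invariant function $f:M\to\mathbb R$ such that $-\omega\lrcorner JX=df$ on $M$ and $f=\nu^*\left(\frac{r^2}{2}-1\right)$ outside a compact subset of $M$. It satisfies $$\Delta_\omega f+f-\tfrac X2\cdot f=0$$ outside a compact subset of $M$. If $M\setminus K$ is connected, then both $f=\nu^*\left(\frac{r^2}{2}-1\right)$ and this equation hold on all of $M\setminus K$. Moreover $f\to+\infty$ as $r\circ\nu\to+\infty$ on $M\setminus K$, $f(p)\to+\infty$ as $p$ leaves every compact subset of $M$, and $f$ is proper. -/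

import Mathlib

open scoped Manifold ContDiff Topology

noncomputable section

namespace KahlerToric

/-! Conventions. A complex manifold is a Hausdorff second countable space `M` charted on a finite
dimensional complex normed space `E` with complex analytic transition maps, i.e.
`IsManifold 𝓘(ℂ, E) ω M`. Its underlying real manifold uses the same charts with the model
`𝓘(ℝ, E)`. In Mathlib `TangentSpace 𝓘(ℝ, E) p` is by definition the vector space `E`, a vector
being written in the preferred chart at `p`; as the charts are holomorphic, the complex structure
`J` of `M` is multiplication by `i` on each tangent space. -/

section Forms

variable (E : Type*) [NormedAddCommGroup E] [NormedSpace ℂ E]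

/-- The complex structure on a tangent space. -/
def J : E →L[ℝ] E := Complex.I • ContinuousLinearMap.id ℝ E

variable (M : Type*) [TopologicalSpace M] [ChartedSpace E M]

/-- Real vector fields: `X p` lies in `TangentSpace 𝓘(ℝ, E) p = E`. -/
abbrev VField : Type _ := M → E

/-- Fields of real bilinear forms on the tangent spaces: `Ω p u v` for `u v` in
`TangentSpace 𝓘(ℝ, E) p = E`. -/
abbrev BilinField : Type _ := M → E →L[ℝ] E →L[ℝ] ℝ

variable {E M}

/-- The differential of a map between the underlying real manifolds. -/
def tangentMapAt {F N : Type*} [NormedAddCommGroup F] [NormedSpace ℂ F]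
    [TopologicalSpace N] [ChartedSpace F N] (φ : M → N) (p : M) : E →L[ℝ] F :=
  mfderiv 𝓘(ℝ, E) 𝓘(ℝ, F) φ p

/-- The differential of a real-valued function. -/
def diff (f : M → ℝ) (p : M) : E →L[ℝ] ℝ :=
  mfderiv 𝓘(ℝ, E) 𝓘(ℝ, ℝ) f p

/-- The coordinate expression of `Ω` in the preferred chart at `x`, i.e. its pullback under the
inverse of that chart; it is meaningful on the target of the chart. -/
def coordExpr (Ω : BilinField E M) (x : M) (y : E) : E →L[ℝ] E →L[ℝ] ℝ :=
  (Ω ((chartAt E x).symm y)).bilinearComp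
    (tangentMapAt (chartAt E x).symm y) (tangentMapAt (chartAt E x).symm y)

/-- `Ω` is the Kähler form of a Kähler metric: a smooth closed real `(1,1)`-form such that
`Ω (v, J v) > 0` for `v ≠ 0`. -/
structure IsKahler (Ω : BilinField E M) : Prop where
  alternating : ∀ p v, Ω p v v = 0
  smooth : ∀ x, ContDiffOn ℝ ∞ (coordExpr Ω x) (chartAt E x).target
  closed : ∀ x, ∀ y ∈ (chartAt E x).target, ∀ u v w : E,
    fderiv ℝ (coordExpr Ω x) y u v w + fderiv ℝ (coordExpr Ω x) y v w u
      + fderiv ℝ (coordExpr Ω x) y w u v = 0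
  invariant : ∀ p u v, Ω p (J E u) (J E v) = Ω p u v
  positive : ∀ p v, v ≠ 0 → 0 < Ω p v (J E v)

/-- The Riemannian metric `g (u, v) = Ω (u, J v)` of a Kähler form. -/
def metric (Ω : BilinField E M) : BilinField E M :=
  fun p => (Ω p).bilinearComp (ContinuousLinearMap.id ℝ E) (J E)

/-- The Riemannian distance of the metric of `Ω`: the infimum of the lengths of `C^1` paths. -/
def kahlerEDist (Ω : BilinField E M) : M → M → ENNReal :=
  letI : ∀ p : M, ENorm (TangentSpace 𝓘(ℝ, E) p) :=
    fun p => ⟨fun v : E => ENNReal.ofReal (Real.sqrt (metric Ω p v v))⟩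
  Manifold.riemannianEDist 𝓘(ℝ, E)

/-- The metric of `Ω` is complete: Cauchy sequences for its Riemannian distance converge. -/
def IsCompleteMetric (Ω : BilinField E M) : Prop :=
  ∀ a : ℕ → M, (∀ ε : ENNReal, 0 < ε → ∃ N, ∀ k ≥ N, ∀ l ≥ N, kahlerEDist Ω (a k) (a l) < ε) →
    ∃ x, Filter.Tendsto a Filter.atTop (𝓝 x)

/-- The real `(1,1)`-form `i ∂ ∂̄ φ` of a function on the complex vector space `E`. As
`i ∂ ∂̄ φ = (1/2) d (- dφ ∘ J)`, its value on `(u, v)` is `(1/2) (D²φ (v, J u) - D²φ (u, J v))`. -/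
def flatDdbar (φ : E → ℝ) (y : E) : E →L[ℝ] E →L[ℝ] ℝ :=
  (1 / 2 : ℝ) •
    (((fderiv ℝ (fderiv ℝ φ) y).bilinearComp (ContinuousLinearMap.id ℝ E) (J E)).flip
      - (fderiv ℝ (fderiv ℝ φ) y).bilinearComp (ContinuousLinearMap.id ℝ E) (J E))

/-- The real `(1,1)`-form `i ∂ ∂̄ f` of a function on `M`, computed at `p` in the preferred
(holomorphic) chart at `p`. -/
def ddbar (f : M → ℝ) : BilinField E M := fun p =>
  flatDdbar (f ∘ (chartAt E p).symm) (chartAt E p p)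

/-- The Kähler Laplacian `Δ_Ω f = tr_Ω (i ∂ ∂̄ f)`. In a unitary frame this is
`∑ⱼ (i ∂ ∂̄ f)(eⱼ, J eⱼ)`, which is half of the trace of the symmetric form
`(u, v) ↦ (i ∂ ∂̄ f)(u, J v)` with respect to the metric of `Ω`. -/
def laplacian (Ω : BilinField E M) (f : M → ℝ) (p : M) : ℝ :=
  (1 / 2 : ℝ) * LinearMap.trace ℝ E
    ((metric Ω p).inverse ∘L metric (ddbar f) p : E →L[ℝ] E).toLinearMap

end Forms

section Toric

/-- The exponential map `ℂⁿ → (ℂ*)ⁿ`. -/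
def torusExp {n : ℕ} (w : Fin n → ℂ) : Fin n → ℂˣ :=
  fun j => Units.mk0 (Complex.exp (w j)) (Complex.exp_ne_zero _)

/-- The inclusion of the real torus `Tⁿ = (S¹)ⁿ` in `(ℂ*)ⁿ`. -/
def realTorus {n : ℕ} (t : Fin n → Circle) : Fin n → ℂˣ :=
  fun j => Circle.toUnits (t j)

variable (n : ℕ) (E : Type*) [NormedAddCommGroup E] [NormedSpace ℂ E]
  (M : Type*) [TopologicalSpace M] [ChartedSpace E M] [MulAction (Fin n → ℂˣ) M]

/-- `M` is a toric manifold of complex dimension `n`: the torus `(ℂ*)ⁿ` acts holomorphically and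
effectively, with compact fixed point set and an open dense orbit. Since the exponential map
`ℂⁿ → (ℂ*)ⁿ` is a holomorphic covering, the action `(ℂ*)ⁿ × M → M` is holomorphic if and only if
its composition with that covering is. -/
structure IsToric : Prop where
  finrank_eq : Module.finrank ℂ E = n
  holomorphic : ContMDiff (𝓘(ℂ, Fin n → ℂ).prod 𝓘(ℂ, E)) 𝓘(ℂ, E) ω
    (fun q : (Fin n → ℂ) × M => torusExp q.1 • q.2)
  effective : ∀ t : Fin n → ℂˣ, (∀ p : M, t • p = p) → t = 1
  compact_fixedPoints : IsCompact (MulAction.fixedPoints (Fin n → ℂˣ) M)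
  dense_orbit : ∃ p : M, IsOpen (MulAction.orbit (Fin n → ℂˣ) p) ∧
    Dense (MulAction.orbit (Fin n → ℂˣ) p)

variable {n E M}

/-- The vector field on `M` generated by `b ∈ ℝⁿ`, the Lie algebra of the real torus: its value at
`p` is the velocity at `s = 0` of `s ↦ (e^{i s b₁}, …, e^{i s bₙ}) • p`. -/
def torusField (b : Fin n → ℝ) : VField E M := fun p =>
  (mfderiv 𝓘(ℝ, ℝ) 𝓘(ℝ, E)
    (fun s : ℝ => torusExp (fun j => ((s * b j : ℝ) : ℂ) * Complex.I) • p) 0 : ℝ →L[ℝ] E) 1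

/-- The vector field `V` lies in the Lie algebra of the real torus. -/
def InTorusLieAlgebra (n : ℕ) [MulAction (Fin n → ℂˣ) M] (V : VField E M) : Prop :=
  ∃ b : Fin n → ℝ, V = torusField b

/-- A function invariant under the real torus. -/
def TorusInvariant (n : ℕ) [MulAction (Fin n → ℂˣ) M] (f : M → ℝ) : Prop :=
  ∀ (t : Fin n → Circle) (p : M), f (realTorus t • p) = f p

/-- A bilinear form invariant under (pullback by) the real torus. -/
def TorusInvariantForm (n : ℕ) [MulAction (Fin n → ℂˣ) M] (Ω : BilinField E M) : Prop :=
  ∀ (t : Fin n → Circle) (p : M) (u v : E),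
    Ω (realTorus t • p) (tangentMapAt (fun q : M => realTorus t • q) p u)
      (tangentMapAt (fun q : M => realTorus t • q) p v) = Ω p u v

end Toric

section Model

/-- The form `(i/2) ∂ ∂̄ |z|^{2a}` on `ℂ`. -/
def coneForm (a : ℝ) (z : ℂ) : ℂ →L[ℝ] ℂ →L[ℝ] ℝ :=
  (1 / 2 : ℝ) • flatDdbar (fun w : ℂ => ‖w‖ ^ (2 * a)) z

variable {F : Type*} [NormedAddCommGroup F] [NormedSpace ℂ F]
  {D : Type*} [TopologicalSpace D] [ChartedSpace F D]

/-- The product form `(i/2) ∂ ∂̄ |z|^{2a} + Ω_D` on `ℂ × D`; the tangent space at `(z, x)` is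
`ℂ × F`. -/
def modelForm (a : ℝ) (ΩD : BilinField F D) (q : ℂ × D) : (ℂ × F) →L[ℝ] (ℂ × F) →L[ℝ] ℝ :=
  (coneForm a q.1).bilinearComp (ContinuousLinearMap.fst ℝ ℂ F) (ContinuousLinearMap.fst ℝ ℂ F)
    + (ΩD q.2).bilinearComp (ContinuousLinearMap.snd ℝ ℂ F) (ContinuousLinearMap.snd ℝ ℂ F)

/-- The function `r = |z|^a` on `ℂ × D`. -/
def radius (a : ℝ) (q : ℂ × D) : ℝ := ‖q.1‖ ^ a

/-- The vector field `(2/a) Re (z ∂_z) = r ∂_r` on `ℂ × D`. The complex vector field `z ∂_z` is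
`(1/2) (Y - i J Y)` with `Y = x ∂_x + y ∂_y` the radial field, whose value at `z` is the vector
`z`; so `2 Re (z ∂_z) = Y`. -/
def modelField (a : ℝ) (q : ℂ × D) : ℂ × F := ((1 / a : ℝ) • q.1, 0)

variable {E : Type*} [NormedAddCommGroup E] [NormedSpace ℂ E]
  {M : Type*} [TopologicalSpace M] [ChartedSpace E M]

/-- The real differential at `p` of a map from `M` to `ℂ × D`. -/
def prodTangentMapAt (φ : M → ℂ × D) (p : M) : E →L[ℝ] ℂ × F :=
  mfderiv 𝓘(ℝ, E) (𝓘(ℝ, ℂ).prod 𝓘(ℝ, F)) φ p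

/-- `ν : M \ K → (ℂ × D) \ K'` is a biholomorphism between complements of compact sets with
`dν(X) = (2/a) Re (z ∂_z)` and `Ω = ν^* ((i/2) ∂ ∂̄ |z|^{2a} + Ω_D)`. -/
structure IsModelAtInfinity (a : ℝ) (ΩD : BilinField F D) (Ω : BilinField E M) (X : VField E M)
    (K : Set M) (K' : Set (ℂ × D)) (ν : OpenPartialHomeomorph M (ℂ × D)) : Prop where
  compact : IsCompact K
  compact' : IsCompact K'
  source_eq : ν.source = Kᶜ
  target_eq : ν.target = K'ᶜ
  holomorphic : ContMDiffOn 𝓘(ℂ, E) (𝓘(ℂ, ℂ).prod 𝓘(ℂ, F)) ω ν Kᶜ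
  holomorphic_symm : ContMDiffOn (𝓘(ℂ, ℂ).prod 𝓘(ℂ, F)) 𝓘(ℂ, E) ω ν.symm K'ᶜ
  map_field : ∀ p ∉ K, prodTangentMapAt ν p (X p) = modelField (F := F) a (ν p)
  pullback : ∀ p ∉ K, ∀ u v : E,
    Ω p u v = modelForm a ΩD (ν p) (prodTangentMapAt ν p u) (prodTangentMapAt ν p v)

/-- `f` is a smooth torus-invariant Hamiltonian potential of `J X`, i.e. `- Ω ⌟ J X = df`, that is
equal to `ν^* (r^2 / 2 - 1)` outside a compact set. -/
structure IsNormalisedPotential (n : ℕ) [MulAction (Fin n → ℂˣ) M] (a : ℝ) (Ω : BilinField E M)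
    (X : VField E M) (ν : OpenPartialHomeomorph M (ℂ × D)) (f : M → ℝ) : Prop where
  smooth : ContMDiff 𝓘(ℝ, E) 𝓘(ℝ, ℝ) ∞ f
  invariant : TorusInvariant n f
  hamiltonian : ∀ p v, - Ω p (J E (X p)) v = diff f p v
  at_infinity : ∀ᶠ p in Filter.cocompact M, f p = radius a (ν p) ^ 2 / 2 - 1

end Model

end KahlerToric

end

/-!
Let `p` be a point of the open orbit outside `K`. The model potential is `|X|²/2 - 1`, and `|X|²` is
constant along the orbits of the real torus, so `ω(JX, ·)` vanishes on the torus directions at `p`,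
hence on the whole orbit. The pullback of `-ω(JX, ·)` to `ℂⁿ` by the orbit map of `p` is closed; its
primitive is therefore invariant under translation by the Lie algebra of the real torus and descends
to the orbit. The complement of the orbit is locally contained in the zero set of a nonzero
holomorphic function and does not locally disconnect `M`, so local primitives of `-ω(JX, ·)` extend
the potential to `M`. Over the exterior of a large disc in `ℂ` its difference from
`ν^*(r²/2 - 1)` is constant, and this fixes the normalisation.

Completeness is what makes `r → ∞` along every sequence leaving all compact subsets of `M`: a
sequence over a bounded part of `ℂ × D` accumulates in the model, either at a point outside `K'` or
at a point of `K'`. In the latter case its distance to `K` tends to `0` along a subsequence, even if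
the point lies over the apex of the cone, and a further subsequence converges.
-/

noncomputable section

namespace KahlerToric

section RealDifferential

variable {E : Type*} [NormedAddCommGroup E] [NormedSpace ℝ E]
  {F : Type*} [NormedAddCommGroup F] [NormedSpace ℝ F]
  {G : Type*} [NormedAddCommGroup G] [NormedSpace ℝ G]
  {M : Type*} [TopologicalSpace M] [ChartedSpace E M]
  {N : Type*} [TopologicalSpace N] [ChartedSpace F N]
  {P : Type*} [TopologicalSpace P] [ChartedSpace G P]

variable (E F) in
/-- The differential of a map between boundaryless real manifolds, with values in the space of
linear maps between the model spaces. It unfolds to `tangentMapAt`, `prodTangentMapAt` and `diff`,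
but does not require the model spaces to be complex. -/
def rdiff (φ : M → N) (p : M) : E →L[ℝ] F := mfderiv 𝓘(ℝ, E) 𝓘(ℝ, F) φ p

theorem rdiff_comp {g : N → P} {f : M → N} (p : M)
    (hg : MDifferentiableAt 𝓘(ℝ, F) 𝓘(ℝ, G) g (f p))
    (hf : MDifferentiableAt 𝓘(ℝ, E) 𝓘(ℝ, F) f p) :
    rdiff E G (g ∘ f) p = (rdiff F G g (f p)).comp (rdiff E F f p) :=
  mfderiv_comp p hg hf

theorem rdiff_eq_fderiv (f : E → F) (x : E) : rdiff E F f x = fderiv ℝ f x :=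
  mfderiv_eq_fderiv

theorem rdiff_id (p : M) : rdiff E E (fun q : M => q) p = ContinuousLinearMap.id ℝ E :=
  mfderiv_id

theorem rdiff_const (c : N) (p : M) : rdiff E F (fun _ : M => c) p = 0 :=
  mfderiv_const

theorem rdiff_congr {f g : M → N} {p : M} (h : f =ᶠ[𝓝 p] g) : rdiff E F f p = rdiff E F g p := by
  have := h.eq_of_nhds
  unfold rdiff
  exact h.mfderiv_eq

theorem contDiffAt_chartAt_comp {n : WithTop ℕ∞} [IsManifold 𝓘(ℝ, E) n M] {φ : G → M} {w : G}
    (x : M) (hφ : ContMDiffAt 𝓘(ℝ, G) 𝓘(ℝ, E) n φ w) (hx : φ w ∈ (chartAt E x).source) :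
    ContDiffAt ℝ n (chartAt E x ∘ φ) w := by
  rw [← contMDiffAt_iff_contDiffAt]
  exact ((contMDiffOn_chart (I := 𝓘(ℝ, E)) (n := n)).contMDiffAt
    ((chartAt E x).open_source.mem_nhds hx)).comp w hφ

variable [IsManifold 𝓘(ℝ, E) 1 M]

theorem mdifferentiableAt_chartAt (x : M) {p : M} (hp : p ∈ (chartAt E x).source) :
    MDifferentiableAt 𝓘(ℝ, E) 𝓘(ℝ, E) (chartAt E x) p :=
  mdifferentiableAt_atlas (chart_mem_atlas E x) hp

theorem mdifferentiableAt_chartAt_symm (x : M) {y : E} (hy : y ∈ (chartAt E x).target) :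
    MDifferentiableAt 𝓘(ℝ, E) 𝓘(ℝ, E) (chartAt E x).symm y :=
  mdifferentiableAt_atlas_symm (chart_mem_atlas E x) hy

theorem rdiff_chartAt_symm_comp (x : M) {p : M} (hp : p ∈ (chartAt E x).source) :
    (rdiff E E (chartAt E x).symm (chartAt E x p)).comp (rdiff E E (chartAt E x) p)
      = ContinuousLinearMap.id ℝ E := by
  rw [← rdiff_comp p (mdifferentiableAt_chartAt_symm x ((chartAt E x).map_source hp))
    (mdifferentiableAt_chartAt x hp), ← rdiff_id p]
  apply rdiff_congr
  filter_upwards [(chartAt E x).open_source.mem_nhds hp] with q hq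
  exact (chartAt E x).left_inv hq

theorem rdiff_comp_chartAt_symm (x : M) {y : E} (hy : y ∈ (chartAt E x).target) :
    (rdiff E E (chartAt E x) ((chartAt E x).symm y)).comp (rdiff E E (chartAt E x).symm y)
      = ContinuousLinearMap.id ℝ E := by
  rw [← rdiff_comp y (mdifferentiableAt_chartAt x ((chartAt E x).map_target hy))
    (mdifferentiableAt_chartAt_symm x hy), ← rdiff_id y]
  apply rdiff_congr
  filter_upwards [(chartAt E x).open_target.mem_nhds hy] with q hq
  exact (chartAt E x).right_inv hq

theorem rdiff_eq_chartAt_symm_comp_fderiv {φ : G → M} {w : G} (x : M)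
    (hφ : MDifferentiableAt 𝓘(ℝ, G) 𝓘(ℝ, E) φ w) (hx : φ w ∈ (chartAt E x).source) :
    rdiff G E φ w = (rdiff E E (chartAt E x).symm (chartAt E x (φ w))).comp
      (fderiv ℝ (chartAt E x ∘ φ) w) := by
  rw [← rdiff_eq_fderiv, rdiff_comp w (mdifferentiableAt_chartAt x hx) hφ,
    ← ContinuousLinearMap.comp_assoc, rdiff_chartAt_symm_comp x hx, ContinuousLinearMap.id_comp]

end RealDifferential

section RestrictScalars

variable {E : Type*} [NormedAddCommGroup E] [NormedSpace ℂ E]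
  {F : Type*} [NormedAddCommGroup F] [NormedSpace ℂ F]
  {M : Type*} [TopologicalSpace M] [ChartedSpace E M]
  {N : Type*} [TopologicalSpace N] [ChartedSpace F N]

instance isManifold_restrictScalars {n : WithTop ℕ∞} [IsManifold 𝓘(ℂ, E) n M] :
    IsManifold 𝓘(ℝ, E) n M := by
  refine isManifold_of_contDiffOn 𝓘(ℝ, E) n M fun e e' he he' => ?_
  have h := HasGroupoid.compatible (G := contDiffGroupoid n 𝓘(ℂ, E)) he he'
  rw [contDiffGroupoid, mem_groupoid_of_pregroupoid] at h
  exact ContDiffOn.restrict_scalars ℝ h.1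

theorem contMDiffAt_restrictScalars {n : WithTop ℕ∞} {φ : M → N} {p : M}
    (h : ContMDiffAt 𝓘(ℂ, E) 𝓘(ℂ, F) n φ p) : ContMDiffAt 𝓘(ℝ, E) 𝓘(ℝ, F) n φ p := by
  rw [contMDiffAt_iff] at h ⊢
  exact ⟨h.1, ContDiffWithinAt.restrict_scalars ℝ h.2⟩

theorem hasMFDerivAt_restrictScalars {φ : M → N} {p : M} {L : E →L[ℂ] F}
    (h : HasMFDerivAt 𝓘(ℂ, E) 𝓘(ℂ, F) φ p L) :
    HasMFDerivAt 𝓘(ℝ, E) 𝓘(ℝ, F) φ p (L.restrictScalars ℝ) :=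
  ⟨h.1, HasFDerivWithinAt.restrictScalars ℝ h.2⟩

theorem mdifferentiableAt_restrictScalars {φ : M → N} {p : M}
    (h : MDifferentiableAt 𝓘(ℂ, E) 𝓘(ℂ, F) φ p) : MDifferentiableAt 𝓘(ℝ, E) 𝓘(ℝ, F) φ p :=
  (hasMFDerivAt_restrictScalars h.hasMFDerivAt).mdifferentiableAt

theorem rdiff_J {φ : M → N} {p : M} (h : MDifferentiableAt 𝓘(ℂ, E) 𝓘(ℂ, F) φ p) (v : E) :
    rdiff E F φ p (J E v) = J F (rdiff E F φ p v) := by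
  have hL : rdiff E F φ p =
      ContinuousLinearMap.restrictScalars ℝ (mfderiv 𝓘(ℂ, E) 𝓘(ℂ, F) φ p : E →L[ℂ] F) :=
    (hasMFDerivAt_restrictScalars h.hasMFDerivAt).mfderiv
  rw [hL]
  exact (mfderiv 𝓘(ℂ, E) 𝓘(ℂ, F) φ p : E →L[ℂ] F).map_smul Complex.I v

end RestrictScalars

section FlatForms

variable {E : Type*} [NormedAddCommGroup E] [NormedSpace ℝ E]
  {G : Type*} [NormedAddCommGroup G] [NormedSpace ℝ G]
  {H : Type*} [NormedAddCommGroup H] [NormedSpace ℝ H]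
  {Q : Type*} [NormedAddCommGroup Q] [NormedSpace ℝ Q]

theorem contDiff_flip {n : WithTop ℕ∞} :
    ContDiff ℝ n (ContinuousLinearMap.flip : (E →L[ℝ] G →L[ℝ] H) → G →L[ℝ] E →L[ℝ] H) :=
  IsBoundedLinearMap.contDiff ⟨⟨fun _ _ => rfl, fun _ _ => rfl⟩, 1, one_pos, fun B => by simp⟩

theorem contDiffAt_bilinearComp {n : WithTop ℕ∞} {B : Q → E →L[ℝ] E →L[ℝ] H} {L : Q → G →L[ℝ] E}
    {w : Q} (hB : ContDiffAt ℝ n B w) (hL : ContDiffAt ℝ n L w) :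
    ContDiffAt ℝ n (fun w => (B w).bilinearComp (L w) (L w)) w := by
  have hBL : ContDiffAt ℝ n (fun w => ((B w).comp (L w)).flip) w :=
    contDiff_flip.contDiffAt.comp w (hB.clm_comp hL)
  exact contDiff_flip.contDiffAt.comp w (hBL.clm_comp hL)

theorem fderiv_clm_apply_const {B : Q → E →L[ℝ] G} {w : Q} (hB : DifferentiableAt ℝ B w)
    (u : Q) (v : E) : fderiv ℝ (fun w => B w v) w u = fderiv ℝ B w u v := by
  simp [fderiv_clm_apply hB (differentiableAt_const v)]

theorem fderiv_clm_apply₂_const {B : Q → E →L[ℝ] G →L[ℝ] H} {w : Q} (hB : DifferentiableAt ℝ B w)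
    (u : Q) (v : E) (v' : G) : fderiv ℝ (fun w => B w v v') w u = fderiv ℝ B w u v v' := by
  rw [fderiv_clm_apply_const (hB.clm_apply (differentiableAt_const v)), fderiv_clm_apply_const hB]

theorem fderiv_pullback_apply {β : E → E →L[ℝ] E →L[ℝ] H} {χ : G → E} {w : G}
    (hβ : DifferentiableAt ℝ β (χ w)) (hχ : ContDiffAt ℝ 2 χ w) (u v v' : G) :
    fderiv ℝ (fun w => (β (χ w)).bilinearComp (fderiv ℝ χ w) (fderiv ℝ χ w)) w u v v' =
      fderiv ℝ β (χ w) (fderiv ℝ χ w u) (fderiv ℝ χ w v) (fderiv ℝ χ w v')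
      + β (χ w) (fderiv ℝ (fderiv ℝ χ) w u v) (fderiv ℝ χ w v')
      + β (χ w) (fderiv ℝ χ w v) (fderiv ℝ (fderiv ℝ χ) w u v') := by
  have hχ₁ : DifferentiableAt ℝ χ w := hχ.differentiableAt (by simp)
  have hχ' : DifferentiableAt ℝ (fderiv ℝ χ) w :=
    (hχ.fderiv_right (m := 1) (by norm_num)).differentiableAt (by simp)
  have dβ : HasFDerivAt (fun w => β (χ w)) ((fderiv ℝ β (χ w)).comp (fderiv ℝ χ w)) w :=
    HasFDerivAt.comp (g := β) w hβ.hasFDerivAt hχ₁.hasFDerivAt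
  have dγ := (dβ.clm_apply (hχ'.hasFDerivAt.clm_apply (hasFDerivAt_const v w))).clm_apply
    (hχ'.hasFDerivAt.clm_apply (hasFDerivAt_const v' w))
  have hγ : DifferentiableAt ℝ
      (fun w => (β (χ w)).bilinearComp (fderiv ℝ χ w) (fderiv ℝ χ w)) w := by
    have hβχ : DifferentiableAt ℝ (fun w => ((β (χ w)).comp (fderiv ℝ χ w)).flip) w :=
      (contDiff_flip.differentiable one_ne_zero _).comp w (dβ.differentiableAt.clm_comp hχ')
    exact (contDiff_flip.differentiable one_ne_zero _).comp w (hβχ.clm_comp hχ')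
  rw [← fderiv_clm_apply₂_const hγ]
  refine (DFunLike.congr_fun dγ.fderiv u).trans ?_
  simp only [ContinuousLinearMap.comp_zero, zero_add, ContinuousLinearMap.flip_add, add_apply,
    ContinuousLinearMap.comp_apply, ContinuousLinearMap.flip_apply]
  abel

theorem closed_pullback {β : E → E →L[ℝ] E →L[ℝ] H} {χ : G → E} {w : G}
    (hβ : DifferentiableAt ℝ β (χ w)) (hχ : ContDiffAt ℝ 2 χ w)
    (halt : ∀ v v', β (χ w) v v' = -β (χ w) v' v)
    (hcl : ∀ u v v' : E, fderiv ℝ β (χ w) u v v' + fderiv ℝ β (χ w) v v' u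
      + fderiv ℝ β (χ w) v' u v = 0) (u v v' : G) :
    let γ := fun w => (β (χ w)).bilinearComp (fderiv ℝ χ w) (fderiv ℝ χ w)
    fderiv ℝ γ w u v v' + fderiv ℝ γ w v v' u + fderiv ℝ γ w v' u v = 0 := by
  intro γ
  have sym : ∀ a b, fderiv ℝ (fderiv ℝ χ) w a b = fderiv ℝ (fderiv ℝ χ) w b a :=
    (hχ.isSymmSndFDerivAt (by simp)).eq
  rw [fderiv_pullback_apply hβ hχ, fderiv_pullback_apply hβ hχ, fderiv_pullback_apply hβ hχ,
    sym u v, sym v v', sym v' u, halt (fderiv ℝ χ w v), halt (fderiv ℝ χ w v'),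
    halt (fderiv ℝ χ w u), ← hcl (fderiv ℝ χ w u) (fderiv ℝ χ w v) (fderiv ℝ χ w v')]
  abel

end FlatForms

section Pullback

variable {E : Type*} [NormedAddCommGroup E] [NormedSpace ℂ E]
  {M : Type*} [TopologicalSpace M] [ChartedSpace E M]
  {G : Type*} [NormedAddCommGroup G] [NormedSpace ℝ G]

theorem IsKahler.antisymm {Ω : BilinField E M} (h : IsKahler Ω) (p : M) (u v : E) :
    Ω p u v = - Ω p v u := by
  have := h.alternating p (u + v)
  simp only [map_add, add_apply, h.alternating] at this
  linarith

/-- The pullback of a field of bilinear forms under a map from a normed space; unlike `coordExpr`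
it is not restricted to inverses of charts. -/
def pull (Ω : BilinField E M) (φ : G → M) (w : G) : G →L[ℝ] G →L[ℝ] ℝ :=
  (Ω (φ w)).bilinearComp (rdiff G E φ w) (rdiff G E φ w)

theorem pull_apply (Ω : BilinField E M) (φ : G → M) (w u v : G) :
    pull Ω φ w u v = Ω (φ w) (rdiff G E φ w u) (rdiff G E φ w v) := rfl

theorem IsKahler.coordExpr_contDiffAt {Ω : BilinField E M} (h : IsKahler Ω) (x : M) {y : E}
    (hy : y ∈ (chartAt E x).target) : ContDiffAt ℝ ∞ (coordExpr Ω x) y :=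
  (h.smooth x).contDiffAt ((chartAt E x).open_target.mem_nhds hy)

theorem IsKahler.pull_antisymm {Ω : BilinField E M} (h : IsKahler Ω) (φ : G → M) (w u v : G) :
    pull Ω φ w u v = - pull Ω φ w v u := h.antisymm _ _ _

theorem pull_eq_coordExpr [IsManifold 𝓘(ℝ, E) 1 M] (Ω : BilinField E M) {φ : G → M} {w : G} (x : M)
    (hφ : MDifferentiableAt 𝓘(ℝ, G) 𝓘(ℝ, E) φ w) (hx : φ w ∈ (chartAt E x).source) :
    pull Ω φ w = (coordExpr Ω x ((chartAt E x ∘ φ) w)).bilinearComp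
      (fderiv ℝ (chartAt E x ∘ φ) w) (fderiv ℝ (chartAt E x ∘ φ) w) := by
  ext u v
  rw [pull_apply, rdiff_eq_chartAt_symm_comp_fderiv x hφ hx]
  simp only [coordExpr, Function.comp_apply, ContinuousLinearMap.bilinearComp_apply,
    ContinuousLinearMap.comp_apply, (chartAt E x).left_inv hx]
  rfl

theorem pull_eventuallyEq [IsManifold 𝓘(ℝ, E) 1 M] (Ω : BilinField E M) {φ : G → M} {w : G}
    (hφ : ContMDiffAt 𝓘(ℝ, G) 𝓘(ℝ, E) 1 φ w) (x : M) (hx : φ w ∈ (chartAt E x).source) :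
    pull Ω φ =ᶠ[𝓝 w] fun w => (coordExpr Ω x ((chartAt E x ∘ φ) w)).bilinearComp
      (fderiv ℝ (chartAt E x ∘ φ) w) (fderiv ℝ (chartAt E x ∘ φ) w) := by
  filter_upwards [(contMDiffAt_iff_contMDiffAt_nhds (by simp)).1 hφ,
    hφ.continuousAt ((chartAt E x).open_source.mem_nhds hx)] with w' hw' hx'
  exact pull_eq_coordExpr Ω x (hw'.mdifferentiableAt (by simp)) hx'

variable [IsManifold 𝓘(ℝ, E) ∞ M] {Ω : BilinField E M} {φ : G → M} {w : G}

theorem IsKahler.pull_contDiffAt (h : IsKahler Ω) (hφ : ContMDiffAt 𝓘(ℝ, G) 𝓘(ℝ, E) ∞ φ w) :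
    ContDiffAt ℝ ∞ (pull Ω φ) w := by
  have hx := mem_chart_source E (φ w)
  have hχ := contDiffAt_chartAt_comp (φ w) hφ hx
  have hΩ : ContDiffAt ℝ ∞ (coordExpr Ω (φ w) ∘ (chartAt E (φ w) ∘ φ)) w :=
    (h.coordExpr_contDiffAt (φ w) ((chartAt E (φ w)).map_source hx)).comp w hχ
  exact (contDiffAt_bilinearComp hΩ (hχ.fderiv_right (by simp))).congr_of_eventuallyEq
    (pull_eventuallyEq Ω (hφ.of_le ENat.LEInfty.out) (φ w) hx)

theorem IsKahler.pull_closed (h : IsKahler Ω) (hφ : ContMDiffAt 𝓘(ℝ, G) 𝓘(ℝ, E) ∞ φ w)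
    (u v v' : G) :
    fderiv ℝ (pull Ω φ) w u v v' + fderiv ℝ (pull Ω φ) w v v' u
      + fderiv ℝ (pull Ω φ) w v' u v = 0 := by
  have hx := mem_chart_source E (φ w)
  have hχ := contDiffAt_chartAt_comp (φ w) hφ hx
  have ht := (chartAt E (φ w)).map_source hx
  rw [(pull_eventuallyEq Ω (hφ.of_le ENat.LEInfty.out) (φ w) hx).fderiv_eq]
  exact closed_pullback (χ := chartAt E (φ w) ∘ φ)
    ((h.coordExpr_contDiffAt (φ w) ht).differentiableAt (by simp)) (hχ.of_le ENat.LEInfty.out)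
    (fun _ _ => h.antisymm _ _ _) (h.closed (φ w) _ ht) u v v'

theorem IsKahler.fderiv_pull_eq_zero (h : IsKahler Ω) (hφ : ContMDiffAt 𝓘(ℝ, G) 𝓘(ℝ, E) ∞ φ w)
    {ξ : G} (hξ : ∀ s : ℝ, pull Ω φ (w + s • ξ) = pull Ω φ w) : fderiv ℝ (pull Ω φ) w ξ = 0 := by
  rw [← ((h.pull_contDiffAt hφ).differentiableAt (by simp)).lineDeriv_eq_fderiv, lineDeriv]
  simp [hξ]

-- Cartan's formula: `d (ξ ⌟ Ω) = L_ξ Ω - ξ ⌟ dΩ = 0`.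
theorem IsKahler.fderiv_pull_contract_symm (h : IsKahler Ω)
    (hφ : ContMDiffAt 𝓘(ℝ, G) 𝓘(ℝ, E) ∞ φ w) {ξ : G}
    (hξ : ∀ s : ℝ, pull Ω φ (w + s • ξ) = pull Ω φ w) (u v : G) :
    fderiv ℝ (pull Ω φ) w u ξ v = fderiv ℝ (pull Ω φ) w v ξ u := by
  have hd := (h.pull_contDiffAt hφ).differentiableAt (by simp)
  have hanti : fderiv ℝ (pull Ω φ) w u v ξ = - fderiv ℝ (pull Ω φ) w u ξ v := by
    rw [← fderiv_clm_apply₂_const hd, ← fderiv_clm_apply₂_const hd, ← neg_apply, ← fderiv_fun_neg]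
    exact congrArg (fun f => fderiv ℝ f w u) (funext fun w' => h.pull_antisymm φ w' v ξ)
  have hclosed := h.pull_closed hφ ξ u v
  rw [h.fderiv_pull_eq_zero hφ hξ] at hclosed
  simp only [zero_apply] at hclosed
  linarith

theorem IsKahler.exists_primitive_contract (h : IsKahler Ω) {C : Set G} (hC : Convex ℝ C)
    (hCo : IsOpen C) (hφ : ∀ w ∈ C, ContMDiffAt 𝓘(ℝ, G) 𝓘(ℝ, E) ∞ φ w) {ξ : G}
    (hξ : ∀ w ∈ C, ∀ s : ℝ, pull Ω φ (w + s • ξ) = pull Ω φ w) :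
    ∃ g : G → ℝ, ContDiffOn ℝ ∞ g C ∧ ∀ w ∈ C, HasFDerivAt g (-(pull Ω φ w ξ)) w := by
  have hpull : ContDiffOn ℝ ∞ (fun w => -(pull Ω φ w ξ)) C := fun w hw =>
    ((h.pull_contDiffAt (hφ w hw)).clm_apply contDiffAt_const).neg.contDiffWithinAt
  have hd : ∀ w ∈ C, DifferentiableAt ℝ (pull Ω φ) w := fun w hw =>
    (h.pull_contDiffAt (hφ w hw)).differentiableAt (by simp)
  obtain ⟨g, hg⟩ := hC.exists_forall_hasFDerivAt_of_fderiv_symmetric hCo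
    (hpull.differentiableOn (by simp)) fun w hw u v => by
      have hw' := (hd w hw).clm_apply (differentiableAt_const ξ)
      simp only [fderiv_fun_neg, neg_apply, neg_inj]
      rw [← fderiv_clm_apply_const hw', ← fderiv_clm_apply_const hw',
        fderiv_clm_apply₂_const (hd w hw), fderiv_clm_apply₂_const (hd w hw),
        h.fderiv_pull_contract_symm (hφ w hw) (hξ w hw)]
  refine ⟨g, (contDiffOn_infty_iff_fderiv_of_isOpen hCo).2
    ⟨fun w hw => (hg w hw).differentiableAt.differentiableWithinAt, ?_⟩, hg⟩
  exact hpull.congr fun w hw => (hg w hw).fderiv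

end Pullback

section Constancy

variable {E : Type*} [NormedAddCommGroup E] [NormedSpace ℝ E]
  {F : Type*} [NormedAddCommGroup F] [NormedSpace ℝ F]
  {M : Type*} [TopologicalSpace M] [ChartedSpace E M] [IsManifold 𝓘(ℝ, E) 1 M]
  {N : Type*} [TopologicalSpace N] [ChartedSpace F N] [IsManifold 𝓘(ℝ, F) 1 N]

theorem eventually_eq_of_rdiff_eq_zero {φ : M → N} {p : M}
    (h : ∀ᶠ q in 𝓝 p, MDifferentiableAt 𝓘(ℝ, E) 𝓘(ℝ, F) φ q ∧ rdiff E F φ q = 0) :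
    ∀ᶠ q in 𝓝 p, φ q = φ p := by
  set e := chartAt E p
  set e' := chartAt F (φ p)
  have hp : p ∈ e.source := mem_chart_source E p
  have hφp : φ p ∈ e'.source := mem_chart_source F (φ p)
  have hsource : ∀ᶠ q in 𝓝 p, φ q ∈ e'.source :=
    h.self_of_nhds.1.continuousAt (e'.open_source.mem_nhds hφp)
  have he : Filter.Tendsto e.symm (𝓝 (e p)) (𝓝 p) := by
    simpa only [ContinuousAt, e.left_inv hp] using e.continuousAt_symm (e.map_source hp)
  have hd : ∀ᶠ y in 𝓝 (e p), HasFDerivAt (e' ∘ φ ∘ e.symm) (0 : E →L[ℝ] F) y := by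
    filter_upwards [e.open_target.mem_nhds (e.map_source hp), he.eventually h,
      he.eventually hsource] with y hy hφ hy'
    have he' := mdifferentiableAt_chartAt (φ p) hy'
    have hφe := hφ.1.comp y (mdifferentiableAt_chartAt_symm p hy)
    have hm : MDifferentiableAt 𝓘(ℝ, E) 𝓘(ℝ, F) (e' ∘ φ ∘ e.symm) y :=
      MDifferentiableAt.comp (I' := 𝓘(ℝ, F)) y he' hφe
    have hz : rdiff E F (e' ∘ φ ∘ e.symm) y = 0 := by
      rw [rdiff_comp (F := F) y he' hφe,
        rdiff_comp y hφ.1 (mdifferentiableAt_chartAt_symm p hy), hφ.2,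
        ContinuousLinearMap.zero_comp, ContinuousLinearMap.comp_zero]
    rw [← hz, rdiff_eq_fderiv]
    exact hm.differentiableAt.hasFDerivAt
  obtain ⟨r, hr, hB⟩ := Metric.eventually_nhds_iff_ball.1 hd
  filter_upwards [e.continuousAt hp (Metric.ball_mem_nhds _ hr), e.open_source.mem_nhds hp,
    hsource] with q hq hqe hqe'
  have hconst := Metric.isOpen_ball.is_const_of_fderiv_eq_zero (𝕜 := ℝ)
    (convex_ball (e p) r).isPreconnected
    (fun y hy => (hB y hy).differentiableAt.differentiableWithinAt) (fun y hy => (hB y hy).fderiv)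
    hq (Metric.mem_ball_self hr)
  simp only [Function.comp_apply, e.left_inv hqe, e.left_inv hp] at hconst
  exact e'.injOn hqe' hφp hconst

theorem sub_eq_sub_of_rdiff_eq {f g : M → ℝ} {U : Set M} (hU : IsOpen U) (hc : IsPreconnected U)
    (hf : ∀ q ∈ U, MDifferentiableAt 𝓘(ℝ, E) 𝓘(ℝ, ℝ) f q)
    (hg : ∀ q ∈ U, MDifferentiableAt 𝓘(ℝ, E) 𝓘(ℝ, ℝ) g q)
    (h : ∀ q ∈ U, rdiff E ℝ f q = rdiff E ℝ g q) {p q : M} (hp : p ∈ U) (hq : q ∈ U) :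
    f p - g p = f q - g q := by
  refine hc.induction₂ (fun p q => f p - g p = f q - g q) (fun x hx => ?_)
    (fun x y z _ _ _ => Eq.trans) (fun x y _ _ => Eq.symm) hp hq
  have hlocal : ∀ᶠ y in 𝓝 x, (f - g) y = (f - g) x := by
    refine eventually_eq_of_rdiff_eq_zero (E := E) (F := ℝ) ?_
    filter_upwards [hU.mem_nhds hx] with y hy
    have hsub : rdiff E ℝ (f - g) y = rdiff E ℝ f y - rdiff E ℝ g y :=
      mfderiv_sub (hf y hy) (hg y hy)
    exact ⟨(hf y hy).sub (hg y hy), by rw [hsub, h y hy, sub_self]⟩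
  filter_upwards [hlocal.filter_mono nhdsWithin_le_nhds] with y hy using hy.symm

end Constancy

section LocalInverse

variable {E : Type*} [NormedAddCommGroup E] [NormedSpace ℝ E]
  {F : Type*} [NormedAddCommGroup F] [NormedSpace ℝ F]
  {G : Type*} [NormedAddCommGroup G] [NormedSpace ℝ G] [CompleteSpace G]
  {M : Type*} [TopologicalSpace M] [ChartedSpace E M] [IsManifold 𝓘(ℝ, E) 1 M]
  {N : Type*} [TopologicalSpace N] [ChartedSpace F N]

theorem exists_localInverse {φ : G → M} {w : G} (hφ : ContMDiffAt 𝓘(ℝ, G) 𝓘(ℝ, E) 1 φ w)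
    {A : G ≃L[ℝ] E} (hA : rdiff G E φ w = A) :
    ∃ ψ : M → G, ψ (φ w) = w ∧ MDifferentiableAt 𝓘(ℝ, E) 𝓘(ℝ, G) ψ (φ w) ∧
      ∀ᶠ q in 𝓝 (φ w), φ (ψ q) = q := by
  set e := chartAt E (φ w)
  have he : φ w ∈ e.source := mem_chart_source E (φ w)
  have hχ : ContDiffAt ℝ 1 (e ∘ φ) w := contDiffAt_chartAt_comp (φ w) hφ he
  let B : E ≃L[ℝ] E := (mdifferentiable_chart (I := 𝓘(ℝ, E)) (φ w)).mfderiv he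
  have hB : fderiv ℝ (e ∘ φ) w = (A.trans B : G ≃L[ℝ] E) := by
    rw [← rdiff_eq_fderiv, rdiff_comp w (mdifferentiableAt_chartAt (φ w) he)
      (hφ.mdifferentiableAt (by simp)), hA]
    rfl
  have hs : HasStrictFDerivAt (e ∘ φ) (A.trans B : G →L[ℝ] E) w := by
    rw [← hB]
    exact hχ.hasStrictFDerivAt (by simp)
  set g := hs.localInverse
  have hg : g (e (φ w)) = w := hs.localInverse_apply_image
  have hgd : DifferentiableAt ℝ g (e (φ w)) := hs.to_localInverse.hasFDerivAt.differentiableAt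
  refine ⟨g ∘ e, hg, hgd.mdifferentiableAt.comp (φ w) (mdifferentiableAt_chartAt (φ w) he), ?_⟩
  have hinv : ∀ᶠ q in 𝓝 (φ w), e (φ (g (e q))) = e q :=
    (e.continuousAt he).eventually hs.eventually_right_inverse
  have hmem : ∀ᶠ q in 𝓝 (φ w), φ (g (e q)) ∈ e.source := by
    have hφg : ContinuousAt φ (g (e (φ w))) := by rw [hg]; exact hφ.continuousAt
    have hge : ContinuousAt (fun q => g (e q)) (φ w) :=
      ContinuousAt.comp (g := g) hgd.continuousAt (e.continuousAt he)
    refine (ContinuousAt.comp (g := φ) (f := fun q => g (e q)) hφg hge).eventually_mem ?_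
    simp only [Function.comp_apply, hg]
    exact e.open_source.mem_nhds he
  filter_upwards [hinv, hmem, e.open_source.mem_nhds he] with q hq hq' hqe
  exact e.injOn hq' hqe hq

theorem rdiff_eq_of_comp {φ : G → M} {w : G} (hφ : ContMDiffAt 𝓘(ℝ, G) 𝓘(ℝ, E) 1 φ w)
    {A : G ≃L[ℝ] E} (hA : rdiff G E φ w = A) {f : M → N} {L : E →L[ℝ] F}
    (hf : MDifferentiableAt 𝓘(ℝ, G) 𝓘(ℝ, F) (f ∘ φ) w)
    (hL : rdiff G F (f ∘ φ) w = L.comp (A : G →L[ℝ] E)) :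
    MDifferentiableAt 𝓘(ℝ, E) 𝓘(ℝ, F) f (φ w) ∧ rdiff E F f (φ w) = L := by
  obtain ⟨ψ, hψw, hψ, hinv⟩ := exists_localInverse hφ hA
  have hfψ : f =ᶠ[𝓝 (φ w)] (f ∘ φ) ∘ ψ := by
    filter_upwards [hinv] with q hq using (congrArg f hq).symm
  have hfd : MDifferentiableAt 𝓘(ℝ, E) 𝓘(ℝ, F) f (φ w) := by
    refine MDifferentiableAt.congr_of_eventuallyEq ?_ hfψ
    exact MDifferentiableAt.comp (φ w) (by rwa [hψw]) hψ
  refine ⟨hfd, ?_⟩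
  rw [rdiff_comp w hfd (hφ.mdifferentiableAt (by simp)), hA] at hL
  ext v
  obtain ⟨u, rfl⟩ := A.surjective v
  exact DFunLike.congr_fun hL u

end LocalInverse

section Zeros

theorem isPreconnected_diff_countable {V : Type*} [NormedAddCommGroup V] [NormedSpace ℝ V]
    (hV : 1 < Module.rank ℝ V) {D Z : Set V} (hD : IsOpen D)
    (hconv : Convex ℝ D) (hbdd : Bornology.IsBounded D) (hZ : Z.Countable) :
    IsPreconnected (D \ Z) := by
  rcases D.eq_empty_or_nonempty with rfl | hne
  · simpa using isPreconnected_empty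
  obtain ⟨h, hh, -, -⟩ := exists_homeomorph_image_interior_closure_frontier_eq_unitBall hconv
    (by rwa [hD.interior_eq]) hbdd
  rw [hD.interior_eq] at hh
  let u : OpenPartialHomeomorph V V := .univUnitBall
  let g : V → V := h.symm ∘ u
  have hg : Continuous g := h.symm.continuous.comp (continuousOn_univ.1 u.continuousOn)
  have hinj : Function.Injective g := h.symm.injective.comp (Set.injOn_univ.1 u.injOn)
  have hrange : Set.range g = D := by
    have hu : Set.range u = Metric.ball 0 1 := by
      rw [← Set.image_univ]
      exact u.image_source_eq_target
    rw [Set.range_comp, hu, ← hh]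
    exact h.toEquiv.symm_image_image D
  have himage : D \ Z = g '' (g ⁻¹' Z)ᶜ := by
    rw [← hrange, ← Set.preimage_compl, Set.image_preimage_eq_range_inter, Set.sdiff_eq]
  rw [himage]
  exact ((hZ.preimage_of_injOn hinj.injOn).isConnected_compl_of_one_lt_rank
    hV).isPreconnected.image g hg.continuousOn

theorem countable_zeros {D : Set ℂ} (hD : IsOpen D) (hconn : IsPreconnected D) {g : ℂ → ℂ}
    (hg : DifferentiableOn ℂ g D) {z : ℂ} (hz : z ∈ D) (hgz : g z ≠ 0) :
    (D ∩ g ⁻¹' {0}).Countable := by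
  have hdisc : (D ∩ g ⁻¹' {0})ᶜ ∈ Filter.codiscreteWithin D := by
    filter_upwards [AnalyticOnNhd.preimage_zero_mem_codiscreteWithin (hg.analyticOnNhd hD) hgz hz
      ⟨⟨z, hz⟩, hconn⟩] with w hw hw'
    exact hw hw'.2
  have := isDiscrete_of_codiscreteWithin hdisc
  rw [Set.inter_eq_left.2 Set.inter_subset_left] at this
  exact (HereditarilyLindelofSpace.isLindelof _).countable_of_isDiscrete this

theorem isPreconnected_inter_ne_zero {V : Type*} [NormedAddCommGroup V] [NormedSpace ℂ V]
    {B : Set V} (hB : IsOpen B) (hconv : Convex ℝ B) {g : V → ℂ} (hg : DifferentiableOn ℂ g B) :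
    IsPreconnected (B ∩ {y | g y ≠ 0}) := by
  refine isPreconnected_of_forall_pair fun y₀ hy₀ y₁ hy₁ => ?_
  let ℓ : ℂ → V := fun ζ => y₀ + ζ • (y₁ - y₀)
  have hℓ : Differentiable ℂ ℓ := by fun_prop
  have hℓ₀ : ℓ 0 = y₀ := by simp [ℓ]
  have hℓ₁ : ℓ 1 = y₁ := by simp [ℓ]
  let D : Set ℂ := ℓ ⁻¹' B ∩ Metric.ball 0 2
  have hD : IsOpen D := (hB.preimage hℓ.continuous).inter Metric.isOpen_ball
  have hDconv : Convex ℝ D := by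
    refine Convex.inter ?_ (convex_ball 0 2)
    exact (hconv.translate_preimage_right y₀).linear_preimage
      ((LinearMap.toSpanSingleton ℂ V (y₁ - y₀)).restrictScalars ℝ)
  have hgℓ : DifferentiableOn ℂ (g ∘ ℓ) D :=
    hg.comp hℓ.differentiableOn fun ζ hζ => hζ.1
  have h₀ : (0 : ℂ) ∈ D := ⟨by simpa [hℓ₀] using hy₀.1, by simp⟩
  have h₁ : (1 : ℂ) ∈ D := ⟨by simpa [hℓ₁] using hy₁.1, by simp⟩
  have hZ := countable_zeros hD hDconv.isPreconnected hgℓ h₀ (by simpa [hℓ₀] using hy₀.2)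
  have hconn := isPreconnected_diff_countable (by simp [Complex.rank_real_complex]) hD hDconv
    (Metric.isBounded_ball.subset Set.inter_subset_right) hZ
  refine ⟨ℓ '' (D \ (D ∩ (g ∘ ℓ) ⁻¹' {0})), ?_, ⟨0, ⟨h₀, fun h => hy₀.2 ?_⟩, hℓ₀⟩,
    ⟨1, ⟨h₁, fun h => hy₁.2 ?_⟩, hℓ₁⟩, hconn.image ℓ hℓ.continuous.continuousOn⟩
  · rintro - ⟨ζ, hζ, rfl⟩
    exact ⟨hζ.1.1, fun h => hζ.2 ⟨hζ.1, h⟩⟩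
  · simpa [hℓ₀] using h.2
  · simpa [hℓ₁] using h.2

end Zeros

section TorusExp

variable {n : ℕ}

theorem torusExp_zero : torusExp (0 : Fin n → ℂ) = 1 := by
  ext j; simp [torusExp]

theorem torusExp_add (w w' : Fin n → ℂ) : torusExp (w + w') = torusExp w * torusExp w' := by
  ext j; simp [torusExp, Complex.exp_add]

theorem torusExp_surjective : Function.Surjective (torusExp : (Fin n → ℂ) → Fin n → ℂˣ) := by
  intro t
  refine ⟨fun j => Complex.log (t j), ?_⟩
  ext j
  simp [torusExp, Complex.exp_log (t j).ne_zero]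

/-- The vector `i c` of the Lie algebra `ℂⁿ` of the complex torus; these vectors form the Lie
algebra of the real torus. -/
def imagVec (c : Fin n → ℝ) : Fin n → ℂ := fun j => (c j : ℂ) * Complex.I

/-- The vector `c` of the Lie algebra `ℂⁿ` of the complex torus, generating a real one-parameter
group that expands or contracts. -/
def realVec (c : Fin n → ℝ) : Fin n → ℂ := fun j => (c j : ℂ)

theorem imagVec_smul (s : ℝ) (c : Fin n → ℝ) : imagVec (s • c) = s • imagVec c := by
  ext j; simp [imagVec, mul_assoc]

theorem J_realVec (c : Fin n → ℝ) : J (Fin n → ℂ) (realVec c) = imagVec c := by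
  ext j; simp [imagVec, realVec, J, mul_comm]

theorem torusExp_imagVec (c : Fin n → ℝ) :
    torusExp (imagVec c) = realTorus (fun j => Circle.exp (c j)) := by
  ext j; simp [torusExp, imagVec, realTorus]

theorem exists_torusExp_eq_realTorus (t : Fin n → Circle) :
    ∃ c : Fin n → ℝ, torusExp (imagVec c) = realTorus t := by
  refine ⟨fun j => Complex.arg (t j), ?_⟩
  rw [torusExp_imagVec]
  congr 1
  ext j
  simp

theorem exists_imagVec_of_torusExp_eq_one {w : Fin n → ℂ} (h : torusExp w = 1) :
    ∃ c : Fin n → ℝ, w = imagVec c := by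
  refine ⟨fun j => (w j).im, ?_⟩
  ext j
  have hexp : Complex.exp (w j) = 1 := by
    simpa [torusExp] using congrArg Units.val (congrFun h j)
  obtain ⟨m, hm⟩ := Complex.exp_eq_one_iff.1 hexp
  have hre : (w j).re = 0 := by rw [hm]; simp
  apply Complex.ext <;> simp [imagVec, hre]

theorem eq_zero_of_torusExp_smul_eq_one {k : Fin n → ℂ}
    (h : ∀ s : ℝ, torusExp (s • k) = 1) : k = 0 := by
  ext j
  have hconst : ∀ s : ℝ, Complex.exp ((s : ℂ) * k j) = 1 := fun s => by
    simpa [torusExp] using congrArg Units.val (congrFun (h s) j)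
  have hderiv : HasDerivAt (fun s : ℝ => Complex.exp ((s : ℂ) * k j)) (k j) 0 := by
    have hlin : HasDerivAt (fun s : ℝ => (s : ℂ) * k j) (k j) 0 := by
      simpa using (Complex.ofRealCLM.hasDerivAt (x := (0 : ℝ))).mul_const (k j)
    simpa using hlin.cexp
  simp_rw [hconst] at hderiv
  exact hderiv.unique (hasDerivAt_const _ _)

end TorusExp

section OrbitMap

variable {n : ℕ} {M : Type*} [MulAction (Fin n → ℂˣ) M]

/-- The orbit map of `p`, composed with the exponential map of the torus. -/
def orbitMap (p : M) (w : Fin n → ℂ) : M := torusExp w • p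

theorem orbitMap_zero (p : M) : orbitMap p (0 : Fin n → ℂ) = p := by
  simp [orbitMap, torusExp_zero]

theorem orbitMap_add (p : M) (w w' : Fin n → ℂ) :
    orbitMap p (w + w') = torusExp w • orbitMap p w' := by
  simp [orbitMap, torusExp_add, mul_smul]

theorem orbitMap_orbitMap (p : M) (w w' : Fin n → ℂ) :
    orbitMap (orbitMap p w) w' = orbitMap p (w + w') := by
  rw [add_comm, orbitMap_add]
  rfl

theorem orbitMap_sub_eq {p : M} {w w' : Fin n → ℂ} (h : orbitMap p w = orbitMap p w') :
    orbitMap p (w - w') = p := by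
  rw [sub_eq_add_neg, ← orbitMap_orbitMap, h, orbitMap_orbitMap, add_neg_cancel, orbitMap_zero]

theorem mem_orbit_iff_orbitMap {p q : M} :
    q ∈ MulAction.orbit (Fin n → ℂˣ) p ↔ ∃ w : Fin n → ℂ, orbitMap p w = q := by
  constructor
  · rintro ⟨t, rfl⟩
    obtain ⟨w, rfl⟩ := torusExp_surjective t
    exact ⟨w, rfl⟩
  · rintro ⟨w, rfl⟩
    exact ⟨torusExp w, rfl⟩

end OrbitMap

section Action

variable {n : ℕ} {E : Type*} [NormedAddCommGroup E] [NormedSpace ℂ E]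
  {M : Type*} [TopologicalSpace M] [ChartedSpace E M] [MulAction (Fin n → ℂˣ) M]

/-- The action of the torus, composed with its exponential map, in the chart at `x` on `M`. -/
def actChart (x : M) (q : (Fin n → ℂ) × E) : M := torusExp q.1 • (chartAt E x).symm q.2

theorem IsToric.contMDiff_orbitMap (hM : IsToric n E M) (p : M) :
    ContMDiff 𝓘(ℂ, Fin n → ℂ) 𝓘(ℂ, E) ω (orbitMap p : (Fin n → ℂ) → M) :=
  hM.holomorphic.comp (contMDiff_id.prodMk contMDiff_const)

theorem IsToric.contMDiff_smul (hM : IsToric n E M) (w : Fin n → ℂ) :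
    ContMDiff 𝓘(ℂ, E) 𝓘(ℂ, E) ω (fun q : M => torusExp w • q) :=
  hM.holomorphic.comp (contMDiff_const.prodMk contMDiff_id)

theorem IsToric.contMDiffAt_actChart [IsManifold 𝓘(ℂ, E) ω M] (hM : IsToric n E M) (x : M)
    {q : (Fin n → ℂ) × E} (hq : q.2 ∈ (chartAt E x).target) :
    ContMDiffAt 𝓘(ℂ, (Fin n → ℂ) × E) 𝓘(ℂ, E) ω (actChart x) q := by
  have hfst : ContMDiffAt 𝓘(ℂ, (Fin n → ℂ) × E) 𝓘(ℂ, Fin n → ℂ) ω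
      (Prod.fst : (Fin n → ℂ) × E → _) q := contDiff_fst.contMDiff.contMDiffAt
  have hsnd : ContMDiffAt 𝓘(ℂ, (Fin n → ℂ) × E) 𝓘(ℂ, E) ω
      (Prod.snd : (Fin n → ℂ) × E → _) q := contDiff_snd.contMDiff.contMDiffAt
  have hsymm : ContMDiffAt 𝓘(ℂ, E) 𝓘(ℂ, E) ω (chartAt E x).symm q.2 :=
    contMDiffOn_chart_symm.contMDiffAt ((chartAt E x).open_target.mem_nhds hq)
  exact (hM.holomorphic.contMDiffAt (x := (q.1, (chartAt E x).symm q.2))).comp q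
    (hfst.prodMk (hsymm.comp q hsnd))

theorem IsToric.smooth_orbitMap (hM : IsToric n E M) (p : M) (w : Fin n → ℂ) :
    ContMDiffAt 𝓘(ℝ, Fin n → ℂ) 𝓘(ℝ, E) ∞ (orbitMap p : (Fin n → ℂ) → M) w :=
  (contMDiffAt_restrictScalars (hM.contMDiff_orbitMap p w)).of_le le_top

theorem IsToric.mdifferentiableAt_orbitMap (hM : IsToric n E M) (p : M) (w : Fin n → ℂ) :
    MDifferentiableAt 𝓘(ℝ, Fin n → ℂ) 𝓘(ℝ, E) (orbitMap p : (Fin n → ℂ) → M) w :=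
  (hM.smooth_orbitMap p w).mdifferentiableAt (by simp)

theorem IsToric.mdifferentiableAt_smul (hM : IsToric n E M) (w : Fin n → ℂ) (p : M) :
    MDifferentiableAt 𝓘(ℝ, E) 𝓘(ℝ, E) (fun q : M => torusExp w • q) p :=
  (contMDiffAt_restrictScalars (hM.contMDiff_smul w p)).mdifferentiableAt (by simp)

theorem IsToric.continuous_smul (hM : IsToric n E M) (w : Fin n → ℂ) :
    Continuous (fun q : M => torusExp w • q) := (hM.contMDiff_smul w).continuous

theorem IsToric.smooth_actChart [IsManifold 𝓘(ℂ, E) ω M] (hM : IsToric n E M) (x : M)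
    {q : (Fin n → ℂ) × E} (hq : q.2 ∈ (chartAt E x).target) :
    ContMDiffAt 𝓘(ℝ, (Fin n → ℂ) × E) 𝓘(ℝ, E) ∞ (actChart x) q :=
  (contMDiffAt_restrictScalars (hM.contMDiffAt_actChart x hq)).of_le le_top

theorem rdiff_line {G : Type*} [NormedAddCommGroup G] [NormedSpace ℝ G] {φ : G → M} {w : G}
    (hφ : MDifferentiableAt 𝓘(ℝ, G) 𝓘(ℝ, E) φ w) (ξ : G) :
    rdiff ℝ E (fun s : ℝ => φ (w + s • ξ)) 0 1 = rdiff G E φ w ξ := by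
  have hline : HasFDerivAt (fun s : ℝ => w + s • ξ) ((1 : ℝ →L[ℝ] ℝ).smulRight ξ) 0 :=
    ((hasFDerivAt_id (0 : ℝ)).smul_const ξ).const_add w
  have hcomp := rdiff_comp (g := φ) (f := fun s : ℝ => w + s • ξ) (0 : ℝ) (by simpa using hφ)
    hline.differentiableAt.mdifferentiableAt
  rw [rdiff_eq_fderiv, hline.fderiv, zero_smul, add_zero] at hcomp
  simpa only [Function.comp_def, ContinuousLinearMap.comp_apply,
    ContinuousLinearMap.smulRight_apply, one_apply_eq_self, one_smul] using
    DFunLike.congr_fun hcomp 1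

theorem torusField_eq (b : Fin n → ℝ) (p : M) :
    torusField (E := E) b p = rdiff ℝ E (fun s : ℝ => orbitMap p (s • imagVec b)) 0 1 := by
  simp_rw [← imagVec_smul]
  rfl

theorem IsToric.rdiff_orbitMap_imagVec (hM : IsToric n E M) (p : M) (w : Fin n → ℂ)
    (c : Fin n → ℝ) :
    rdiff (Fin n → ℂ) E (orbitMap p) w (imagVec c) = torusField c (orbitMap p w) := by
  rw [torusField_eq, ← rdiff_line (hM.mdifferentiableAt_orbitMap p w)]
  simp_rw [orbitMap_orbitMap]

theorem IsToric.rdiff_orbitMap_orbitMap (hM : IsToric n E M) (p : M) (w : Fin n → ℂ) :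
    rdiff (Fin n → ℂ) E (orbitMap (orbitMap p w)) (0 : Fin n → ℂ)
      = rdiff (Fin n → ℂ) E (orbitMap p) w := by
  ext v
  rw [← rdiff_line (hM.mdifferentiableAt_orbitMap p w),
    ← rdiff_line (hM.mdifferentiableAt_orbitMap _ 0)]
  simp_rw [orbitMap_orbitMap, zero_add]

theorem IsToric.rdiff_orbitMap_J (hM : IsToric n E M) (p : M) (w v : Fin n → ℂ) :
    rdiff (Fin n → ℂ) E (orbitMap p) w (J _ v) = J E (rdiff (Fin n → ℂ) E (orbitMap p) w v) :=
  rdiff_J ((hM.contMDiff_orbitMap p w).mdifferentiableAt (by simp)) v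

theorem J_J {V : Type*} [NormedAddCommGroup V] [NormedSpace ℂ V] (v : V) :
    J V (J V v) = - v := by
  simp [J, smul_smul]

theorem J_injective {V : Type*} [NormedAddCommGroup V] [NormedSpace ℂ V] :
    Function.Injective (J V) := fun u v h => by
  simpa [J_J] using congrArg (J V) h

theorem IsToric.rdiff_orbitMap_realVec (hM : IsToric n E M) (p : M) (w : Fin n → ℂ)
    {X : VField E M} {b : Fin n → ℝ} (hb : (fun p => J E (X p)) = torusField b) :
    rdiff (Fin n → ℂ) E (orbitMap p) w (realVec b) = X (orbitMap p w) := by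
  apply J_injective
  rw [← hM.rdiff_orbitMap_J, J_realVec, hM.rdiff_orbitMap_imagVec, ← hb]

theorem IsToric.rdiff_actChart_imagVec [IsManifold 𝓘(ℂ, E) ω M] (hM : IsToric n E M) (x : M)
    {y : E} (hy : y ∈ (chartAt E x).target) (c : Fin n → ℝ) :
    rdiff ((Fin n → ℂ) × E) E (actChart (n := n) x) (0, y) (imagVec c, 0)
      = torusField c ((chartAt E x).symm y) := by
  rw [torusField_eq, ← rdiff_line ((hM.smooth_actChart x hy).mdifferentiableAt (by simp))]
  simp [actChart, orbitMap]

theorem IsToric.rdiff_actChart_snd [IsManifold 𝓘(ℂ, E) ω M] (hM : IsToric n E M) (x : M)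
    {y : E} (hy : y ∈ (chartAt E x).target) (v : E) :
    rdiff ((Fin n → ℂ) × E) E (actChart (n := n) x) (0, y) (0, v)
      = rdiff E E (chartAt E x).symm y v := by
  rw [← rdiff_line ((hM.smooth_actChart x hy).mdifferentiableAt (by simp)),
    ← rdiff_line (mdifferentiableAt_chartAt_symm x hy)]
  simp [actChart, torusExp_zero]

theorem IsToric.pull_translate (hM : IsToric n E M) {Ω : BilinField E M}
    (hinv : TorusInvariantForm n Ω) {G : Type*} [NormedAddCommGroup G] [NormedSpace ℝ G]
    {φ : G → M} {w ξ : G} {c : Fin n → ℝ} (hφ : MDifferentiableAt 𝓘(ℝ, G) 𝓘(ℝ, E) φ w)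
    (hc : ∀ w, φ (w + ξ) = torusExp (imagVec c) • φ w) :
    pull Ω φ (w + ξ) = pull Ω φ w := by
  have hφξ : φ = (fun q => torusExp (imagVec c) • q) ∘ φ ∘ fun w => w - ξ := by
    ext w
    simp [← hc]
  have hsub : HasFDerivAt (fun w => w - ξ) (ContinuousLinearMap.id ℝ G) (w + ξ) :=
    (hasFDerivAt_id _).sub_const ξ
  have hw : w + ξ - ξ = w := by abel
  have hrdiff : rdiff G E φ (w + ξ) =
      (rdiff E E (fun q : M => torusExp (imagVec c) • q) (φ w)).comp (rdiff G E φ w) := by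
    conv_lhs => rw [hφξ]
    have hφ' : MDifferentiableAt 𝓘(ℝ, G) 𝓘(ℝ, E) φ ((fun w => w - ξ) (w + ξ)) := by
      simpa only [hw] using hφ
    have hsub' := hsub.differentiableAt.mdifferentiableAt
    rw [rdiff_comp (w + ξ) (hM.mdifferentiableAt_smul _ _) (hφ'.comp (w + ξ) hsub'),
      rdiff_comp (w + ξ) hφ' hsub', rdiff_eq_fderiv, hsub.fderiv, ContinuousLinearMap.comp_id]
    simp only [Function.comp_apply, hw]
  ext u v
  rw [pull_apply, pull_apply, hrdiff, hc, torusExp_imagVec]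
  exact hinv _ _ _ _

theorem IsToric.pull_orbitMap_translate (hM : IsToric n E M) {Ω : BilinField E M}
    (hinv : TorusInvariantForm n Ω) (p : M) (w : Fin n → ℂ) (c : Fin n → ℝ) (s : ℝ) :
    pull Ω (orbitMap p) (w + s • imagVec c) = pull Ω (orbitMap p) w := by
  rw [← imagVec_smul]
  exact hM.pull_translate hinv (c := s • c) (hM.mdifferentiableAt_orbitMap p w) fun w => by
    rw [add_comm, orbitMap_add]

theorem IsToric.pull_actChart_translate [IsManifold 𝓘(ℂ, E) ω M] (hM : IsToric n E M)
    {Ω : BilinField E M} (hinv : TorusInvariantForm n Ω) (x : M) {q : (Fin n → ℂ) × E}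
    (hq : q.2 ∈ (chartAt E x).target) (c : Fin n → ℝ) (s : ℝ) :
    pull Ω (actChart x) (q + s • (imagVec c, 0)) = pull Ω (actChart x) q := by
  rw [Prod.smul_mk, ← imagVec_smul, smul_zero]
  refine hM.pull_translate hinv (c := s • c)
    ((hM.smooth_actChart x hq).mdifferentiableAt (by simp)) fun w => ?_
  simp only [actChart, Prod.fst_add, Prod.snd_add, add_zero]
  rw [add_comm, torusExp_add, mul_smul]

end Action

section Orbit

variable {n : ℕ} {E : Type*} [NormedAddCommGroup E] [NormedSpace ℂ E]
  {M : Type*} [TopologicalSpace M] [ChartedSpace E M] [MulAction (Fin n → ℂˣ) M]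

theorem IsToric.torusExp_eq_one [T2Space M] (hM : IsToric n E M) {p : M}
    (hp : Dense (MulAction.orbit (Fin n → ℂˣ) p)) {w : Fin n → ℂ} (hw : orbitMap p w = p) :
    torusExp w = 1 := by
  apply hM.effective
  suffices (fun q : M => torusExp w • q) = fun q => q from fun q => congrFun this q
  apply Continuous.ext_on hp (hM.continuous_smul w) continuous_id
  rintro q ⟨t, rfl⟩
  change torusExp w • t • p = t • p
  rw [smul_comm]
  exact congrArg (t • ·) hw

theorem IsToric.rdiff_orbitMap_add (hM : IsToric n E M) (p : M) (w u v : Fin n → ℂ) :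
    rdiff (Fin n → ℂ) E (orbitMap p) (w + u) v
      = rdiff E E (fun q : M => torusExp w • q) (orbitMap p u)
        (rdiff (Fin n → ℂ) E (orbitMap p) u v) := by
  rw [← rdiff_line (hM.mdifferentiableAt_orbitMap p (w + u)),
    ← ContinuousLinearMap.comp_apply,
    ← rdiff_comp u (hM.mdifferentiableAt_smul w _) (hM.mdifferentiableAt_orbitMap p u),
    ← rdiff_line ((hM.mdifferentiableAt_smul w _).comp u (hM.mdifferentiableAt_orbitMap p u))]
  simp only [Function.comp_apply, ← orbitMap_add, add_assoc]

theorem IsToric.exists_equiv_rdiff_orbitMap [FiniteDimensional ℂ E] (hM : IsToric n E M) {p : M}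
    (hp : Function.Injective (rdiff (Fin n → ℂ) E (orbitMap p) (0 : Fin n → ℂ))) :
    ∃ A : (Fin n → ℂ) ≃L[ℝ] E, rdiff (Fin n → ℂ) E (orbitMap p) (0 : Fin n → ℂ) = A := by
  have : FiniteDimensional ℝ E := .trans ℝ ℂ E
  have hrank : Module.finrank ℝ (Fin n → ℂ) = Module.finrank ℝ E := by
    rw [finrank_real_of_complex, finrank_real_of_complex, hM.finrank_eq,
      Module.finrank_fin_fun]
  exact ⟨(LinearEquiv.ofInjectiveOfFinrankEq
    (rdiff (Fin n → ℂ) E (orbitMap p) (0 : Fin n → ℂ)).toLinearMap hp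
    hrank).toContinuousLinearEquiv, rfl⟩

variable {Ω : BilinField E M} [IsManifold 𝓘(ℂ, E) ω M]

theorem IsToric.orbitMap_smul_eq_of_rdiff_eq_zero (hM : IsToric n E M) {p : M} {k : Fin n → ℂ}
    (hk : rdiff (Fin n → ℂ) E (orbitMap p) (0 : Fin n → ℂ) k = 0) (s : ℝ) :
    orbitMap p (s • k) = p := by
  let γ : ℝ → M := fun s => orbitMap p (s • k)
  have hγ : ∀ s, MDifferentiableAt 𝓘(ℝ, ℝ) 𝓘(ℝ, E) γ s := fun s =>
    (hM.mdifferentiableAt_orbitMap p (s • k)).comp s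
      ((differentiableAt_id.smul_const k : DifferentiableAt ℝ (fun s : ℝ => s • k) s)
        |>.mdifferentiableAt)
  have hγ' : ∀ s, rdiff ℝ E γ s = 0 := fun s => by
    have hvel := hM.rdiff_orbitMap_add p (s • k) 0 k
    rw [hk, map_zero, add_zero, ← rdiff_line (hM.mdifferentiableAt_orbitMap p _)] at hvel
    ext
    rw [← rdiff_line (hγ s) 1]
    simpa only [γ, smul_eq_mul, mul_one, add_smul, zero_apply] using hvel
  have hconst : IsLocallyConstant γ := by
    rw [IsLocallyConstant.iff_eventually_eq]
    exact fun s =>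
      eventually_eq_of_rdiff_eq_zero (Filter.Eventually.of_forall fun s => ⟨hγ s, hγ' s⟩)
  have h0 : γ s = γ 0 :=
    hconst.apply_eq_of_isPreconnected isPreconnected_univ (Set.mem_univ s) (Set.mem_univ 0)
  simpa only [γ, zero_smul, orbitMap_zero] using h0

theorem IsToric.rdiff_orbitMap_injective [T2Space M] (hM : IsToric n E M) {p : M}
    (hp : Dense (MulAction.orbit (Fin n → ℂˣ) p)) :
    Function.Injective (rdiff (Fin n → ℂ) E (orbitMap p) (0 : Fin n → ℂ)) := by
  rw [injective_iff_map_eq_zero]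
  intro k hk
  exact eq_zero_of_torusExp_smul_eq_one fun s =>
    hM.torusExp_eq_one hp (hM.orbitMap_smul_eq_of_rdiff_eq_zero hk s)

theorem IsToric.mem_orbit_iff_rdiff_orbitMap_injective [T2Space M] [FiniteDimensional ℂ E]
    (hM : IsToric n E M) {p q : M} (hp : Dense (MulAction.orbit (Fin n → ℂˣ) p)) :
    q ∈ MulAction.orbit (Fin n → ℂˣ) p ↔
      Function.Injective (rdiff (Fin n → ℂ) E (orbitMap q) (0 : Fin n → ℂ)) := by
  refine ⟨fun hq => hM.rdiff_orbitMap_injective (MulAction.orbit_eq_iff.2 hq ▸ hp), fun hq => ?_⟩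
  obtain ⟨A, hA⟩ := hM.exists_equiv_rdiff_orbitMap hq
  obtain ⟨ψ, -, -, hψ⟩ :=
    exists_localInverse ((hM.smooth_orbitMap q 0).of_le ENat.LEInfty.out) hA
  rw [orbitMap_zero] at hψ
  obtain ⟨z, hzp, hz⟩ := hp.inter_nhds_nonempty hψ
  have hzq : z ∈ MulAction.orbit (Fin n → ℂˣ) q := mem_orbit_iff_orbitMap.2 ⟨ψ z, hz⟩
  rw [← MulAction.orbit_eq_iff] at hzp hzq ⊢
  rw [← hzq, hzp]

theorem IsToric.rdiff_eq_of_orbitMap [FiniteDimensional ℂ E] (hM : IsToric n E M) {q : M}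
    (hq : Function.Injective (rdiff (Fin n → ℂ) E (orbitMap q) (0 : Fin n → ℂ))) {f : M → ℝ}
    {L : E →L[ℝ] ℝ}
    (hf : HasFDerivAt (f ∘ orbitMap q)
      (L.comp (rdiff (Fin n → ℂ) E (orbitMap q) (0 : Fin n → ℂ))) 0) :
    MDifferentiableAt 𝓘(ℝ, E) 𝓘(ℝ, ℝ) f q ∧ rdiff E ℝ f q = L := by
  obtain ⟨A, hA⟩ := hM.exists_equiv_rdiff_orbitMap hq
  have h := rdiff_eq_of_comp (F := ℝ) ((hM.smooth_orbitMap q 0).of_le ENat.LEInfty.out) hA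
    hf.differentiableAt.mdifferentiableAt (L := L)
    (by rw [rdiff_eq_fderiv, hf.fderiv, hA])
  rwa [orbitMap_zero] at h

theorem IsToric.pull_imagVec_eq_zero (hM : IsToric n E M) (hΩ : IsKahler Ω)
    (hinv : TorusInvariantForm n Ω) {p : M} {b c : Fin n → ℝ}
    (h0 : Ω p (torusField b p) (torusField c p) = 0) (w : Fin n → ℂ) :
    pull Ω (orbitMap p) w (imagVec b) (imagVec c) = 0 := by
  have hd : ∀ w, DifferentiableAt ℝ (pull Ω (orbitMap (n := n) p)) w := fun w =>
    (hΩ.pull_contDiffAt (hM.smooth_orbitMap p w)).differentiableAt (by simp)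
  have hdiff : Differentiable ℝ
      (fun w => pull Ω (orbitMap (n := n) p) w (imagVec b) (imagVec c)) := fun w =>
    ((hd w).clm_apply (differentiableAt_const _)).clm_apply (differentiableAt_const _)
  have hzero : ∀ w,
      fderiv ℝ (fun w => pull Ω (orbitMap (n := n) p) w (imagVec b) (imagVec c)) w = 0 := by
    intro w
    ext u
    rw [fderiv_clm_apply₂_const (hd w), hΩ.fderiv_pull_contract_symm (hM.smooth_orbitMap p w)
      (hM.pull_orbitMap_translate hinv p w b), hΩ.fderiv_pull_eq_zero (hM.smooth_orbitMap p w)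
      (hM.pull_orbitMap_translate hinv p w c)]
    rfl
  rw [is_const_of_fderiv_eq_zero hdiff hzero w 0, pull_apply, hM.rdiff_orbitMap_imagVec,
    hM.rdiff_orbitMap_imagVec, orbitMap_zero, h0]

theorem IsToric.exists_torusInvariant_primitive (hM : IsToric n E M) (hΩ : IsKahler Ω)
    (hinv : TorusInvariantForm n Ω) {p : M} {b : Fin n → ℝ}
    (h0 : ∀ c : Fin n → ℝ, Ω p (torusField b p) (torusField c p) = 0) :
    ∃ F : (Fin n → ℂ) → ℝ, (∀ w, HasFDerivAt F (-(pull Ω (orbitMap p) w (imagVec b))) w) ∧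
      ∀ (w : Fin n → ℂ) (c : Fin n → ℝ), F (w + imagVec c) = F w := by
  obtain ⟨F, -, hF⟩ := hΩ.exists_primitive_contract convex_univ isOpen_univ
    (fun w _ => hM.smooth_orbitMap p w) fun w _ => hM.pull_orbitMap_translate hinv p w b
  replace hF := fun w => hF w (Set.mem_univ w)
  refine ⟨F, hF, fun w c => ?_⟩
  have hline : ∀ s : ℝ, HasDerivAt (fun s : ℝ => F (w + s • imagVec c)) 0 s := fun s => by
    have hl : HasDerivAt (fun s : ℝ => w + s • imagVec c) (imagVec c) s := by
      simpa using ((hasDerivAt_id s).smul_const (imagVec c)).const_add w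
    simpa [hM.pull_imagVec_eq_zero hΩ hinv (h0 c), Function.comp_def] using
      (hF (w + s • imagVec c)).comp_hasDerivAt s hl
  simpa using is_const_of_deriv_eq_zero (fun s => (hline s).differentiableAt)
    (fun s => (hline s).deriv) 1 0

theorem IsToric.exists_orbit_potential [T2Space M] [FiniteDimensional ℂ E] (hM : IsToric n E M)
    (hΩ : IsKahler Ω) (hinv : TorusInvariantForm n Ω) {p : M}
    (hp : Dense (MulAction.orbit (Fin n → ℂˣ) p)) {b : Fin n → ℝ}
    (h0 : ∀ c : Fin n → ℝ, Ω p (torusField b p) (torusField c p) = 0) :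
    ∃ f : M → ℝ, ∀ q ∈ MulAction.orbit (Fin n → ℂˣ) p,
      (MDifferentiableAt 𝓘(ℝ, E) 𝓘(ℝ, ℝ) f q ∧ rdiff E ℝ f q = -(Ω q (torusField b q))) ∧
      ∀ t : Fin n → Circle, f (realTorus t • q) = f q := by
  obtain ⟨F, hF, hFc⟩ := hM.exists_torusInvariant_primitive hΩ hinv h0
  have hfactor : F.FactorsThrough (orbitMap p) := fun w w' h => by
    obtain ⟨c, hc⟩ :=
      exists_imagVec_of_torusExp_eq_one (hM.torusExp_eq_one hp (orbitMap_sub_eq h))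
    rw [← hFc w' c, ← hc, add_sub_cancel]
  let f : M → ℝ := Function.extend (orbitMap p) F 0
  have hf : ∀ w, f (orbitMap p w) = F w := fun w => hfactor.extend_apply 0 w
  refine ⟨f, fun q hq => ?_⟩
  obtain ⟨w, rfl⟩ := mem_orbit_iff_orbitMap.1 hq
  refine ⟨hM.rdiff_eq_of_orbitMap ((hM.mem_orbit_iff_rdiff_orbitMap_injective hp).1 hq) ?_,
    fun t => ?_⟩
  · have hfF : f ∘ orbitMap (orbitMap p w) = fun u => F (w + u) := by
      ext u
      rw [Function.comp_apply, orbitMap_orbitMap, hf]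
    rw [hfF, hasFDerivAt_comp_add_left, add_zero, hM.rdiff_orbitMap_orbitMap]
    refine (hF w).congr_fderiv (ContinuousLinearMap.ext fun v => ?_)
    rw [neg_apply, pull_apply, hM.rdiff_orbitMap_imagVec]
    rfl
  · obtain ⟨c, hc⟩ := exists_torusExp_eq_realTorus t
    rw [← hc, ← orbitMap_add, hf, hf, add_comm, hFc]

end Orbit

section Degeneracy

theorem differentiable_det {V : Type*} [NormedAddCommGroup V] [NormedSpace ℂ V]
    [FiniteDimensional ℂ V] : Differentiable ℂ fun A : V →L[ℂ] V => A.det := by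
  let β := Module.finBasis ℂ V
  have hentry : ∀ i j, Differentiable ℂ fun A : V →L[ℂ] V =>
      LinearMap.toMatrix β β (A : V →ₗ[ℂ] V) i j := fun i j => by
    simp only [LinearMap.toMatrix_apply]
    exact (LinearMap.toContinuousLinearMap (β.coord i)).differentiable.comp
      (ContinuousLinearMap.apply ℂ V (β j)).differentiable
  simp only [ContinuousLinearMap.det, ← LinearMap.det_toMatrix β, Matrix.det_apply]
  exact Differentiable.fun_sum fun σ _ => Differentiable.const_smul
    (fun A => (HasFDerivAt.finsetProd fun i _ =>
      (hentry (σ i) i A).hasFDerivAt).differentiableAt) _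

theorem isPreconnected_inter_injective {V W Q : Type*} [NormedAddCommGroup V] [NormedSpace ℂ V]
    [NormedAddCommGroup W] [NormedSpace ℂ W] [NormedAddCommGroup Q] [NormedSpace ℂ Q]
    [FiniteDimensional ℂ V] [FiniteDimensional ℂ W]
    (hVW : Module.finrank ℂ V = Module.finrank ℂ W) {B : Set Q} (hB : IsOpen B)
    (hconv : Convex ℝ B) {A : Q → V →L[ℂ] W} (hA : DifferentiableOn ℂ A B) :
    IsPreconnected (B ∩ {y | Function.Injective (A y)}) := by
  let e : W ≃L[ℂ] V := ContinuousLinearEquiv.ofFinrankEq hVW.symm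
  have hdet : ∀ y, Function.Injective (A y) ↔
      ContinuousLinearMap.det ((e : W →L[ℂ] V) ∘L A y) ≠ 0 := fun y => by
    rw [ContinuousLinearMap.det, ← isUnit_iff_ne_zero, ← LinearMap.isUnit_iff_isUnit_det,
      LinearMap.isUnit_iff_ker_eq_bot, LinearMap.ker_eq_bot]
    exact (e.injective.of_comp_iff (A y)).symm
  simp only [hdet]
  have hdiff := differentiable_det.comp_differentiableOn
    ((differentiableOn_const (e : W →L[ℂ] V)).clm_comp hA)
  exact isPreconnected_inter_ne_zero hB hconv hdiff

end Degeneracy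

section Velocity

variable {n : ℕ} {E : Type*} [NormedAddCommGroup E] [NormedSpace ℂ E]
  {M : Type*} [TopologicalSpace M] [ChartedSpace E M] [MulAction (Fin n → ℂˣ) M]

variable (n) in
/-- The infinitesimal action of the complex torus, read in the chart at `x`: the value at `y` maps
an element of the Lie algebra `ℂⁿ` to its velocity at the point with coordinate `y`. -/
def velocity (x : M) (y : E) : (Fin n → ℂ) →L[ℂ] E :=
  (fderiv ℂ (chartAt E x ∘ actChart (n := n) x) (0, y)).comp
    (ContinuousLinearMap.inl ℂ (Fin n → ℂ) E)

variable [IsManifold 𝓘(ℂ, E) ω M]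

theorem IsToric.contDiffAt_chartAt_actChart (hM : IsToric n E M) (x : M) {y : E}
    (hy : y ∈ (chartAt E x).target) :
    ContDiffAt ℂ ω (chartAt E x ∘ actChart (n := n) x) (0, y) := by
  rw [← contMDiffAt_iff_contDiffAt]
  have hs : actChart (n := n) x (0, y) ∈ (chartAt E x).source := by
    simpa [actChart, torusExp_zero] using (chartAt E x).map_target hy
  exact ((contMDiffOn_chart (I := 𝓘(ℂ, E)) (n := ω)).contMDiffAt
    ((chartAt E x).open_source.mem_nhds hs)).comp _ (hM.contMDiffAt_actChart x hy)

theorem IsToric.hasFDerivAt_velocity (hM : IsToric n E M) (x : M) {y : E}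
    (hy : y ∈ (chartAt E x).target) :
    HasFDerivAt (chartAt E x ∘ orbitMap ((chartAt E x).symm y)) (velocity n x y)
      (0 : Fin n → ℂ) :=
  HasFDerivAt.comp (0 : Fin n → ℂ)
    ((hM.contDiffAt_chartAt_actChart x hy).differentiableAt (by simp)).hasFDerivAt
    (hasFDerivAt_prodMk_left (𝕜 := ℂ) (0 : Fin n → ℂ) y)

theorem IsToric.velocity_differentiableAt (hM : IsToric n E M) (x : M) {y : E}
    (hy : y ∈ (chartAt E x).target) : DifferentiableAt ℂ (velocity n x) y := by
  have hfderiv : ContDiffAt ℂ ω (fderiv ℂ (chartAt E x ∘ actChart (n := n) x)) (0, y) :=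
    (hM.contDiffAt_chartAt_actChart x hy).fderiv_right (by simp)
  have hcomp : DifferentiableAt ℂ (fderiv ℂ (chartAt E x ∘ actChart (n := n) x) ∘
      fun y : E => ((0 : Fin n → ℂ), y)) y :=
    (hfderiv.differentiableAt (by simp)).comp y (by fun_prop)
  exact hcomp.clm_comp (differentiableAt_const _)

theorem IsToric.rdiff_orbitMap_eq_velocity (hM : IsToric n E M) (x : M) {y : E}
    (hy : y ∈ (chartAt E x).target) :
    rdiff (Fin n → ℂ) E (orbitMap (n := n) ((chartAt E x).symm y)) 0
      = (rdiff E E (chartAt E x).symm y).comp ((velocity n x y).restrictScalars ℝ) := by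
  have hs : orbitMap ((chartAt E x).symm y) (0 : Fin n → ℂ) ∈ (chartAt E x).source := by
    rw [orbitMap_zero]
    exact (chartAt E x).map_target hy
  rw [rdiff_eq_chartAt_symm_comp_fderiv x (hM.mdifferentiableAt_orbitMap _ 0) hs,
    ((hM.hasFDerivAt_velocity x hy).restrictScalars ℝ).fderiv, orbitMap_zero,
    (chartAt E x).right_inv hy]

variable [T2Space M] [FiniteDimensional ℂ E] {p : M}

theorem IsToric.mem_orbit_iff_velocity_injective (hM : IsToric n E M)
    (hp : Dense (MulAction.orbit (Fin n → ℂˣ) p)) (x : M) {y : E}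
    (hy : y ∈ (chartAt E x).target) :
    (chartAt E x).symm y ∈ MulAction.orbit (Fin n → ℂˣ) p ↔
      Function.Injective (velocity n x y) := by
  have hsymm : Function.Injective (rdiff E E (chartAt E x).symm y) :=
    Function.LeftInverse.injective (g := rdiff E E (chartAt E x) ((chartAt E x).symm y))
      (DFunLike.congr_fun (rdiff_comp_chartAt_symm x hy))
  rw [hM.mem_orbit_iff_rdiff_orbitMap_injective hp, hM.rdiff_orbitMap_eq_velocity x hy]
  exact hsymm.of_comp_iff (velocity n x y)

theorem IsToric.isPreconnected_inter_orbit (hM : IsToric n E M)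
    (hp : Dense (MulAction.orbit (Fin n → ℂˣ) p)) (x : M) {B : Set E} (hB : IsOpen B)
    (hconv : Convex ℝ B) (hBt : B ⊆ (chartAt E x).target) :
    IsPreconnected ((chartAt E x).source ∩ chartAt E x ⁻¹' B ∩
      MulAction.orbit (Fin n → ℂˣ) p) := by
  have hpre : IsPreconnected (B ∩ {y | Function.Injective (velocity n x y)}) :=
    isPreconnected_inter_injective (by rw [hM.finrank_eq, Module.finrank_fin_fun]) hB hconv
      fun y hy => (hM.velocity_differentiableAt x (hBt hy)).differentiableWithinAt
  convert hpre.image _ ((chartAt E x).continuousOn_symm.mono (Set.inter_subset_left.trans hBt))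
    using 1
  rw [(chartAt E x).symm_image_eq_source_inter_preimage (Set.inter_subset_left.trans hBt),
    Set.preimage_inter, ← Set.inter_assoc]
  ext q
  refine and_congr_right fun hq => ?_
  rw [Set.mem_preimage, Set.mem_ofPred_eq,
    ← hM.mem_orbit_iff_velocity_injective hp x ((chartAt E x).map_source hq.1),
    (chartAt E x).left_inv hq.1]

end Velocity

section Potential

theorem exists_contMDiff_extension {E : Type*} [NormedAddCommGroup E] [NormedSpace ℝ E]
    {M : Type*} [TopologicalSpace M] [ChartedSpace E M] {U : Set M} (hU : Dense U) {f : M → ℝ}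
    {α : M → E →L[ℝ] ℝ}
    (h : ∀ x, ∃ g : M → ℝ, ∀ᶠ q in 𝓝 x, ContMDiffAt 𝓘(ℝ, E) 𝓘(ℝ, ℝ) ∞ g q ∧
      rdiff E ℝ g q = α q ∧ (q ∈ U → f q = g q)) :
    ∃ F : M → ℝ, ContMDiff 𝓘(ℝ, E) 𝓘(ℝ, ℝ) ∞ F ∧ (∀ q, rdiff E ℝ F q = α q) ∧
      ∀ q ∈ U, F q = f q := by
  have hext : ∀ q, ∀ g : M → ℝ, (∀ᶠ q' in 𝓝 q, q' ∈ U → f q' = g q') → ContinuousAt g q →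
      extendFrom U f q = g q := fun q g hfg hg =>
    extendFrom_eq (hU q) (((hg.mono_left nhdsWithin_le_nhds).congr'
      (eventually_nhdsWithin_iff.2 (hfg.mono fun q' h hq' => (h hq').symm))))
  have hlocal : ∀ x, ∃ g : M → ℝ, (extendFrom U f =ᶠ[𝓝 x] g) ∧
      ContMDiffAt 𝓘(ℝ, E) 𝓘(ℝ, ℝ) ∞ g x ∧ rdiff E ℝ g x = α x ∧ (x ∈ U → f x = g x) := fun x => by
    obtain ⟨g, hg⟩ := h x
    refine ⟨g, ?_, hg.self_of_nhds⟩
    filter_upwards [eventually_eventually_nhds.2 hg] with q hq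
    exact hext q g (hq.mono fun _ h => h.2.2) hq.self_of_nhds.1.continuousAt
  refine ⟨extendFrom U f, fun x => ?_, fun x => ?_, fun x hx => ?_⟩ <;>
    obtain ⟨g, hfg, hsmooth, hα, hgU⟩ := hlocal x
  · exact hsmooth.congr_of_eventuallyEq hfg
  · rw [rdiff_congr hfg, hα]
  · rw [hfg.eq_of_nhds, hgU hx]

variable {n : ℕ} {E : Type*} [NormedAddCommGroup E] [NormedSpace ℂ E]
  {M : Type*} [TopologicalSpace M] [ChartedSpace E M] [MulAction (Fin n → ℂˣ) M]
  {Ω : BilinField E M} [IsManifold 𝓘(ℂ, E) ω M]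

theorem IsToric.exists_local_potential (hM : IsToric n E M) (hΩ : IsKahler Ω)
    (hinv : TorusInvariantForm n Ω) (b : Fin n → ℝ) (x : M) {B : Set E} (hB : IsOpen B)
    (hconv : Convex ℝ B) (hBt : B ⊆ (chartAt E x).target) :
    ∃ g : M → ℝ, ∀ q ∈ (chartAt E x).source ∩ chartAt E x ⁻¹' B,
      ContMDiffAt 𝓘(ℝ, E) 𝓘(ℝ, ℝ) ∞ g q ∧ rdiff E ℝ g q = -(Ω q (torusField b q)) := by
  obtain ⟨G, hGs, hG⟩ := hΩ.exists_primitive_contract (φ := actChart (n := n) x)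
    (ξ := ((imagVec b, 0) : (Fin n → ℂ) × E)) (convex_univ.prod hconv) (isOpen_univ.prod hB)
    (fun w hw => hM.smooth_actChart x (hBt hw.2))
    (fun w hw => hM.pull_actChart_translate hinv x (hBt hw.2) b)
  refine ⟨fun q => G (0, chartAt E x q), fun q ⟨hq, hqB⟩ => ?_⟩
  have hmem : ((0, chartAt E x q) : (Fin n → ℂ) × E) ∈ (Set.univ : Set (Fin n → ℂ)) ×ˢ B :=
    ⟨trivial, hqB⟩
  have hslice : ContMDiffAt 𝓘(ℝ, E) 𝓘(ℝ, ℝ) ∞ (fun y => G (0, y)) (chartAt E x q) :=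
    ((hGs.contDiffAt ((isOpen_univ.prod hB).mem_nhds hmem)).comp _
      (contDiffAt_const.prodMk contDiffAt_id)).contMDiffAt
  have hderiv : HasFDerivAt (fun y => G (0, y)) _ (chartAt E x q) :=
    (hG _ hmem).comp _ (hasFDerivAt_prodMk_right (𝕜 := ℝ) (0 : Fin n → ℂ) (chartAt E x q))
  have hchart : ContMDiffAt 𝓘(ℝ, E) 𝓘(ℝ, E) ∞ (chartAt E x) q :=
    contMDiffOn_chart.contMDiffAt ((chartAt E x).open_source.mem_nhds hq)
  refine ⟨hslice.comp q hchart, ContinuousLinearMap.ext fun v => ?_⟩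
  have hv : rdiff E E (chartAt E x).symm (chartAt E x q) (rdiff E E (chartAt E x) q v) = v :=
    DFunLike.congr_fun (rdiff_chartAt_symm_comp x hq) v
  have hchain := rdiff_comp q (hslice.mdifferentiableAt (by simp))
    (hchart.mdifferentiableAt (by simp))
  rw [rdiff_eq_fderiv, hderiv.fderiv] at hchain
  refine (DFunLike.congr_fun hchain v).trans ?_
  have ht := (chartAt E x).map_source hq
  simp only [ContinuousLinearMap.comp_apply, neg_apply, pull_apply, ContinuousLinearMap.inr_apply,
    hM.rdiff_actChart_imagVec x ht, hM.rdiff_actChart_snd x ht, hv]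
  simp [actChart, torusExp_zero, (chartAt E x).left_inv hq]

variable [T2Space M] [FiniteDimensional ℂ E]

theorem IsToric.exists_potential_near (hM : IsToric n E M) (hΩ : IsKahler Ω)
    (hinv : TorusInvariantForm n Ω) {p : M} (hpo : IsOpen (MulAction.orbit (Fin n → ℂˣ) p))
    (hp : Dense (MulAction.orbit (Fin n → ℂˣ) p)) {b : Fin n → ℝ} {f : M → ℝ}
    (hf : ∀ q ∈ MulAction.orbit (Fin n → ℂˣ) p,
      MDifferentiableAt 𝓘(ℝ, E) 𝓘(ℝ, ℝ) f q ∧ rdiff E ℝ f q = -(Ω q (torusField b q))) (x : M) :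
    ∃ g : M → ℝ, ∀ᶠ q in 𝓝 x, ContMDiffAt 𝓘(ℝ, E) 𝓘(ℝ, ℝ) ∞ g q ∧
      rdiff E ℝ g q = -(Ω q (torusField b q)) ∧
      (q ∈ MulAction.orbit (Fin n → ℂˣ) p → f q = g q) := by
  obtain ⟨r, hr, hrt⟩ := Metric.isOpen_iff.1 (chartAt E x).open_target _ (mem_chart_target E x)
  obtain ⟨g, hg⟩ := hM.exists_local_potential hΩ hinv b x Metric.isOpen_ball
    (convex_ball (chartAt E x x) r) hrt
  set W := (chartAt E x).source ∩ chartAt E x ⁻¹' Metric.ball (chartAt E x x) r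
  have hW : IsOpen W := (chartAt E x).isOpen_inter_preimage Metric.isOpen_ball
  have hxW : x ∈ W := ⟨mem_chart_source E x, Metric.mem_ball_self hr⟩
  obtain ⟨q₀, hq₀⟩ := hp.inter_open_nonempty W hW ⟨x, hxW⟩
  refine ⟨fun q => g q + (f q₀ - g q₀), ?_⟩
  filter_upwards [hW.mem_nhds hxW] with q hq
  have hgd := fun q hq => (hg q hq).1.mdifferentiableAt (by simp)
  refine ⟨(hg q hq).1.add contMDiffAt_const, ?_, fun hqU => ?_⟩
  · rw [← (hg q hq).2]
    refine ((hgd q hq).hasMFDerivAt.add (hasMFDerivAt_const (f q₀ - g q₀) q)).mfderiv.trans ?_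
    exact add_zero _
  · have hconst := sub_eq_sub_of_rdiff_eq (hW.inter hpo)
      (hM.isPreconnected_inter_orbit hp x Metric.isOpen_ball (convex_ball _ r) hrt)
      (fun q hq => (hf q hq.2).1) (fun q hq => hgd q hq.1)
      (fun q hq => (hf q hq.2).2.trans (hg q hq.1).2.symm) ⟨hq, hqU⟩ hq₀
    linarith

theorem IsToric.exists_potential (hM : IsToric n E M) (hΩ : IsKahler Ω)
    (hinv : TorusInvariantForm n Ω) {p : M} (hpo : IsOpen (MulAction.orbit (Fin n → ℂˣ) p))
    (hp : Dense (MulAction.orbit (Fin n → ℂˣ) p)) {b : Fin n → ℝ}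
    (h0 : ∀ c : Fin n → ℝ, Ω p (torusField b p) (torusField c p) = 0) :
    ∃ f : M → ℝ, ContMDiff 𝓘(ℝ, E) 𝓘(ℝ, ℝ) ∞ f ∧ TorusInvariant n f ∧
      ∀ q, rdiff E ℝ f q = -(Ω q (torusField b q)) := by
  obtain ⟨f₀, hf₀⟩ := hM.exists_orbit_potential hΩ hinv hp h0
  obtain ⟨f, hf, hdf, hff₀⟩ := exists_contMDiff_extension hp
    (hM.exists_potential_near hΩ hinv hpo hp fun q hq => (hf₀ q hq).1)
  refine ⟨f, hf, fun t q => ?_, hdf⟩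
  obtain ⟨c, hc⟩ := exists_torusExp_eq_realTorus t
  have hcont : Continuous fun q : M => f (realTorus t • q) :=
    hf.continuous.comp (hc ▸ hM.continuous_smul (imagVec c))
  refine congrFun (hcont.ext_on hp hf.continuous fun q hq => ?_) q
  exact (hff₀ _ (MulAction.mem_orbit_of_mem_orbit _ hq)).trans
    (((hf₀ q hq).2 t).trans (hff₀ q hq).symm)

end Potential

section Cone

/-- The Kähler potential `|z|^{2a}` of the cone metric on `ℂ`. -/
def conePot (a : ℝ) (z : ℂ) : ℝ := ‖z‖ ^ (2 * a)

theorem conePot_eq (a : ℝ) : conePot a = fun z => (‖z‖ ^ 2) ^ a := by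
  ext z
  rw [conePot, Real.rpow_mul (norm_nonneg z), Real.rpow_two]

theorem radius_sq {D : Type*} (a : ℝ) (q : ℂ × D) : radius a q ^ 2 = conePot a q.1 := by
  rw [radius, conePot, mul_comm, Real.rpow_mul (norm_nonneg _), Real.rpow_two]

variable {a : ℝ} {z : ℂ}

theorem hasFDerivAt_conePot (hz : z ≠ 0 ∨ a = 1) :
    HasFDerivAt (conePot a) ((2 * a * (‖z‖ ^ 2) ^ (a - 1)) • innerSL ℝ z) z := by
  rw [conePot_eq]
  refine ((hasStrictFDerivAt_norm_sq z).hasFDerivAt.rpow_const (p := a)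
    (hz.imp (fun hz => by simpa using hz) fun ha => ha.ge)).congr_fderiv ?_
  ext v
  simp
  ring

theorem contDiffAt_conePot (hz : z ≠ 0 ∨ a = 1) : ContDiffAt ℝ ∞ (conePot a) z := by
  rw [conePot_eq]
  rcases hz with hz | rfl
  · exact (contDiff_norm_sq ℝ).contDiffAt.rpow_const_of_ne (by simpa using hz)
  · simpa only [Real.rpow_one] using (contDiff_norm_sq ℝ).contDiffAt

theorem hasFDerivAt_fderiv_conePot (hz : z ≠ 0 ∨ a = 1) :
    HasFDerivAt (fderiv ℝ (conePot a)) (fderiv ℝ (fderiv ℝ (conePot a)) z) z :=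
  (((contDiffAt_conePot hz).fderiv_right (m := ∞) (by simp)).differentiableAt
    (by simp)).hasFDerivAt

theorem eventually_ne_zero_or_eq_one (hz : z ≠ 0 ∨ a = 1) : ∀ᶠ w in 𝓝 z, w ≠ 0 ∨ a = 1 := by
  rcases hz with hz | hz
  · filter_upwards [isOpen_ne.mem_nhds hz] with w hw using Or.inl hw
  · exact Filter.Eventually.of_forall fun _ => Or.inr hz

theorem fderiv_conePot_self (hz : z ≠ 0 ∨ a = 1) :
    fderiv ℝ (conePot a) z z = 2 * a * conePot a z := by
  rw [(hasFDerivAt_conePot hz).fderiv, conePot_eq]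
  simp only [smul_apply, innerSL_apply_apply, real_inner_self_eq_norm_sq, smul_eq_mul]
  rcases hz with hz | rfl
  · have hpos : 0 < ‖z‖ ^ 2 := by positivity
    rw [mul_assoc, ← Real.rpow_add_one hpos.ne', sub_add_cancel]
  · simp

theorem fderiv_conePot_I_mul (hz : z ≠ 0 ∨ a = 1) :
    fderiv ℝ (conePot a) z (Complex.I * z) = 0 := by
  have horth : inner ℝ z (Complex.I * z) = 0 := by
    simp only [Complex.inner, Complex.mul_re, Complex.mul_im, Complex.conj_re, Complex.conj_im,
      Complex.I_re, Complex.I_im]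
    ring
  simp [(hasFDerivAt_conePot hz).fderiv, horth]

-- Euler's identity for the homogeneous function `D |z|^{2a}`.
theorem fderiv_fderiv_conePot_self (hz : z ≠ 0 ∨ a = 1) (v : ℂ) :
    fderiv ℝ (fderiv ℝ (conePot a)) z v z = (2 * a - 1) * fderiv ℝ (conePot a) z v := by
  have hproduct := (hasFDerivAt_fderiv_conePot hz).clm_apply (hasFDerivAt_id z)
  have heuler := ((hasFDerivAt_conePot hz).differentiableAt.hasFDerivAt.const_mul
    (2 * a)).congr_of_eventuallyEq (f₁ := fun w => fderiv ℝ (conePot a) w (id w))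
      ((eventually_ne_zero_or_eq_one hz).mono fun w hw => fderiv_conePot_self hw)
  have h := DFunLike.congr_fun (hproduct.unique heuler) v
  simp only [id_eq, add_apply, ContinuousLinearMap.comp_apply,
    ContinuousLinearMap.flip_apply, smul_apply, smul_eq_mul, ContinuousLinearMap.id_apply] at h
  linarith

-- The derivative of the rotation invariance of `|z|^{2a}`.
theorem fderiv_fderiv_conePot_I_mul (hz : z ≠ 0 ∨ a = 1) (v : ℂ) :
    fderiv ℝ (fderiv ℝ (conePot a)) z v (Complex.I * z)
      = - fderiv ℝ (conePot a) z (Complex.I * v) := by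
  have hproduct := (hasFDerivAt_fderiv_conePot hz).clm_apply
    ((hasFDerivAt_id (𝕜 := ℝ) z).const_mul Complex.I)
  have hrotation := (hasFDerivAt_const (𝕜 := ℝ) (0 : ℝ) z).congr_of_eventuallyEq
    (f₁ := fun w => fderiv ℝ (conePot a) w (Complex.I * id w))
      ((eventually_ne_zero_or_eq_one hz).mono fun w hw => fderiv_conePot_I_mul hw)
  have h := DFunLike.congr_fun (hproduct.unique hrotation) v
  simp only [id_eq, add_apply, ContinuousLinearMap.comp_apply,
    ContinuousLinearMap.flip_apply, smul_apply, smul_eq_mul, ContinuousLinearMap.id_apply,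
    zero_apply] at h
  linarith

theorem coneForm_apply (a : ℝ) (z u v : ℂ) : coneForm a z u v = 1 / 4 *
    (fderiv ℝ (fderiv ℝ (conePot a)) z v (Complex.I * u)
      - fderiv ℝ (fderiv ℝ (conePot a)) z u (Complex.I * v)) := by
  change 1 / 2 * (1 / 2 * (fderiv ℝ (fderiv ℝ (conePot a)) z v (Complex.I * u)
    - fderiv ℝ (fderiv ℝ (conePot a)) z u (Complex.I * v))) = _
  ring

-- The contraction of the cone form with `J (r ∂_r)` is `- d (r² / 2)`.
theorem coneForm_radial (ha : a ≠ 0) (hz : z ≠ 0 ∨ a = 1) (v : ℂ) :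
    coneForm a z (Complex.I * ((1 / a : ℝ) • z)) v = - (1 / 2) * fderiv ℝ (conePot a) z v := by
  have hsymm : IsSymmSndFDerivAt ℝ (conePot a) z :=
    (contDiffAt_conePot hz).isSymmSndFDerivAt (by simpa using ENat.LEInfty.out)
  rw [coneForm_apply, mul_smul_comm, mul_smul_comm, map_smul, map_smul, smul_apply,
    hsymm.eq (Complex.I * z), ← mul_assoc, Complex.I_mul_I, neg_one_mul, map_neg,
    fderiv_fderiv_conePot_self hz, fderiv_fderiv_conePot_I_mul hz, ← mul_assoc, Complex.I_mul_I,
    neg_one_mul, map_neg]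
  simp only [smul_eq_mul]
  field_simp
  ring

theorem fderiv_smul_of_homogeneous {V W : Type*} [NormedAddCommGroup V] [NormedSpace ℝ V]
    [NormedAddCommGroup W] [NormedSpace ℝ W] {φ : V → W} {t c : ℝ} (ht : t ≠ 0)
    (hφ : ∀ y, φ (t • y) = c • φ y) (y : V) :
    fderiv ℝ φ (t • y) = (c / t) • fderiv ℝ φ y := by
  have hscale : t • fderiv ℝ φ (t • y) = c • fderiv ℝ φ y := by
    rw [← fderiv_comp_smul, funext hφ]
    exact congrFun (fderiv_const_smul_field c) y
  rw [div_eq_inv_mul, mul_smul, ← hscale, inv_smul_smul₀ ht]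

theorem coneForm_zero (ha : a ≠ 1) : coneForm a 0 = 0 := by
  have hscale : ∀ w, conePot a ((2 : ℝ) • w) = (2 : ℝ) ^ (2 * a) • conePot a w := fun w => by
    simp [conePot, Real.mul_rpow]
  have hfix := fderiv_smul_of_homogeneous (φ := fderiv ℝ (conePot a)) two_ne_zero
    (fderiv_smul_of_homogeneous two_ne_zero hscale) 0
  rw [smul_zero] at hfix
  have hfactor : (2 : ℝ) ^ (2 * a) / 2 / 2 ≠ 1 := fun h => by
    have hpow : (2 : ℝ) ^ (2 * a) = 2 ^ (2 : ℝ) := by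
      rw [Real.rpow_two]
      linarith
    exact ha (by linarith [(Real.rpow_right_inj two_pos (by norm_num)).1 hpow])
  have hzero : fderiv ℝ (fderiv ℝ (conePot a)) 0 = 0 := by
    refine (smul_eq_zero.1 ?_).resolve_left (sub_ne_zero.2 hfactor)
    rw [sub_smul, one_smul, ← hfix, sub_self]
  ext u v
  rw [coneForm_apply, hzero]
  simp

end Cone

section ModelAtInfinity

variable {F : Type*} [NormedAddCommGroup F] [NormedSpace ℂ F]
  {D : Type*} [TopologicalSpace D] [ChartedSpace F D]
  {E : Type*} [NormedAddCommGroup E] [NormedSpace ℂ E]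
  {M : Type*} [TopologicalSpace M] [ChartedSpace E M]
  {a : ℝ} {ΩD : BilinField F D} {Ω : BilinField E M} {X : VField E M}
  {K : Set M} {K' : Set (ℂ × D)} {ν : OpenPartialHomeomorph M (ℂ × D)}

/-- The model potential `ν^* (r² / 2 - 1)`. -/
def modelPot (a : ℝ) (ν : OpenPartialHomeomorph M (ℂ × D)) (p : M) : ℝ := conePot a (ν p).1 / 2 - 1

theorem modelPot_eq (a : ℝ) (ν : OpenPartialHomeomorph M (ℂ × D)) (p : M) :
    modelPot a ν p = radius a (ν p) ^ 2 / 2 - 1 := by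
  rw [modelPot, radius_sq]

theorem hasFDerivAt_half_conePot {z : ℂ} (hz : z ≠ 0 ∨ a = 1) :
    HasFDerivAt (fun z => conePot a z / 2 - 1) ((1 / 2 : ℝ) • fderiv ℝ (conePot a) z) z := by
  simpa only [div_eq_inv_mul, mul_one] using
    ((hasFDerivAt_conePot hz).differentiableAt.hasFDerivAt.const_mul 2⁻¹).sub_const 1

namespace IsModelAtInfinity

variable {p : M}

theorem isOpen_compl (hν : IsModelAtInfinity a ΩD Ω X K K' ν) : IsOpen Kᶜ :=
  hν.source_eq ▸ ν.open_source

theorem mem_source (hν : IsModelAtInfinity a ΩD Ω X K K' ν) (hp : p ∉ K) : p ∈ ν.source :=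
  hν.source_eq ▸ hp

theorem mem_target (hν : IsModelAtInfinity a ΩD Ω X K K' ν) {q : ℂ × D} (hq : q ∉ K') :
    q ∈ ν.target := hν.target_eq ▸ hq

theorem map_notMem (hν : IsModelAtInfinity a ΩD Ω X K K' ν) (hp : p ∉ K) : ν p ∉ K' := by
  have h := ν.map_source (hν.mem_source hp)
  rwa [hν.target_eq] at h

theorem symm_notMem (hν : IsModelAtInfinity a ΩD Ω X K K' ν) {q : ℂ × D} (hq : q ∉ K') :
    ν.symm q ∉ K := by
  have h := ν.map_target (hν.mem_target hq)
  rwa [hν.source_eq] at h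

theorem left_inv (hν : IsModelAtInfinity a ΩD Ω X K K' ν) (hp : p ∉ K) : ν.symm (ν p) = p :=
  ν.left_inv (hν.mem_source hp)

theorem right_inv (hν : IsModelAtInfinity a ΩD Ω X K K' ν) {q : ℂ × D} (hq : q ∉ K') :
    ν (ν.symm q) = q := ν.right_inv (hν.mem_target hq)

theorem contMDiffAt_fst (hν : IsModelAtInfinity a ΩD Ω X K K' ν) (hp : p ∉ K) :
    ContMDiffAt 𝓘(ℂ, E) 𝓘(ℂ, ℂ) ω (fun p => (ν p).1) p :=
  _root_.contMDiffAt_fst.comp p (hν.holomorphic.contMDiffAt (hν.isOpen_compl.mem_nhds hp))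

theorem contMDiffAt_snd (hν : IsModelAtInfinity a ΩD Ω X K K' ν) (hp : p ∉ K) :
    ContMDiffAt 𝓘(ℂ, E) 𝓘(ℂ, F) ω (fun p => (ν p).2) p :=
  _root_.contMDiffAt_snd.comp p (hν.holomorphic.contMDiffAt (hν.isOpen_compl.mem_nhds hp))

theorem mdifferentiableAt_fst (hν : IsModelAtInfinity a ΩD Ω X K K' ν) (hp : p ∉ K) :
    MDifferentiableAt 𝓘(ℝ, E) 𝓘(ℝ, ℂ) (fun p => (ν p).1) p :=
  mdifferentiableAt_restrictScalars ((hν.contMDiffAt_fst hp).mdifferentiableAt (by simp))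

theorem mdifferentiableAt_snd (hν : IsModelAtInfinity a ΩD Ω X K K' ν) (hp : p ∉ K) :
    MDifferentiableAt 𝓘(ℝ, E) 𝓘(ℝ, F) (fun p => (ν p).2) p :=
  mdifferentiableAt_restrictScalars ((hν.contMDiffAt_snd hp).mdifferentiableAt (by simp))

theorem prodTangentMapAt_eq (hν : IsModelAtInfinity a ΩD Ω X K K' ν) (hp : p ∉ K) (u : E) :
    prodTangentMapAt (F := F) ν p u
      = (rdiff E ℂ (fun p => (ν p).1) p u, rdiff E F (fun p => (ν p).2) p u) :=
  DFunLike.congr_fun (mfderiv_prodMk (hν.mdifferentiableAt_fst hp) (hν.mdifferentiableAt_snd hp)) u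

theorem rdiff_fst_J (hν : IsModelAtInfinity a ΩD Ω X K K' ν) (hp : p ∉ K) (u : E) :
    rdiff E ℂ (fun p => (ν p).1) p (J E u) = Complex.I * rdiff E ℂ (fun p => (ν p).1) p u :=
  rdiff_J ((hν.contMDiffAt_fst hp).mdifferentiableAt (by simp)) u

theorem rdiff_snd_J (hν : IsModelAtInfinity a ΩD Ω X K K' ν) (hp : p ∉ K) (u : E) :
    rdiff E F (fun p => (ν p).2) p (J E u) = J F (rdiff E F (fun p => (ν p).2) p u) :=
  rdiff_J ((hν.contMDiffAt_snd hp).mdifferentiableAt (by simp)) u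

theorem form_apply (hν : IsModelAtInfinity a ΩD Ω X K K' ν) (hp : p ∉ K) (u v : E) :
    Ω p u v = coneForm a (ν p).1 (rdiff E ℂ (fun p => (ν p).1) p u)
        (rdiff E ℂ (fun p => (ν p).1) p v)
      + ΩD (ν p).2 (rdiff E F (fun p => (ν p).2) p u) (rdiff E F (fun p => (ν p).2) p v) := by
  rw [hν.pullback p hp, hν.prodTangentMapAt_eq hp, hν.prodTangentMapAt_eq hp]
  rfl

theorem rdiff_fst_field (hν : IsModelAtInfinity a ΩD Ω X K K' ν) (hp : p ∉ K) :
    rdiff E ℂ (fun p => (ν p).1) p (X p) = (1 / a : ℝ) • (ν p).1 :=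
  congrArg Prod.fst ((hν.prodTangentMapAt_eq hp (X p)).symm.trans (hν.map_field p hp))

theorem rdiff_snd_field (hν : IsModelAtInfinity a ΩD Ω X K K' ν) (hp : p ∉ K) :
    rdiff E F (fun p => (ν p).2) p (X p) = 0 :=
  congrArg Prod.snd ((hν.prodTangentMapAt_eq hp (X p)).symm.trans (hν.map_field p hp))

theorem rdiff_bijective [FiniteDimensional ℂ F] [FiniteDimensional ℂ E]
    (hν : IsModelAtInfinity a ΩD Ω X K K' ν) (hΩ : IsKahler Ω)
    (hdim : Module.finrank ℂ F + 1 = Module.finrank ℂ E) (hp : p ∉ K) :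
    Function.Bijective
      ((rdiff E ℂ (fun p => (ν p).1) p).prod (rdiff E F (fun p => (ν p).2) p)) := by
  set L := (rdiff E ℂ (fun p => (ν p).1) p).prod (rdiff E F (fun p => (ν p).2) p)
  have hinj : Function.Injective L := by
    rw [injective_iff_map_eq_zero]
    intro u hu
    by_contra hne
    have hpos := hΩ.positive p u hne
    have hfst : rdiff E ℂ (fun p => (ν p).1) p u = 0 := congrArg Prod.fst hu
    have hsnd : rdiff E F (fun p => (ν p).2) p u = 0 := congrArg Prod.snd hu
    simp [hν.form_apply hp, hfst, hsnd] at hpos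
  have : FiniteDimensional ℝ E := .trans ℝ ℂ E
  have : FiniteDimensional ℝ F := .trans ℝ ℂ F
  have hrank : Module.finrank ℝ E = Module.finrank ℝ (ℂ × F) := by
    rw [Module.finrank_prod, finrank_real_of_complex E, finrank_real_of_complex F,
      Complex.finrank_real_complex]
    lia
  exact ⟨hinj,
    (LinearMap.injective_iff_surjective_of_finrank_eq_finrank (f := L.toLinearMap) hrank).1 hinj⟩

-- Unless `a = 1`, the cone form vanishes at the origin, while `Ω` is nondegenerate.
theorem fst_ne_zero_or [FiniteDimensional ℂ F] [FiniteDimensional ℂ E]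
    (hν : IsModelAtInfinity a ΩD Ω X K K' ν) (hΩ : IsKahler Ω)
    (hdim : Module.finrank ℂ F + 1 = Module.finrank ℂ E) (hp : p ∉ K) :
    (ν p).1 ≠ 0 ∨ a = 1 := by
  by_contra! hcon
  obtain ⟨u, hu⟩ := (hν.rdiff_bijective hΩ hdim hp).2 ((1 : ℂ), (0 : F))
  have hfst : rdiff E ℂ (fun p => (ν p).1) p u = 1 := congrArg Prod.fst hu
  have hsnd : rdiff E F (fun p => (ν p).2) p u = 0 := congrArg Prod.snd hu
  have hne : u ≠ 0 := by
    rintro rfl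
    simp at hfst
  have hpos := hΩ.positive p u hne
  simp [hν.form_apply hp, hsnd, hcon.1, coneForm_zero hcon.2] at hpos

theorem mdifferentiableAt_modelPot (hν : IsModelAtInfinity a ΩD Ω X K K' ν) (hp : p ∉ K)
    (hz : (ν p).1 ≠ 0 ∨ a = 1) : MDifferentiableAt 𝓘(ℝ, E) 𝓘(ℝ, ℝ) (modelPot a ν) p :=
  (hasFDerivAt_half_conePot hz).differentiableAt.mdifferentiableAt.comp p
    (hν.mdifferentiableAt_fst hp)

theorem rdiff_modelPot (hν : IsModelAtInfinity a ΩD Ω X K K' ν) (hp : p ∉ K)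
    (hz : (ν p).1 ≠ 0 ∨ a = 1) (v : E) :
    rdiff E ℝ (modelPot a ν) p v
      = 1 / 2 * fderiv ℝ (conePot a) (ν p).1 (rdiff E ℂ (fun p => (ν p).1) p v) := by
  have hchain := rdiff_comp (g := fun z => conePot a z / 2 - 1) p
    (hasFDerivAt_half_conePot hz).differentiableAt.mdifferentiableAt (hν.mdifferentiableAt_fst hp)
  rw [rdiff_eq_fderiv, (hasFDerivAt_half_conePot hz).fderiv] at hchain
  exact DFunLike.congr_fun hchain v

theorem contract_eq_rdiff (hν : IsModelAtInfinity a ΩD Ω X K K' ν) (hp : p ∉ K)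
    (hz : (ν p).1 ≠ 0 ∨ a = 1) (ha : a ≠ 0) (v : E) :
    - Ω p (J E (X p)) v = rdiff E ℝ (modelPot a ν) p v := by
  rw [hν.rdiff_modelPot hp hz, hν.form_apply hp, hν.rdiff_fst_J hp, hν.rdiff_snd_J hp,
    hν.rdiff_fst_field hp, hν.rdiff_snd_field hp, coneForm_radial ha hz]
  simp

theorem rdiff_modelPot_field (hν : IsModelAtInfinity a ΩD Ω X K K' ν) (hp : p ∉ K)
    (hz : (ν p).1 ≠ 0 ∨ a = 1) (ha : a ≠ 0) :
    rdiff E ℝ (modelPot a ν) p (X p) = conePot a (ν p).1 := by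
  rw [hν.rdiff_modelPot hp hz, hν.rdiff_fst_field hp, map_smul, fderiv_conePot_self hz, smul_eq_mul]
  field_simp

theorem form_field (hν : IsModelAtInfinity a ΩD Ω X K K' ν) (hp : p ∉ K)
    (hz : (ν p).1 ≠ 0 ∨ a = 1) (ha : a ≠ 0) (hΩ : IsKahler Ω) :
    Ω p (X p) (J E (X p)) = conePot a (ν p).1 := by
  rw [hΩ.antisymm, hν.contract_eq_rdiff hp hz ha, hν.rdiff_modelPot_field hp hz ha]

end IsModelAtInfinity

end ModelAtInfinity

section FlatDdbar

variable {E : Type*} [NormedAddCommGroup E] [NormedSpace ℂ E]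

theorem flatDdbar_apply (φ : E → ℝ) (y u v : E) : flatDdbar φ y u v = 1 / 2 *
    (fderiv ℝ (fderiv ℝ φ) y v (Complex.I • u) - fderiv ℝ (fderiv ℝ φ) y u (Complex.I • v)) := by
  simp [flatDdbar, J]

theorem flatDdbar_congr {φ ψ : E → ℝ} {y : E} (h : φ =ᶠ[𝓝 y] ψ) :
    flatDdbar φ y = flatDdbar ψ y := by
  rw [flatDdbar, flatDdbar, h.fderiv.fderiv_eq]

theorem flatDdbar_const_mul_sub_const (φ : E → ℝ) (c d : ℝ) (y : E) :
    flatDdbar (fun y => c * φ y - d) y = c • flatDdbar φ y := by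
  have hfst : fderiv ℝ (fun y => c * φ y - d) = c • fderiv ℝ φ := by
    ext1 y
    exact (fderiv_sub_const d).trans (congrFun (fderiv_const_smul_field (f := φ) c) y)
  have hsnd : fderiv ℝ (c • fderiv ℝ φ) = c • fderiv ℝ (fderiv ℝ φ) :=
    fderiv_const_smul_field (f := fderiv ℝ φ) c
  ext u v
  rw [flatDdbar_apply, hfst, hsnd]
  simp only [Pi.smul_apply, smul_apply, smul_eq_mul, flatDdbar_apply]
  ring

theorem flatDdbar_half_conePot (a : ℝ) (z : ℂ) :
    flatDdbar (fun z => conePot a z / 2 - 1) z = coneForm a z := by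
  have h := flatDdbar_const_mul_sub_const (conePot a) (1 / 2) 1 z
  simp only [one_div_mul_eq_div] at h
  exact h

theorem fderiv_fderiv_comp_apply {V W G : Type*} [NormedAddCommGroup V] [NormedSpace ℝ V]
    [NormedAddCommGroup W] [NormedSpace ℝ W] [NormedAddCommGroup G] [NormedSpace ℝ G]
    {ψ : W → G} {ζ : V → W} {y : V} (hψ : ContDiffAt ℝ 2 ψ (ζ y)) (hζ : ContDiffAt ℝ 2 ζ y)
    (u v : V) :
    fderiv ℝ (fderiv ℝ (ψ ∘ ζ)) y u v
      = fderiv ℝ (fderiv ℝ ψ) (ζ y) (fderiv ℝ ζ y u) (fderiv ℝ ζ y v)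
        + fderiv ℝ ψ (ζ y) (fderiv ℝ (fderiv ℝ ζ) y u v) := by
  have hchain : fderiv ℝ (ψ ∘ ζ) =ᶠ[𝓝 y] fun z => (fderiv ℝ ψ (ζ z)).comp (fderiv ℝ ζ z) := by
    filter_upwards [hζ.eventually (by simp), hζ.continuousAt.eventually (hψ.eventually (by simp))]
      with z hζz hψz
    exact fderiv_comp z (hψz.differentiableAt two_ne_zero) (hζz.differentiableAt two_ne_zero)
  have hψ' : HasFDerivAt (fun z => fderiv ℝ ψ (ζ z))
      ((fderiv ℝ (fderiv ℝ ψ) (ζ y)).comp (fderiv ℝ ζ y)) y :=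
    ((hψ.fderiv_right (m := 1) le_rfl).differentiableAt one_ne_zero).hasFDerivAt.comp y
      (hζ.differentiableAt two_ne_zero).hasFDerivAt
  have hζ' : HasFDerivAt (fderiv ℝ ζ) (fderiv ℝ (fderiv ℝ ζ) y) y :=
    ((hζ.fderiv_right (m := 1) le_rfl).differentiableAt one_ne_zero).hasFDerivAt
  rw [hchain.fderiv_eq, (hψ'.clm_comp hζ').fderiv]
  simp [add_comm]

theorem fderiv_real_I_smul {ζ : E → ℂ} {y : E} (hζ : DifferentiableAt ℂ ζ y) (v : E) :
    fderiv ℝ ζ y (Complex.I • v) = Complex.I * fderiv ℝ ζ y v := by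
  rw [(hζ.hasFDerivAt.restrictScalars ℝ).fderiv]
  simp

theorem fderiv_fderiv_real_I_smul {ζ : E → ℂ} {y : E} (hζ : ContDiffAt ℂ 2 ζ y) (u v : E) :
    fderiv ℝ (fderiv ℝ ζ) y u (Complex.I • v) = Complex.I * fderiv ℝ (fderiv ℝ ζ) y u v := by
  have hlinear : (fun z => fderiv ℝ ζ z (Complex.I • v))
      =ᶠ[𝓝 y] fun z => Complex.I * fderiv ℝ ζ z v := by
    filter_upwards [hζ.eventually (by simp)] with z hz
    exact fderiv_real_I_smul (hz.differentiableAt two_ne_zero) v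
  have hζ' : DifferentiableAt ℝ (fderiv ℝ ζ) y :=
    ((hζ.restrict_scalars ℝ).fderiv_right (m := 1) le_rfl).differentiableAt one_ne_zero
  rw [← fderiv_clm_apply_const hζ', hlinear.fderiv_eq,
    fderiv_const_mul (hζ'.clm_apply (differentiableAt_const v)), smul_apply,
    fderiv_clm_apply_const hζ', smul_eq_mul]

theorem flatDdbar_comp {ψ : ℂ → ℝ} {ζ : E → ℂ} {y : E} (hψ : ContDiffAt ℝ 2 ψ (ζ y))
    (hζ : ContDiffAt ℂ 2 ζ y) (u v : E) :
    flatDdbar (ψ ∘ ζ) y u v = flatDdbar ψ (ζ y) (fderiv ℝ ζ y u) (fderiv ℝ ζ y v) := by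
  have hζ' : ContDiffAt ℝ 2 ζ y := hζ.restrict_scalars ℝ
  have hsymm : fderiv ℝ (fderiv ℝ ζ) y u v = fderiv ℝ (fderiv ℝ ζ) y v u :=
    (hζ'.isSymmSndFDerivAt (by simp)).eq u v
  simp only [flatDdbar_apply, fderiv_fderiv_comp_apply hψ hζ', fderiv_fderiv_real_I_smul hζ, hsymm,
    fderiv_real_I_smul (hζ.differentiableAt two_ne_zero), smul_eq_mul]
  ring

end FlatDdbar

section ModelPotential

theorem rdiff_eq_fderiv_chartAt {E : Type*} [NormedAddCommGroup E] [NormedSpace ℝ E]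
    {F : Type*} [NormedAddCommGroup F] [NormedSpace ℝ F]
    {M : Type*} [TopologicalSpace M] [ChartedSpace E M] {f : M → F} {p : M}
    (hf : MDifferentiableAt 𝓘(ℝ, E) 𝓘(ℝ, F) f p) :
    rdiff E F f p = fderiv ℝ (f ∘ (chartAt E p).symm) (chartAt E p p) := by
  unfold rdiff
  rw [hf.mfderiv]
  simp only [mfld_simps, fderivWithin_univ]
  rfl

variable {F : Type*} [NormedAddCommGroup F] [NormedSpace ℂ F]
  {D : Type*} [TopologicalSpace D] [ChartedSpace F D]
  {E : Type*} [NormedAddCommGroup E] [NormedSpace ℂ E]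
  {M : Type*} [TopologicalSpace M] [ChartedSpace E M]
  {a : ℝ} {ΩD : BilinField F D} {Ω : BilinField E M} {X : VField E M}
  {K : Set M} {K' : Set (ℂ × D)} {ν : OpenPartialHomeomorph M (ℂ × D)} {p : M}

-- The model potential is `|X|² / 2 - 1`, and `|X|²` is constant along the orbits of the real torus.
theorem IsModelAtInfinity.torusField_orthogonal {n : ℕ} [MulAction (Fin n → ℂˣ) M]
    (hν : IsModelAtInfinity a ΩD Ω X K K' ν)
    (hM : IsToric n E M) (hΩ : IsKahler Ω) (hinv : TorusInvariantForm n Ω) (ha : a ≠ 0)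
    (hz : ∀ p ∉ K, (ν p).1 ≠ 0 ∨ a = 1) {b : Fin n → ℝ}
    (hb : (fun p => J E (X p)) = torusField b) (hp : p ∉ K) (c : Fin n → ℝ) :
    Ω p (torusField b p) (torusField c p) = 0 := by
  have hb' : ∀ q, J E (X q) = torusField b q := congrFun hb
  let γ : ℝ → M := fun s => orbitMap p (s • imagVec c)
  have hγ0 : γ 0 = p := by simp [γ, orbitMap_zero]
  have hγ : MDifferentiableAt 𝓘(ℝ, ℝ) 𝓘(ℝ, E) γ 0 :=
    (hM.mdifferentiableAt_orbitMap p _).comp (0 : ℝ)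
      (differentiableAt_id.smul_const (imagVec c)).mdifferentiableAt
  have hconst : modelPot a ν ∘ γ =ᶠ[𝓝 0]
      fun _ => pull Ω (orbitMap p) 0 (realVec b) (imagVec b) / 2 - 1 := by
    filter_upwards [hγ.continuousAt.eventually_mem
      (hγ0 ▸ hν.isOpen_compl.mem_nhds hp : Kᶜ ∈ 𝓝 (γ 0))] with s hs
    rw [Function.comp_apply, modelPot, ← hν.form_field hs (hz _ hs) ha hΩ,
      ← hM.pull_orbitMap_translate hinv p 0 c s, pull_apply, hM.rdiff_orbitMap_realVec p _ hb,
      hM.rdiff_orbitMap_imagVec, zero_add, hb']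
  have hchain := rdiff_comp (g := modelPot a ν) (f := γ) (0 : ℝ)
    (hγ0 ▸ hν.mdifferentiableAt_modelPot hp (hz p hp)) hγ
  rw [rdiff_congr hconst, rdiff_const, hγ0] at hchain
  rw [← hb', ← neg_eq_zero, hν.contract_eq_rdiff hp (hz p hp) ha, torusField_eq]
  exact (DFunLike.congr_fun hchain 1).symm

theorem IsModelAtInfinity.ddbar_apply [IsManifold 𝓘(ℂ, E) ω M]
    (hν : IsModelAtInfinity a ΩD Ω X K K' ν) (hp : p ∉ K) (hz : (ν p).1 ≠ 0 ∨ a = 1)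
    {f : M → ℝ} (hf : f =ᶠ[𝓝 p] modelPot a ν) (u v : E) :
    ddbar f p u v = coneForm a (ν p).1 (rdiff E ℂ (fun p => (ν p).1) p u)
      (rdiff E ℂ (fun p => (ν p).1) p v) := by
  set e := chartAt E p
  have hps : p ∈ e.source := mem_chart_source E p
  have hsymm : ContMDiffAt 𝓘(ℂ, E) 𝓘(ℂ, E) ω e.symm (e p) :=
    contMDiffOn_chart_symm.contMDiffAt (e.open_target.mem_nhds (e.map_source hps))
  have hfst : ((fun p => (ν p).1) ∘ e.symm) (e p) = (ν p).1 := by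
    simp [e.left_inv hps]
  have hlocal : f ∘ e.symm =ᶠ[𝓝 (e p)]
      (fun z => conePot a z / 2 - 1) ∘ ((fun p => (ν p).1) ∘ e.symm) :=
    (e.tendsto_symm hps).eventually hf
  have hζ : ContDiffAt ℂ 2 ((fun p => (ν p).1) ∘ e.symm) (e p) :=
    (((e.left_inv hps).symm ▸ hν.contMDiffAt_fst hp).comp (e p) hsymm).contDiffAt.of_le le_top
  have hψ : ContDiffAt ℝ 2 (fun z => conePot a z / 2 - 1)
      (((fun p => (ν p).1) ∘ e.symm) (e p)) := by
    rw [hfst]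
    exact (((contDiffAt_conePot hz).div_const 2).sub contDiffAt_const).of_le ENat.LEInfty.out
  rw [ddbar, flatDdbar_congr hlocal, flatDdbar_comp hψ hζ, hfst, flatDdbar_half_conePot,
    ← rdiff_eq_fderiv_chartAt (hν.mdifferentiableAt_fst hp)]

end ModelPotential

section Laplacian

variable {E : Type*} [NormedAddCommGroup E] [NormedSpace ℂ E] [FiniteDimensional ℂ E]
  {M : Type*} [TopologicalSpace M] [ChartedSpace E M] {Ω : BilinField E M}

theorem IsKahler.metric_isInvertible (hΩ : IsKahler Ω) (p : M) : (metric Ω p).IsInvertible := by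
  have : FiniteDimensional ℝ E := .trans ℝ ℂ E
  have hinj : Function.Injective (metric Ω p) := by
    rw [injective_iff_map_eq_zero]
    intro u hu
    by_contra hne
    exact (hΩ.positive p u hne).ne' (DFunLike.congr_fun hu u)
  have hdim : Module.finrank ℝ E = Module.finrank ℝ (E →L[ℝ] ℝ) := by
    rw [← (LinearMap.toContinuousLinearMap (𝕜 := ℝ) (E := E) (F' := ℝ)).finrank_eq]
    exact (Subspace.dual_finrank_eq (K := ℝ) (V := E)).symm
  exact ⟨(LinearMap.linearEquivOfInjective (metric Ω p).toLinearMap hinj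
    hdim).toContinuousLinearEquiv, by ext u v; rfl⟩

theorem IsKahler.laplacian_eq_half_trace (hΩ : IsKahler Ω) {f : M → ℝ} {p : M} {T : E →L[ℝ] E}
    (hT : ∀ u v, ddbar f p u v = Ω p (T u) v) :
    laplacian Ω f p = 1 / 2 * LinearMap.trace ℝ E T.toLinearMap := by
  have hcomp : metric (ddbar f) p = (metric Ω p).comp T := by
    ext u v
    exact hT u (J E v)
  obtain ⟨e, he⟩ := hΩ.metric_isInvertible p
  rw [laplacian, hcomp, ← he, ContinuousLinearMap.inverse_equiv,
    ← ContinuousLinearMap.comp_assoc, e.coe_symm_comp_coe, ContinuousLinearMap.id_comp]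

variable {F : Type*} [NormedAddCommGroup F] [NormedSpace ℂ F] [FiniteDimensional ℂ F]
  {D : Type*} [TopologicalSpace D] [ChartedSpace F D]
  {a : ℝ} {ΩD : BilinField F D} {X : VField E M}
  {K : Set M} {K' : Set (ℂ × D)} {ν : OpenPartialHomeomorph M (ℂ × D)}

-- With respect to `Ω`, `i ∂ ∂̄ f` is the projection onto the factor `ℂ`, of real trace `2`.
theorem IsModelAtInfinity.laplacian_eq_one [IsManifold 𝓘(ℂ, E) ω M]
    (hν : IsModelAtInfinity a ΩD Ω X K K' ν) (hΩ : IsKahler Ω)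
    (hdim : Module.finrank ℂ F + 1 = Module.finrank ℂ E) {p : M} (hp : p ∉ K)
    (hz : (ν p).1 ≠ 0 ∨ a = 1) {f : M → ℝ} (hf : f =ᶠ[𝓝 p] modelPot a ν) :
    laplacian Ω f p = 1 := by
  have : FiniteDimensional ℝ E := .trans ℝ ℂ E
  have : FiniteDimensional ℝ F := .trans ℝ ℂ F
  let L : E ≃ₗ[ℝ] ℂ × F := LinearEquiv.ofBijective
    ((rdiff E ℂ (fun p => (ν p).1) p).prod (rdiff E F (fun p => (ν p).2) p)).toLinearMap
    (hν.rdiff_bijective hΩ hdim hp)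
  let P : ℂ × F →ₗ[ℝ] ℂ × F := LinearMap.prodMap LinearMap.id 0
  let T : E →L[ℝ] E := LinearMap.toContinuousLinearMap (L.symm.conj P)
  have hLT : ∀ u, L (T u) = P (L u) := fun u => by simp [T, LinearEquiv.conj_apply]
  have hfst : ∀ u, rdiff E ℂ (fun p => (ν p).1) p (T u) = rdiff E ℂ (fun p => (ν p).1) p u :=
    fun u => congrArg Prod.fst (hLT u)
  have hsnd : ∀ u, rdiff E F (fun p => (ν p).2) p (T u) = 0 := fun u => congrArg Prod.snd (hLT u)
  have hT : ∀ u v, ddbar f p u v = Ω p (T u) v := fun u v => by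
    rw [hν.ddbar_apply hp hz hf, hν.form_apply hp, hfst, hsnd]
    simp
  have htrace : LinearMap.trace ℝ E T.toLinearMap = 2 := by
    change LinearMap.trace ℝ E (L.symm.conj P) = 2
    rw [LinearMap.trace_conj', LinearMap.trace_prodMap']
    simp
  rw [hΩ.laplacian_eq_half_trace hT, htrace]
  norm_num

end Laplacian

section Norms

variable {E : Type*} [NormedAddCommGroup E] [NormedSpace ℂ E]

theorem metric_smul_smul {M : Type*} (Ω : BilinField E M) (p : M) (c : ℝ) (v : E) :
    metric Ω p (c • v) (c • v) = c ^ 2 * metric Ω p v v := by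
  simp
  ring

theorem norm_J_le (v : E) : ‖J E v‖ ≤ ‖v‖ := by
  simp [J, norm_smul]

theorem form_J_le (B : E →L[ℝ] E →L[ℝ] ℝ) {C : ℝ} (hB : ‖B‖ ≤ C) (v : E) :
    B v (J E v) ≤ C * ‖v‖ ^ 2 := by
  have hC : 0 ≤ C := (norm_nonneg B).trans hB
  calc B v (J E v) ≤ ‖B‖ * ‖v‖ * ‖J E v‖ := (le_abs_self _).trans (B.le_opNorm₂ v (J E v))
    _ ≤ C * ‖v‖ * ‖v‖ := by gcongr; exact norm_J_le v
    _ = C * ‖v‖ ^ 2 := by ring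

end Norms

section Distance

variable {E : Type*} [NormedAddCommGroup E] [NormedSpace ℂ E]
  {M : Type*} [TopologicalSpace M] [ChartedSpace E M] {Ω : BilinField E M}

/-- The length of a tangent vector for the metric of `Ω`, as used in `kahlerEDist`. -/
abbrev kahlerENorm (Ω : BilinField E M) (p : M) : ENorm (TangentSpace 𝓘(ℝ, E) p) :=
  ⟨fun v : E => ENNReal.ofReal (Real.sqrt (metric Ω p v v))⟩

theorem kahlerENorm_smul (Ω : BilinField E M) (p : M) :
    letI := kahlerENorm Ω p
    ENormSMulClass ℝ (TangentSpace 𝓘(ℝ, E) p) := by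
  let := kahlerENorm Ω p
  have hsmul : ∀ (c : ℝ) (v : E), ENNReal.ofReal (Real.sqrt (metric Ω p (c • v) (c • v)))
      = ‖c‖ₑ * ENNReal.ofReal (Real.sqrt (metric Ω p v v)) := fun c v => by
    rw [metric_smul_smul, Real.sqrt_mul (sq_nonneg c), Real.sqrt_sq_eq_abs,
      ENNReal.ofReal_mul (abs_nonneg c), ← Real.enorm_eq_ofReal_abs]
  exact ⟨hsmul⟩

theorem kahlerEDist_comm (Ω : BilinField E M) (p q : M) :
    kahlerEDist Ω p q = kahlerEDist Ω q p := by
  let : ∀ p : M, ENorm (TangentSpace 𝓘(ℝ, E) p) := kahlerENorm Ω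
  have : ∀ p : M, ENormSMulClass ℝ (TangentSpace 𝓘(ℝ, E) p) := kahlerENorm_smul Ω
  exact Manifold.riemannianEDist_comm (I := 𝓘(ℝ, E))

theorem kahlerEDist_triangle (Ω : BilinField E M) (p q r : M) :
    kahlerEDist Ω p r ≤ kahlerEDist Ω p q + kahlerEDist Ω q r := by
  let : ∀ p : M, ENorm (TangentSpace 𝓘(ℝ, E) p) := kahlerENorm Ω
  have : ∀ p : M, ENormSMulClass ℝ (TangentSpace 𝓘(ℝ, E) p) := kahlerENorm_smul Ω
  exact Manifold.riemannianEDist_triangle (I := 𝓘(ℝ, E))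

theorem kahlerEDist_le_add {p q r : M} {c d : ℝ} (hc : 0 ≤ c) (hd : 0 ≤ d)
    (hpq : kahlerEDist Ω p q ≤ ENNReal.ofReal c) (hqr : kahlerEDist Ω q r ≤ ENNReal.ofReal d) :
    kahlerEDist Ω p r ≤ ENNReal.ofReal (c + d) := by
  rw [ENNReal.ofReal_add hc hd]
  exact (kahlerEDist_triangle Ω p q r).trans (add_le_add hpq hqr)

theorem kahlerEDist_le_of_speed_le {γ : ℝ → M} {s t C : ℝ} (hst : s ≤ t)
    (hγ : ContMDiffOn 𝓘(ℝ, ℝ) 𝓘(ℝ, E) 1 γ (Set.Icc s t)) (hC : 0 ≤ C)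
    (hspeed : ∀ r ∈ Set.Icc s t,
      metric Ω (γ r) (rdiff ℝ E γ r 1) (rdiff ℝ E γ r 1) ≤ C ^ 2) :
    kahlerEDist Ω (γ s) (γ t) ≤ ENNReal.ofReal (C * (t - s)) := by
  let : ∀ p : M, ENorm (TangentSpace 𝓘(ℝ, E) p) := kahlerENorm Ω
  have : ∀ p : M, ENormSMulClass ℝ (TangentSpace 𝓘(ℝ, E) p) := kahlerENorm_smul Ω
  refine (Manifold.riemannianEDist_le_pathELength (I := 𝓘(ℝ, E)) hγ rfl rfl hst).trans ?_
  rw [Manifold.pathELength_eq_lintegral_mfderiv_Icc, ENNReal.ofReal_mul hC, ← Real.volume_Icc,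
    ← MeasureTheory.setLIntegral_const]
  refine MeasureTheory.setLIntegral_mono measurable_const fun r hr => ?_
  change ENNReal.ofReal (Real.sqrt (metric Ω (γ r) (rdiff ℝ E γ r 1) (rdiff ℝ E γ r 1))) ≤ _
  exact ENNReal.ofReal_le_ofReal ((Real.sqrt_le_sqrt (hspeed r hr)).trans_eq (Real.sqrt_sq hC))

theorem kahlerEDist_le_of_pull_le {G : Type*} [NormedAddCommGroup G] [NormedSpace ℂ G]
    {Ψ : G → M} {c : ℝ → G} {s t C : ℝ} (hst : s ≤ t)
    (hc : ∀ r ∈ Set.Icc s t, ContDiffAt ℝ 1 c r)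
    (hΨ : ∀ r ∈ Set.Icc s t, ContMDiffAt 𝓘(ℂ, G) 𝓘(ℂ, E) ω Ψ (c r)) (hC : 0 ≤ C)
    (hspeed : ∀ r ∈ Set.Icc s t, pull Ω Ψ (c r) (deriv c r) (J G (deriv c r)) ≤ C ^ 2) :
    kahlerEDist Ω (Ψ (c s)) (Ψ (c t)) ≤ ENNReal.ofReal (C * (t - s)) := by
  have hsmooth : ∀ r ∈ Set.Icc s t, ContMDiffAt 𝓘(ℝ, ℝ) 𝓘(ℝ, E) 1 (Ψ ∘ c) r := fun r hr =>
    ((contMDiffAt_restrictScalars (hΨ r hr)).of_le le_top).comp r (hc r hr).contMDiffAt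
  refine kahlerEDist_le_of_speed_le (γ := Ψ ∘ c) hst
    (fun r hr => (hsmooth r hr).contMDiffWithinAt) hC fun r hr => ?_
  have hΨr : MDifferentiableAt 𝓘(ℂ, G) 𝓘(ℂ, E) Ψ (c r) := (hΨ r hr).mdifferentiableAt (by simp)
  have hcr : DifferentiableAt ℝ c r := (hc r hr).differentiableAt (by simp)
  have hvelocity : rdiff ℝ E (Ψ ∘ c) r 1 = rdiff G E Ψ (c r) (deriv c r) := by
    rw [rdiff_comp r (mdifferentiableAt_restrictScalars hΨr) hcr.mdifferentiableAt,
      rdiff_eq_fderiv]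
    rfl
  have hpull := hspeed r hr
  rw [pull_apply, rdiff_J hΨr] at hpull
  rw [hvelocity]
  exact hpull

variable [IsManifold 𝓘(ℂ, E) ω M]

theorem kahlerEDist_chartAt_symm_le {x : M} {S : Set E} {C : ℝ} (hS : Convex ℝ S)
    (hSt : S ⊆ (chartAt E x).target) (hC : ∀ y ∈ S, ‖coordExpr Ω x y‖ ≤ C) {y y' : E}
    (hy : y ∈ S) (hy' : y' ∈ S) :
    kahlerEDist Ω ((chartAt E x).symm y) ((chartAt E x).symm y')
      ≤ ENNReal.ofReal (Real.sqrt C * ‖y' - y‖) := by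
  have hC0 : 0 ≤ C := (coordExpr Ω x y).opNorm_nonneg.trans (hC y hy)
  let c : ℝ → E := AffineMap.lineMap y y'
  have hcS : ∀ r ∈ Set.Icc (0 : ℝ) 1, c r ∈ S := fun r hr => hS.lineMap_mem hy hy' hr
  have hdist := kahlerEDist_le_of_pull_le (Ω := Ω) (Ψ := (chartAt E x).symm) (c := c)
    (C := Real.sqrt C * ‖y' - y‖) zero_le_one
    (fun r _ => (AffineMap.contDiff_lineMap y y').contDiffAt)
    (fun r hr => contMDiffOn_chart_symm.contMDiffAt
      ((chartAt E x).open_target.mem_nhds (hSt (hcS r hr)))) (by positivity) fun r hr => by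
      rw [AffineMap.hasDerivAt_lineMap.deriv, mul_pow, Real.sq_sqrt hC0]
      exact form_J_le _ (hC _ (hcS r hr)) _
  simpa [c] using hdist

theorem IsKahler.eventually_kahlerEDist_le (hΩ : IsKahler Ω) (x : M) {ε : ℝ} (hε : 0 < ε) :
    ∀ᶠ q in 𝓝 x, kahlerEDist Ω q x ≤ ENNReal.ofReal ε := by
  set e := chartAt E x
  have hx : x ∈ e.source := mem_chart_source E x
  have hnorm : ContinuousAt (fun y => ‖coordExpr Ω x y‖) (e x) :=
    ContinuousAt.norm (E := E →L[ℝ] E →L[ℝ] ℝ)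
      (hΩ.coordExpr_contDiffAt x (e.map_source hx)).continuousAt
  set C := ‖coordExpr Ω x (e x)‖ + 1
  obtain ⟨ρ, hρ, hball⟩ := Metric.eventually_nhds_iff_ball.1
    ((hnorm.eventually_le_const (lt_add_one _)).and
      (e.open_target.eventually_mem (e.map_source hx)))
  have hsmall : Filter.Tendsto (fun q => Real.sqrt C * ‖e x - e q‖) (𝓝 x) (𝓝 0) := by
    simpa using ((e.continuousAt hx).tendsto.const_sub (e x)).norm.const_mul (Real.sqrt C)
  filter_upwards [e.open_source.mem_nhds hx, e.continuousAt hx (Metric.ball_mem_nhds _ hρ),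
    hsmall.eventually_le_const hε] with q hq hqρ hqε
  have hdist := kahlerEDist_chartAt_symm_le (Ω := Ω) (convex_ball (e x) ρ)
    (fun y hy => (hball y hy).2) (fun y hy => (hball y hy).1) hqρ (Metric.mem_ball_self hρ)
  rw [e.left_inv hq, e.left_inv hx] at hdist
  exact hdist.trans (ENNReal.ofReal_le_ofReal hqε)

theorem IsKahler.cauchy_of_kahlerEDist_le {p m : ℕ → M} {x : M} {δ : ℕ → ℝ}
    (hΩ : IsKahler Ω) (hm : Filter.Tendsto m Filter.atTop (𝓝 x))
    (hδ : Filter.Tendsto δ Filter.atTop (𝓝 0))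
    (hpm : ∀ i, kahlerEDist Ω (p i) (m i) ≤ ENNReal.ofReal (δ i)) (ε : ENNReal) (hε : 0 < ε) :
    ∃ N, ∀ k ≥ N, ∀ l ≥ N, kahlerEDist Ω (p k) (p l) < ε := by
  obtain ⟨η, -, hη⟩ := ENNReal.lt_iff_exists_real_btwn.1 hε
  have hη0 : 0 < η / 4 := div_pos (ENNReal.ofReal_pos.1 hη.1) four_pos
  obtain ⟨N, hN⟩ := Filter.eventually_atTop.1 ((hδ.eventually_le_const hη0).and
    (hm.eventually (hΩ.eventually_kahlerEDist_le x hη0)))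
  have hpx : ∀ k ≥ N, kahlerEDist Ω (p k) x ≤ ENNReal.ofReal (η / 4 + η / 4) := fun k hk =>
    kahlerEDist_le_add hη0.le hη0.le
      ((hpm k).trans (ENNReal.ofReal_le_ofReal (hN k hk).1)) (hN k hk).2
  refine ⟨N, fun k hk l hl => lt_of_le_of_lt ?_ hη.2⟩
  have hkl := kahlerEDist_le_add (by positivity) (by positivity) (hpx k hk)
    ((kahlerEDist_comm Ω x (p l)).trans_le (hpx l hl))
  rwa [show η / 4 + η / 4 + (η / 4 + η / 4) = η by ring] at hkl

end Distance

section Complete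

variable {E : Type*} [NormedAddCommGroup E] [NormedSpace ℂ E]
  {M : Type*} [TopologicalSpace M] [ChartedSpace E M] {Ω : BilinField E M}

theorem IsCompleteMetric.exists_mapClusterPt (hΩ : IsCompleteMetric Ω) {γ : ℝ → M} {τ C : ℝ}
    (hτ : 0 < τ)
    (hγ : ∀ s t, 0 ≤ s → s ≤ t → t < τ →
      kahlerEDist Ω (γ s) (γ t) ≤ ENNReal.ofReal (C * (t - s))) :
    ∃ m, MapClusterPt m (𝓝[<] τ) γ := by
  obtain ⟨θ, -, hθ, hθτ⟩ := exists_seq_strictMono_tendsto' hτ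
  have hdist : ∀ k l, kahlerEDist Ω (γ (θ k)) (γ (θ l)) ≤ ENNReal.ofReal |C * θ k - C * θ l| := by
    intro k l
    rw [← mul_sub]
    rcases le_total (θ k) (θ l) with h | h
    · refine (hγ _ _ (hθ k).1.le h (hθ l).2).trans (ENNReal.ofReal_le_ofReal ?_)
      rw [← neg_sub, mul_neg]
      exact neg_le_abs _
    · rw [kahlerEDist_comm]
      exact (hγ _ _ (hθ l).1.le h (hθ k).2).trans (ENNReal.ofReal_le_ofReal (le_abs_self _))
  obtain ⟨m, hm⟩ := hΩ (γ ∘ θ) fun ε hε => by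
    obtain ⟨δ, -, hδ⟩ := ENNReal.lt_iff_exists_real_btwn.1 hε
    obtain ⟨N, hN⟩ := Metric.cauchySeq_iff.1 (hθτ.const_mul C).cauchySeq δ
      (ENNReal.ofReal_pos.1 hδ.1)
    exact ⟨N, fun k hk l hl => (hdist k l).trans_lt
      ((ENNReal.ofReal_le_ofReal (hN k hk l hl).le).trans_lt hδ.2)⟩
  exact ⟨m, hm.mapClusterPt.of_comp
    (tendsto_nhdsWithin_iff.2 ⟨hθτ, Filter.Eventually.of_forall fun j => (hθ j).2⟩)⟩

end Complete

section Cone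

variable {a : ℝ} {z : ℂ}

theorem coneForm_I_le (a : ℝ) (z v : ℂ) {C : ℝ} (hC : ‖fderiv ℝ (fderiv ℝ (conePot a)) z‖ ≤ C) :
    coneForm a z v (Complex.I * v) ≤ C * ‖v‖ ^ 2 := by
  set B := fderiv ℝ (fderiv ℝ (conePot a)) z
  have hBC : ∀ u : ℂ, ‖u‖ = ‖v‖ → |B u u| ≤ C * ‖v‖ ^ 2 := fun u hu => by
    have hBu := B.le_opNorm₂ u u
    rw [hu, mul_assoc, ← sq] at hBu
    exact hBu.trans (by gcongr)
  have hI : Complex.I * (Complex.I * v) = -v := by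
    rw [← mul_assoc, Complex.I_mul_I, neg_one_mul]
  have hv := abs_le.1 (hBC v rfl)
  have hIv := abs_le.1 (hBC (Complex.I * v) (by simp))
  rw [coneForm_apply, hI, map_neg]
  linarith [hv.1, hv.2, hIv.2]

theorem coneForm_self_I (ha : a ≠ 0) (hz : z ≠ 0 ∨ a = 1) (c : ℝ) :
    coneForm a z (c • z) (Complex.I * (c • z)) = c ^ 2 * a ^ 2 * conePot a z := by
  have hradial := coneForm_radial ha hz z
  have hswap : coneForm a z z (Complex.I * z) = - coneForm a z (Complex.I * z) z := by
    rw [coneForm_apply, coneForm_apply]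
    ring
  rw [fderiv_conePot_self hz, mul_smul_comm, map_smul, smul_apply, smul_eq_mul] at hradial
  rw [mul_smul_comm, map_smul, map_smul, smul_apply, hswap]
  simp only [smul_eq_mul]
  field_simp at hradial
  linear_combination (-c ^ 2) * hradial

end Cone

section ProductChart

variable {F : Type*} [NormedAddCommGroup F] {D : Type*} [TopologicalSpace D] [ChartedSpace F D]

/-- The coordinates of `ℂ × D` given by the identity of `ℂ` and the inverse of the chart at `x`;
they are meaningful at the points `w` with `w.2` in the target of that chart. -/
def prodChart (x : D) (w : ℂ × F) : ℂ × D := (w.1, (chartAt F x).symm w.2)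

theorem prodChart_chartAt {x : D} {q : ℂ × D} (hq : q.2 ∈ (chartAt F x).source) :
    prodChart x (q.1, chartAt F x q.2) = q :=
  Prod.ext rfl ((chartAt F x).left_inv hq)

theorem continuousAt_prodChart (x : D) {w : ℂ × F} (hw : w.2 ∈ (chartAt F x).target) :
    ContinuousAt (prodChart x) w :=
  continuousAt_fst.prodMk (((chartAt F x).continuousAt_symm hw).comp continuousAt_snd)

end ProductChart

section ProductCoordinates

theorem exists_first_mem {Y : Type*} [TopologicalSpace Y] {g : ℝ → Y} {S : Set Y} {s t : ℝ}
    (hst : s ≤ t) (hg : ContinuousOn g (Set.Icc s t)) (hS : IsClosed S) (hs : g s ∉ S)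
    (ht : g t ∈ S) : ∃ τ ∈ Set.Ioc s t, g τ ∈ S ∧ ∀ r ∈ Set.Ico s τ, g r ∉ S := by
  have hcompact : IsCompact (Set.Icc s t ∩ g ⁻¹' S) := isCompact_Icc.of_isClosed_subset
    (hg.preimage_isClosed_of_isClosed isClosed_Icc hS) Set.inter_subset_left
  obtain ⟨τ, ⟨hτ, hτS⟩, hleast⟩ := hcompact.exists_isLeast ⟨t, Set.right_mem_Icc.2 hst, ht⟩
  refine ⟨τ, ⟨lt_of_le_of_ne hτ.1 ?_, hτ.2⟩, hτS, fun r hr hrS => ?_⟩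
  · rintro rfl
    exact hs hτS
  · exact (hleast ⟨⟨hr.1, hr.2.le.trans hτ.2⟩, hrS⟩).not_gt hr.2

variable {F : Type*} [NormedAddCommGroup F] [NormedSpace ℂ F]
  {D : Type*} [TopologicalSpace D] [ChartedSpace F D]
  {E : Type*} [NormedAddCommGroup E] [NormedSpace ℂ E]
  {M : Type*} [TopologicalSpace M] [ChartedSpace E M]
  {a : ℝ} {ΩD : BilinField F D} {Ω : BilinField E M} {X : VField E M}
  {K : Set M} {K' : Set (ℂ × D)} {ν : OpenPartialHomeomorph M (ℂ × D)}

namespace IsModelAtInfinity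

theorem isOpen_compl' (hν : IsModelAtInfinity a ΩD Ω X K K' ν) : IsOpen K'ᶜ :=
  hν.target_eq ▸ ν.open_target

theorem eventually_right_inv_prodChart (hν : IsModelAtInfinity a ΩD Ω X K K' ν) {x : D}
    {w : ℂ × F} (hw : w.2 ∈ (chartAt F x).target) (hK : prodChart x w ∉ K') :
    ∀ᶠ w' in 𝓝 w, ν (ν.symm (prodChart x w')) = prodChart x w' := by
  filter_upwards [continuousAt_prodChart x hw (hν.isOpen_compl'.mem_nhds hK)] with w' hw'
  exact hν.right_inv hw'

theorem mem_of_mapClusterPt [T2Space D] (hν : IsModelAtInfinity a ΩD Ω X K K' ν) {ι : Type*}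
    {l : Filter ι} {g : ι → ℂ × D} {q : ℂ × D} {m : M} (hg : Filter.Tendsto g l (𝓝 q))
    (hgK : ∀ᶠ i in l, g i ∉ K') (hq : q ∈ K') (hm : MapClusterPt m l (fun i => ν.symm (g i))) :
    m ∈ K := by
  by_contra hmK
  have hνg : (fun i => ν (ν.symm (g i))) =ᶠ[l] g := hgK.mono fun i hi => hν.right_inv hi
  have hcluster : MapClusterPt (ν m) l (fun i => ν (ν.symm (g i))) :=
    hm.continuousAt_comp (ν.continuousAt (hν.mem_source hmK))
  have : (𝓝 (ν m) ⊓ 𝓝 q).NeBot := ClusterPt.mono hcluster (hg.congr' hνg.symm)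
  exact hν.map_notMem hmK (eq_of_nhds_neBot this ▸ hq)

variable [IsManifold 𝓘(ℂ, F) ω D]

theorem contMDiffAt_symm_prodChart (hν : IsModelAtInfinity a ΩD Ω X K K' ν) {x : D} {w : ℂ × F}
    (hw : w.2 ∈ (chartAt F x).target) (hK : prodChart x w ∉ K') :
    ContMDiffAt 𝓘(ℂ, ℂ × F) 𝓘(ℂ, E) ω (fun w => ν.symm (prodChart x w)) w := by
  have hfst : ContMDiffAt 𝓘(ℂ, ℂ × F) 𝓘(ℂ, ℂ) ω (fun w : ℂ × F => w.1) w :=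
    contDiff_fst.contMDiff.contMDiffAt
  have hsnd : ContMDiffAt 𝓘(ℂ, ℂ × F) 𝓘(ℂ, F) ω (fun w : ℂ × F => w.2) w :=
    contDiff_snd.contMDiff.contMDiffAt
  have hchart : ContMDiffAt 𝓘(ℂ, F) 𝓘(ℂ, F) ω (chartAt F x).symm w.2 :=
    contMDiffOn_chart_symm.contMDiffAt ((chartAt F x).open_target.mem_nhds hw)
  exact (hν.holomorphic_symm.contMDiffAt (hν.isOpen_compl'.mem_nhds hK)).comp w
    (hfst.prodMk (hchart.comp w hsnd))

theorem mdifferentiableAt_symm_prodChart (hν : IsModelAtInfinity a ΩD Ω X K K' ν) {x : D}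
    {w : ℂ × F} (hw : w.2 ∈ (chartAt F x).target) (hK : prodChart x w ∉ K') :
    MDifferentiableAt 𝓘(ℝ, ℂ × F) 𝓘(ℝ, E) (fun w => ν.symm (prodChart x w)) w :=
  mdifferentiableAt_restrictScalars
    ((hν.contMDiffAt_symm_prodChart hw hK).mdifferentiableAt (by simp))

theorem rdiff_fst_rdiff_symm_prodChart (hν : IsModelAtInfinity a ΩD Ω X K K' ν) {x : D}
    {w : ℂ × F} (hw : w.2 ∈ (chartAt F x).target) (hK : prodChart x w ∉ K') (u : ℂ × F) :
    rdiff E ℂ (fun p => (ν p).1) (ν.symm (prodChart x w))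
      (rdiff (ℂ × F) E (fun w => ν.symm (prodChart x w)) w u) = u.1 := by
  have hcomp : (fun p => (ν p).1) ∘ (fun w => ν.symm (prodChart x w)) =ᶠ[𝓝 w] Prod.fst := by
    filter_upwards [hν.eventually_right_inv_prodChart hw hK] with w' hw'
    exact congrArg Prod.fst hw'
  have hchain := rdiff_comp w (hν.mdifferentiableAt_fst (hν.symm_notMem hK))
    (hν.mdifferentiableAt_symm_prodChart hw hK)
  rw [rdiff_congr hcomp, rdiff_eq_fderiv, fderiv_fst] at hchain
  exact (DFunLike.congr_fun hchain u).symm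

theorem rdiff_snd_rdiff_symm_prodChart (hν : IsModelAtInfinity a ΩD Ω X K K' ν) {x : D}
    {w : ℂ × F} (hw : w.2 ∈ (chartAt F x).target) (hK : prodChart x w ∉ K') (u : ℂ × F) :
    rdiff E F (fun p => (ν p).2) (ν.symm (prodChart x w))
      (rdiff (ℂ × F) E (fun w => ν.symm (prodChart x w)) w u)
      = rdiff F F (chartAt F x).symm w.2 u.2 := by
  have hcomp : (fun p => (ν p).2) ∘ (fun w => ν.symm (prodChart x w))
      =ᶠ[𝓝 w] (chartAt F x).symm ∘ Prod.snd := by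
    filter_upwards [hν.eventually_right_inv_prodChart hw hK] with w' hw'
    exact congrArg Prod.snd hw'
  have hchain := rdiff_comp w (hν.mdifferentiableAt_snd (hν.symm_notMem hK))
    (hν.mdifferentiableAt_symm_prodChart hw hK)
  rw [rdiff_congr hcomp, rdiff_comp (g := (chartAt F x).symm) (f := (Prod.snd : ℂ × F → F)) w
    (mdifferentiableAt_chartAt_symm x hw) differentiableAt_snd.mdifferentiableAt,
    rdiff_eq_fderiv, fderiv_snd] at hchain
  exact (DFunLike.congr_fun hchain u).symm

theorem pull_symm_prodChart (hν : IsModelAtInfinity a ΩD Ω X K K' ν) {x : D} {w : ℂ × F}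
    (hw : w.2 ∈ (chartAt F x).target) (hK : prodChart x w ∉ K') (u v : ℂ × F) :
    pull Ω (fun w => ν.symm (prodChart x w)) w u v
      = coneForm a w.1 u.1 v.1 + coordExpr ΩD x w.2 u.2 v.2 := by
  simp only [pull_apply, hν.form_apply (hν.symm_notMem hK),
    hν.rdiff_fst_rdiff_symm_prodChart hw hK, hν.rdiff_snd_rdiff_symm_prodChart hw hK,
    hν.right_inv hK]
  rfl

variable {x : D} {c : ℝ → ℂ × F} {C ε : ℝ}

theorem kahlerEDist_symm_prodChart_le
    (hν : IsModelAtInfinity a ΩD Ω X K K' ν) {s t : ℝ} (hst : s ≤ t) (hC : 0 ≤ C)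
    (hx : ∀ r ∈ Set.Icc s t, (c r).2 ∈ (chartAt F x).target)
    (hK : ∀ r ∈ Set.Icc s t, prodChart x (c r) ∉ K')
    (hc : ∀ r ∈ Set.Icc s t, ContDiffAt ℝ 1 c r)
    (hspeed : ∀ r ∈ Set.Icc s t,
      coneForm a (c r).1 (deriv c r).1 (Complex.I * (deriv c r).1)
        + coordExpr ΩD x (c r).2 (deriv c r).2 (J F (deriv c r).2) ≤ C ^ 2) :
    kahlerEDist Ω (ν.symm (prodChart x (c s))) (ν.symm (prodChart x (c t)))
      ≤ ENNReal.ofReal (C * (t - s)) :=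
  kahlerEDist_le_of_pull_le (Ψ := fun w => ν.symm (prodChart x w)) hst hc
    (fun r hr => hν.contMDiffAt_symm_prodChart (hx r hr) (hK r hr)) hC fun r hr => by
      rw [hν.pull_symm_prodChart (hx r hr) (hK r hr)]
      exact hspeed r hr

-- A curve of finite length in the model that ends in `K'` lifts to `M` up to its first hitting
-- time of `K'`, and by completeness of `M` the lift has an end point.
theorem exists_mem_kahlerEDist_le [T2Space D] [IsManifold 𝓘(ℂ, E) ω M]
    (hν : IsModelAtInfinity a ΩD Ω X K K' ν)
    (hΩ : IsKahler Ω) (hcomplete : IsCompleteMetric Ω)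
    (hC : 0 ≤ C) (hCε : C < ε) (hcont : ContinuousOn c (Set.Icc 0 1))
    (hx : ∀ t ∈ Set.Icc (0 : ℝ) 1, (c t).2 ∈ (chartAt F x).target)
    (h0 : prodChart x (c 0) ∉ K') (h1 : prodChart x (c 1) ∈ K')
    (hc : ∀ t ∈ Set.Ico (0 : ℝ) 1, ContDiffAt ℝ 1 c t)
    (hspeed : ∀ t ∈ Set.Ico (0 : ℝ) 1,
      coneForm a (c t).1 (deriv c t).1 (Complex.I * (deriv c t).1)
        + coordExpr ΩD x (c t).2 (deriv c t).2 (J F (deriv c t).2) ≤ C ^ 2) :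
    ∃ m ∈ K, kahlerEDist Ω (ν.symm (prodChart x (c 0))) m ≤ ENNReal.ofReal ε := by
  have hmodel : ContinuousOn (fun t => prodChart x (c t)) (Set.Icc 0 1) := fun t ht =>
    (continuousAt_prodChart x (hx t ht)).comp_continuousWithinAt (hcont t ht)
  obtain ⟨τ, ⟨hτ0, hτ1⟩, hτK, hbefore⟩ :=
    exists_first_mem zero_le_one hmodel hν.compact'.isClosed h0 h1
  have hsub : Set.Ico 0 τ ⊆ Set.Ico (0 : ℝ) 1 := Set.Ico_subset_Ico_right hτ1
  have hdist : ∀ s t, 0 ≤ s → s ≤ t → t < τ → kahlerEDist Ω (ν.symm (prodChart x (c s)))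
      (ν.symm (prodChart x (c t))) ≤ ENNReal.ofReal (C * (t - s)) := fun s t hs hst ht => by
    have hI : Set.Icc s t ⊆ Set.Ico 0 τ := fun r hr => ⟨hs.trans hr.1, hr.2.trans_lt ht⟩
    exact hν.kahlerEDist_symm_prodChart_le hst hC
      (fun r hr => hx r (Set.Ico_subset_Icc_self (hsub (hI hr)))) (fun r hr => hbefore r (hI hr))
      (fun r hr => hc r (hsub (hI hr))) fun r hr => hspeed r (hsub (hI hr))
  obtain ⟨m, hm⟩ := hcomplete.exists_mapClusterPt hτ0 hdist
  have hlt : ∀ᶠ t in 𝓝[<] τ, t ∈ Set.Ico 0 τ := Ico_mem_nhdsLT hτ0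
  have hlim : Filter.Tendsto (fun t => prodChart x (c t)) (𝓝[<] τ) (𝓝 (prodChart x (c τ))) :=
    (hmodel τ ⟨hτ0.le, hτ1⟩).tendsto.mono_left (nhdsWithin_le_of_mem
      (hlt.mono fun t ht => Set.Ico_subset_Icc_self (hsub ht)))
  refine ⟨m, hν.mem_of_mapClusterPt hlim (hlt.mono hbefore) hτK hm, ?_⟩
  obtain ⟨t, hmt, ht⟩ :=
    ((hm.frequently (hΩ.eventually_kahlerEDist_le m (sub_pos.2 hCε))).and_eventually hlt).exists
  have h0t : kahlerEDist Ω (ν.symm (prodChart x (c 0))) (ν.symm (prodChart x (c t)))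
      ≤ ENNReal.ofReal C :=
    (hdist 0 t le_rfl ht.1 ht.2).trans (ENNReal.ofReal_le_ofReal
      (mul_le_of_le_one_right hC (by linarith [ht.2])))
  simpa using kahlerEDist_le_add hC (sub_pos.2 hCε).le h0t hmt

end IsModelAtInfinity

end ProductCoordinates

section ApexCurve

/-- The radial curve from `z` to the apex of the cone along which the radius `|z|^a` decreases
linearly. -/
def apexCurve (a : ℝ) (z : ℂ) (t : ℝ) : ℂ := (1 - t) ^ (1 / a) • z

variable {a t : ℝ}

theorem continuous_apexCurve (ha : 0 ≤ a) (z : ℂ) : Continuous (apexCurve a z) :=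
  ((continuous_const.sub continuous_id).rpow_const fun _ => Or.inr (by positivity)).smul
    continuous_const

theorem contDiffAt_apexCurve (a : ℝ) (z : ℂ) (ht : t < 1) : ContDiffAt ℝ 1 (apexCurve a z) t :=
  ((contDiffAt_const.sub contDiffAt_id).rpow_const_of_ne (sub_pos.2 ht).ne').smul contDiffAt_const

theorem hasDerivAt_apexCurve (a : ℝ) (z : ℂ) (ht : t < 1) :
    HasDerivAt (apexCurve a z) ((-(1 / a) / (1 - t)) • apexCurve a z t) t := by
  have ht' : 1 - t ≠ 0 := (sub_pos.2 ht).ne'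
  refine ((((hasDerivAt_id t).const_sub 1).rpow_const (Or.inl ht')).smul_const z).congr_deriv ?_
  rw [apexCurve, smul_smul, id, Real.rpow_sub_one ht']
  congr 1
  ring

theorem conePot_apexCurve (ha : a ≠ 0) (z : ℂ) (ht : t ≤ 1) :
    conePot a (apexCurve a z t) = (1 - t) ^ 2 * (‖z‖ ^ a) ^ 2 := by
  have ht' : 0 ≤ 1 - t := sub_nonneg.2 ht
  rw [conePot, apexCurve, norm_smul, Real.norm_of_nonneg (Real.rpow_nonneg ht' _), mul_comm 2 a,
    Real.rpow_mul (by positivity), Real.rpow_two, Real.mul_rpow (by positivity) (norm_nonneg _),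
    ← Real.rpow_mul ht', one_div_mul_cancel ha, Real.rpow_one, mul_pow]

theorem coneForm_deriv_apexCurve (ha : a ≠ 0) {z : ℂ} (hz : z ≠ 0) (ht : t < 1) :
    coneForm a (apexCurve a z t) (deriv (apexCurve a z) t)
      (Complex.I * deriv (apexCurve a z) t) = (‖z‖ ^ a) ^ 2 := by
  have ht' : 0 < 1 - t := sub_pos.2 ht
  have hne : apexCurve a z t ≠ 0 := smul_ne_zero (Real.rpow_pos_of_pos ht' _).ne' hz
  rw [(hasDerivAt_apexCurve a z ht).deriv, coneForm_self_I ha (Or.inl hne),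
    conePot_apexCurve ha z ht.le]
  field_simp

end ApexCurve

section Escape

theorem isCountablyGenerated_cocompact {Y : Type*} [TopologicalSpace Y]
    [WeaklyLocallyCompactSpace Y] [SigmaCompactSpace Y] :
    (Filter.cocompact Y).IsCountablyGenerated := by
  let κ := CompactExhaustion.choice Y
  have hκ : (Filter.cocompact Y).HasBasis (fun _ : ℕ => True) fun k => (κ k)ᶜ := by
    refine ⟨fun S => Filter.mem_cocompact.trans ⟨?_, ?_⟩⟩
    · rintro ⟨C, hC, hCS⟩
      obtain ⟨k, hk⟩ := κ.exists_superset_of_isCompact hC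
      exact ⟨k, trivial, (Set.compl_subset_compl.2 hk).trans hCS⟩
    · rintro ⟨k, -, hk⟩
      exact ⟨κ k, κ.isCompact k, hk⟩
  exact Filter.HasCountableBasis.isCountablyGenerated ⟨hκ, Set.to_countable _⟩

variable {F : Type*} [NormedAddCommGroup F] [NormedSpace ℂ F]
  {D : Type*} [TopologicalSpace D] [ChartedSpace F D]
  {E : Type*} [NormedAddCommGroup E] [NormedSpace ℂ E]
  {M : Type*} [TopologicalSpace M] [ChartedSpace E M]
  {a : ℝ} {ΩD : BilinField F D} {Ω : BilinField E M} {X : VField E M}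
  {K : Set M} {K' : Set (ℂ × D)} {ν : OpenPartialHomeomorph M (ℂ × D)}

/-- The points of `M \ K` lying over the exterior of the disc of radius `R` in `ℂ`: for large `R`,
the end of `M`. -/
def modelEnd (K : Set M) (ν : OpenPartialHomeomorph M (ℂ × D)) (R : ℝ) : Set M :=
  {p | p ∉ K ∧ R < ‖(ν p).1‖}

namespace IsModelAtInfinity

theorem zero_mem [FiniteDimensional ℂ F] [FiniteDimensional ℂ E]
    (hν : IsModelAtInfinity a ΩD Ω X K K' ν) (hΩ : IsKahler Ω)
    (hdim : Module.finrank ℂ F + 1 = Module.finrank ℂ E) (ha : a ≠ 1) (x : D) :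
    ((0 : ℂ), x) ∈ K' := by
  by_contra h
  have hz := hν.fst_ne_zero_or hΩ hdim (hν.symm_notMem h)
  rw [hν.right_inv h] at hz
  exact hz.elim (fun h => h rfl) ha

variable [IsManifold 𝓘(ℂ, F) ω D] [T2Space D] [IsManifold 𝓘(ℂ, E) ω M]

theorem exists_mem_kahlerEDist_le_of_convex (hν : IsModelAtInfinity a ΩD Ω X K K' ν)
    (hΩ : IsKahler Ω) (hcomplete : IsCompleteMetric Ω) {x : D} {S : Set (ℂ × F)} {C₁ C₂ ε : ℝ}
    (hS : Convex ℝ S) (hSt : ∀ w ∈ S, w.2 ∈ (chartAt F x).target)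
    (hC₁ : ∀ w ∈ S, ‖fderiv ℝ (fderiv ℝ (conePot a)) w.1‖ ≤ C₁)
    (hC₂ : ∀ w ∈ S, ‖coordExpr ΩD x w.2‖ ≤ C₂) {w w₀ : ℂ × F} (hw : w ∈ S) (hw₀ : w₀ ∈ S)
    (hwK : prodChart x w ∉ K') (hw₀K : prodChart x w₀ ∈ K')
    (hε : Real.sqrt (C₁ + C₂) * ‖w₀ - w‖ < ε) :
    ∃ m ∈ K, kahlerEDist Ω (ν.symm (prodChart x w)) m ≤ ENNReal.ofReal ε := by
  let c : ℝ → ℂ × F := AffineMap.lineMap w w₀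
  have hc0 : c 0 = w := AffineMap.lineMap_apply_zero w w₀
  have hc1 : c 1 = w₀ := AffineMap.lineMap_apply_one w w₀
  have hc : ContDiff ℝ 1 c := AffineMap.contDiff_lineMap w w₀
  have hcS : ∀ r ∈ Set.Icc (0 : ℝ) 1, c r ∈ S := fun r hr => hS.lineMap_mem hw hw₀ hr
  have hC₁0 : 0 ≤ C₁ := (fderiv ℝ (fderiv ℝ (conePot a)) w.1).opNorm_nonneg.trans (hC₁ w hw)
  have hC₂0 : 0 ≤ C₂ := (coordExpr ΩD x w.2).opNorm_nonneg.trans (hC₂ w hw)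
  rw [← hc0]
  refine hν.exists_mem_kahlerEDist_le hΩ hcomplete (by positivity) hε
    hc.continuous.continuousOn (fun r hr => hSt _ (hcS r hr)) (by rwa [hc0]) (by rwa [hc1])
    (fun r _ => hc.contDiffAt) fun r hr => ?_
  have hr' := hcS r (Set.Ico_subset_Icc_self hr)
  rw [AffineMap.hasDerivAt_lineMap.deriv, mul_pow, Real.sq_sqrt (add_nonneg hC₁0 hC₂0), add_mul]
  refine add_le_add ((coneForm_I_le a _ _ (hC₁ _ hr')).trans ?_)
    ((form_J_le _ (hC₂ _ hr') _).trans ?_)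
  · gcongr
    exact norm_fst_le _
  · gcongr
    exact norm_snd_le _

theorem eventually_exists_mem_of_smooth (hν : IsModelAtInfinity a ΩD Ω X K K' ν)
    (hΩ : IsKahler Ω) (hΩD : IsKahler ΩD) (hcomplete : IsCompleteMetric Ω) {q : ℂ × D}
    (hq : q ∈ K') (hz : q.1 ≠ 0 ∨ a = 1) {ε : ℝ} (hε : 0 < ε) :
    ∀ᶠ q' in 𝓝 q, q' ∉ K' → ∃ m ∈ K, kahlerEDist Ω (ν.symm q') m ≤ ENNReal.ofReal ε := by
  set e := chartAt F q.2
  have hx : q.2 ∈ e.source := mem_chart_source F q.2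
  let coord : ℂ × D → ℂ × F := fun q' => (q'.1, e q'.2)
  have hcoord : ContinuousAt coord q :=
    continuousAt_fst.prodMk ((e.continuousAt hx).comp continuousAt_snd)
  have hcone : ContinuousAt (fun z => ‖fderiv ℝ (fderiv ℝ (conePot a)) z‖) (coord q).1 :=
    ContinuousAt.norm (E := ℂ →L[ℝ] ℂ →L[ℝ] ℝ)
      (((contDiffAt_conePot hz).fderiv_right (m := ∞) (by simp)).fderiv_right (m := ∞)
        (by simp)).continuousAt
  have hform : ContinuousAt (fun y => ‖coordExpr ΩD q.2 y‖) (coord q).2 :=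
    ContinuousAt.norm (E := F →L[ℝ] F →L[ℝ] ℝ)
      (hΩD.coordExpr_contDiffAt q.2 (e.map_source hx)).continuousAt
  set C₁ := ‖fderiv ℝ (fderiv ℝ (conePot a)) (coord q).1‖ + 1
  set C₂ := ‖coordExpr ΩD q.2 (coord q).2‖ + 1
  obtain ⟨ρ, hρ, hball⟩ := Metric.eventually_nhds_iff_ball.1
    ((continuousAt_fst.eventually (hcone.eventually_le_const (lt_add_one _))).and
      (continuousAt_snd.eventually ((hform.eventually_le_const (lt_add_one _)).and
        (e.open_target.eventually_mem (e.map_source hx)))) :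
      ∀ᶠ w in 𝓝 (coord q), ‖fderiv ℝ (fderiv ℝ (conePot a)) w.1‖ ≤ C₁ ∧
        ‖coordExpr ΩD q.2 w.2‖ ≤ C₂ ∧ w.2 ∈ e.target)
  have hsmall : Filter.Tendsto (fun q' => Real.sqrt (C₁ + C₂) * ‖coord q - coord q'‖)
      (𝓝 q) (𝓝 0) := by
    simpa using (hcoord.tendsto.const_sub (coord q)).norm.const_mul (Real.sqrt (C₁ + C₂))
  filter_upwards [continuousAt_snd.eventually (e.open_source.mem_nhds hx),
    hcoord (Metric.ball_mem_nhds _ hρ), hsmall.eventually_lt_const hε] with q' hq'e hq'ρ hq'ε hq'K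
  have hq' : prodChart q.2 (coord q') = q' := prodChart_chartAt hq'e
  rw [← hq'] at hq'K ⊢
  exact hν.exists_mem_kahlerEDist_le_of_convex hΩ hcomplete (convex_ball (coord q) ρ)
    (fun w hw => (hball w hw).2.2) (fun w hw => (hball w hw).1) (fun w hw => (hball w hw).2.1)
    hq'ρ (Metric.mem_ball_self hρ) hq'K ((prodChart_chartAt hx).symm ▸ hq) hq'ε

theorem eventually_exists_mem_of_apex (hν : IsModelAtInfinity a ΩD Ω X K K' ν) (ha : 0 < a)
    (hΩ : IsKahler Ω) (hcomplete : IsCompleteMetric Ω)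
    (hK' : ∀ x : D, ((0 : ℂ), x) ∈ K') {q : ℂ × D} (hz : q.1 = 0) {ε : ℝ} (hε : 0 < ε) :
    ∀ᶠ q' in 𝓝 q, q' ∉ K' → ∃ m ∈ K, kahlerEDist Ω (ν.symm q') m ≤ ENNReal.ofReal ε := by
  have hradius : Filter.Tendsto (fun q' : ℂ × D => ‖q'.1‖ ^ a) (𝓝 q) (𝓝 0) := by
    have h : ContinuousAt (fun q' : ℂ × D => ‖q'.1‖ ^ a) q :=
      continuousAt_fst.norm.rpow_const (Or.inr ha.le)
    simpa [ContinuousAt, hz, Real.zero_rpow ha.ne'] using h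
  filter_upwards [hradius.eventually_lt_const hε] with q' hq' hqK
  have hq0 : q'.1 ≠ 0 := fun h => hqK (by
    have := hK' q'.2
    rwa [← h] at this)
  set e := chartAt F q'.2
  have hx : q'.2 ∈ e.source := mem_chart_source F q'.2
  let c : ℝ → ℂ × F := fun t => (apexCurve a q'.1 t, e q'.2)
  have hc0 : prodChart q'.2 (c 0) = q' := by
    simpa [c, apexCurve] using prodChart_chartAt hx
  have hc1 : prodChart q'.2 (c 1) ∈ K' := by
    simpa [c, apexCurve, prodChart, ha.ne'] using hK' _
  have hderiv : ∀ t < 1, deriv c t = (deriv (apexCurve a q'.1) t, 0) := fun t ht =>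
    ((hasDerivAt_apexCurve a q'.1 ht).differentiableAt.hasDerivAt.prodMk
      (hasDerivAt_const t _)).deriv
  rw [← hc0]
  refine hν.exists_mem_kahlerEDist_le hΩ hcomplete (by positivity) hq'
    ((continuous_apexCurve ha.le _).prodMk continuous_const).continuousOn
    (fun _ _ => e.map_source hx) (by rwa [hc0]) hc1
    (fun t ht => (contDiffAt_apexCurve a _ ht.2).prodMk contDiffAt_const) fun t ht => ?_
  rw [hderiv t ht.2, coneForm_deriv_apexCurve ha.ne' hq0 ht.2]
  simp

variable [FiniteDimensional ℂ F] [FiniteDimensional ℂ E]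

theorem eventually_exists_mem (hν : IsModelAtInfinity a ΩD Ω X K K' ν) (ha : 0 < a)
    (hΩ : IsKahler Ω) (hΩD : IsKahler ΩD) (hcomplete : IsCompleteMetric Ω)
    (hdim : Module.finrank ℂ F + 1 = Module.finrank ℂ E) {q : ℂ × D} (hq : q ∈ K')
    {ε : ℝ} (hε : 0 < ε) :
    ∀ᶠ q' in 𝓝 q, q' ∉ K' → ∃ m ∈ K, kahlerEDist Ω (ν.symm q') m ≤ ENNReal.ofReal ε := by
  by_cases hz : q.1 ≠ 0 ∨ a = 1
  · exact hν.eventually_exists_mem_of_smooth hΩ hΩD hcomplete hq hz hε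
  · push Not at hz
    exact hν.eventually_exists_mem_of_apex ha hΩ hcomplete (hν.zero_mem hΩ hdim hz.2) hz.1 hε

-- If the limit in the model lies in `K'`, a subsequence stays ever closer to the compact set `K`,
-- and completeness applies.
theorem exists_tendsto_subseq (hν : IsModelAtInfinity a ΩD Ω X K K' ν) (ha : 0 < a)
    [FirstCountableTopology M]
    (hΩ : IsKahler Ω) (hΩD : IsKahler ΩD) (hcomplete : IsCompleteMetric Ω)
    (hdim : Module.finrank ℂ F + 1 = Module.finrank ℂ E) {p : ℕ → M} (hp : ∀ j, p j ∉ K)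
    {q : ℂ × D} (hq : Filter.Tendsto (fun j => ν (p j)) Filter.atTop (𝓝 q)) :
    ∃ (y : M) (φ : ℕ → ℕ), StrictMono φ ∧ Filter.Tendsto (p ∘ φ) Filter.atTop (𝓝 y) := by
  by_cases hqK : q ∈ K'
  · have hclose : ∀ i : ℕ, ∀ᶠ j in Filter.atTop,
        ∃ m ∈ K, kahlerEDist Ω (p j) m ≤ ENNReal.ofReal (1 / ((i : ℝ) + 1)) := fun i => by
      filter_upwards [hq.eventually (hν.eventually_exists_mem ha hΩ hΩD hcomplete hdim hqK
        (ε := 1 / ((i : ℝ) + 1)) (by positivity))] with j hj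
      simpa only [hν.left_inv (hp j)] using hj (hν.map_notMem (hp j))
    obtain ⟨ψ, hψ, hψK⟩ := Filter.extraction_forall_of_eventually hclose
    choose m hmK hmdist using hψK
    obtain ⟨x, -, χ, hχ, hx⟩ := hν.compact.tendsto_subseq hmK
    obtain ⟨y, hy⟩ := hcomplete (p ∘ (ψ ∘ χ)) (hΩ.cauchy_of_kahlerEDist_le hx
      ((tendsto_one_div_add_atTop_nhds_zero_nat (𝕜 := ℝ)).comp hχ.tendsto_atTop)
      fun i => hmdist (χ i))
    exact ⟨y, ψ ∘ χ, hψ.comp hχ, hy⟩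
  · have hlim := (ν.continuousAt_symm (hν.mem_target hqK)).tendsto.comp hq
    exact ⟨ν.symm q, id, strictMono_id, hlim.congr fun j => hν.left_inv (hp j)⟩

theorem eventually_mem_modelEnd [CompactSpace D] [T2Space M] [SecondCountableTopology M]
    (hν : IsModelAtInfinity a ΩD Ω X K K' ν) (ha : 0 < a)
    (hΩ : IsKahler Ω) (hΩD : IsKahler ΩD) (hcomplete : IsCompleteMetric Ω)
    (hdim : Module.finrank ℂ F + 1 = Module.finrank ℂ E) (R : ℝ) :
    ∀ᶠ p in Filter.cocompact M, p ∈ modelEnd K ν R := by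
  have : LocallyCompactSpace M := Manifold.locallyCompact_of_finiteDimensional 𝓘(ℂ, E)
  have : ProperSpace F := FiniteDimensional.proper ℂ F
  have : SecondCountableTopology D := ChartedSpace.secondCountable_of_sigmaCompact F D
  have : (Filter.cocompact M).IsCountablyGenerated := isCountablyGenerated_cocompact
  have hK : ∀ᶠ p in Filter.cocompact M, p ∉ K := hν.compact.compl_mem_cocompact
  suffices h : ∀ᶠ p in Filter.cocompact M, R < ‖(ν p).1‖ from hK.and h
  by_contra hcon
  obtain ⟨p, hp, hpR⟩ := Filter.exists_seq_forall_of_frequently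
    ((Filter.not_eventually.1 hcon).and_eventually hK)
  have hcpt : IsCompact (Metric.closedBall (0 : ℂ) R ×ˢ (Set.univ : Set D)) :=
    (isCompact_closedBall 0 R).prod isCompact_univ
  obtain ⟨q, -, φ, hφ, hq⟩ := hcpt.tendsto_subseq (x := fun j => ν (p j)) fun j =>
    ⟨by simpa using (hpR j).1, trivial⟩
  obtain ⟨y, ψ, hψ, hy⟩ := hν.exists_tendsto_subseq ha hΩ hΩD hcomplete hdim
    (fun j => (hpR (φ j)).2) hq
  exact hy.not_tendsto (disjoint_nhds_cocompact y)
    (hp.comp (hφ.comp hψ).tendsto_atTop)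

end IsModelAtInfinity

end Escape

theorem isPreconnected_lt_norm {R : ℝ} (hR : 0 < R) : IsPreconnected {z : ℂ | R < ‖z‖} := by
  have h : {z : ℂ | R < ‖z‖} = Complex.exp '' {w : ℂ | Real.log R < w.re} := by
    ext z
    constructor
    · intro hz
      have hz0 : z ≠ 0 := norm_pos_iff.1 (hR.trans hz)
      refine ⟨Complex.log z, ?_, Complex.exp_log hz0⟩
      rw [Set.mem_ofPred_eq, Complex.log_re]
      exact Real.log_lt_log hR hz
    · rintro ⟨w, hw, rfl⟩
      rw [Set.mem_ofPred_eq, Complex.norm_exp]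
      exact (Real.log_lt_iff_lt_exp hR).1 hw
  rw [h]
  exact (convex_halfSpace_re_gt _).isPreconnected.image _ Complex.continuous_exp.continuousOn

theorem IsToric.preconnectedSpace {n : ℕ} {E : Type*} [NormedAddCommGroup E] [NormedSpace ℂ E]
    {M : Type*} [TopologicalSpace M] [ChartedSpace E M] [MulAction (Fin n → ℂˣ) M]
    (hM : IsToric n E M) : PreconnectedSpace M := by
  obtain ⟨p, -, hp⟩ := hM.dense_orbit
  have h : MulAction.orbit (Fin n → ℂˣ) p = Set.range (orbitMap (n := n) p) :=
    Set.ext fun _ => mem_orbit_iff_orbitMap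
  rw [h] at hp
  refine ⟨?_⟩
  rw [← hp.closure_eq]
  exact (isPreconnected_range (hM.contMDiff_orbitMap p).continuous).closure

section ModelEnd

open Filter

variable {F : Type*} [NormedAddCommGroup F] [NormedSpace ℂ F]
  {D : Type*} [TopologicalSpace D] [ChartedSpace F D]
  {E : Type*} [NormedAddCommGroup E] [NormedSpace ℂ E]
  {M : Type*} [TopologicalSpace M] [ChartedSpace E M]
  {a : ℝ} {ΩD : BilinField F D} {Ω : BilinField E M} {X : VField E M}
  {K : Set M} {K' : Set (ℂ × D)} {ν : OpenPartialHomeomorph M (ℂ × D)}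

theorem mem_modelEnd_of_lt_radius (ha : 0 ≤ a) {R : ℝ} {p : M} (hp : p ∉ K)
    (h : R ^ a < radius a (ν p)) : p ∈ modelEnd K ν R :=
  ⟨hp, lt_of_not_ge fun hR => h.not_ge (Real.rpow_le_rpow (norm_nonneg _) hR ha)⟩

theorem tendsto_modelPot {l : Filter M} (h : Tendsto (fun p => radius a (ν p)) l atTop) :
    Tendsto (modelPot a ν) l atTop := by
  have hsq : Tendsto (fun r : ℝ => r ^ 2 / 2 - 1) atTop atTop :=
    tendsto_atTop_add_const_right _ _ ((tendsto_pow_atTop two_ne_zero).atTop_div_const two_pos)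
  exact (hsq.comp h).congr fun p => (modelPot_eq a ν p).symm

theorem tendsto_of_eqOn_modelEnd (ha : 0 ≤ a) {R : ℝ} {f : M → ℝ}
    (hf : Set.EqOn f (modelPot a ν) (modelEnd K ν R)) :
    Tendsto f (comap (fun p => radius a (ν p)) atTop ⊓ 𝓟 Kᶜ) atTop := by
  have hr : Tendsto (fun p => radius a (ν p))
      (comap (fun p => radius a (ν p)) atTop ⊓ 𝓟 Kᶜ) atTop :=
    tendsto_comap.mono_left inf_le_left
  refine (tendsto_modelPot hr).congr' ?_
  filter_upwards [hr.eventually_gt_atTop (R ^ a), mem_inf_of_right (mem_principal_self Kᶜ)]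
    with p hp hpK
  exact (hf (mem_modelEnd_of_lt_radius ha hpK hp)).symm

namespace IsModelAtInfinity

theorem exists_norm_fst_le (hν : IsModelAtInfinity a ΩD Ω X K K' ν) :
    ∃ R : ℝ, 0 < R ∧ ∀ q ∈ K', ‖q.1‖ ≤ R := by
  obtain ⟨C, hC⟩ := hν.compact'.exists_bound_of_continuousOn
    (continuous_fst (X := ℂ) (Y := D)).continuousOn
  exact ⟨max C 1, by positivity, fun q hq => (hC q hq).trans (le_max_left _ _)⟩

theorem isOpen_modelEnd (hν : IsModelAtInfinity a ΩD Ω X K K' ν) (R : ℝ) :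
    IsOpen (modelEnd K ν R) := by
  have h := ν.isOpen_inter_preimage (s := {q : ℂ × D | R < ‖q.1‖})
    (isOpen_lt continuous_const continuous_fst.norm)
  rwa [hν.source_eq] at h

theorem isPreconnected_modelEnd [PreconnectedSpace D] (hν : IsModelAtInfinity a ΩD Ω X K K' ν)
    {R : ℝ} (hR : 0 < R) (hK' : ∀ q ∈ K', ‖q.1‖ ≤ R) : IsPreconnected (modelEnd K ν R) := by
  have hnot : ∀ q : ℂ × D, R < ‖q.1‖ → q ∉ K' := fun q hq h => (hK' q h).not_gt hq
  have h : modelEnd K ν R = ν.symm '' ({z : ℂ | R < ‖z‖} ×ˢ (Set.univ : Set D)) := by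
    ext p
    constructor
    · rintro ⟨hp, hpR⟩
      exact ⟨ν p, ⟨hpR, trivial⟩, hν.left_inv hp⟩
    · rintro ⟨q, ⟨hq, -⟩, rfl⟩
      refine ⟨hν.symm_notMem (hnot q hq), ?_⟩
      rw [hν.right_inv (hnot q hq)]
      exact hq
  rw [h]
  exact ((isPreconnected_lt_norm hR).prod isPreconnected_univ).image _
    (ν.continuousOn_symm.mono fun q hq => hν.mem_target (hnot q hq.1))

theorem exists_mem_modelEnd [Nonempty D] (hν : IsModelAtInfinity a ΩD Ω X K K' ν) (ha : 0 < a)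
    (R B : ℝ) : ∃ p ∈ modelEnd K ν R, B < modelPot a ν p := by
  obtain ⟨x⟩ := ‹Nonempty D›
  obtain ⟨R', -, hK'⟩ := hν.exists_norm_fst_le
  have hpow : Tendsto (fun t : ℝ => t ^ (2 * a) / 2 - 1) atTop atTop :=
    tendsto_atTop_add_const_right _ _
      ((tendsto_rpow_atTop (mul_pos two_pos ha)).atTop_div_const two_pos)
  obtain ⟨t, ht0, htR, htR', htB⟩ := ((eventually_ge_atTop 0).and ((eventually_gt_atTop R).and
    ((eventually_gt_atTop R').and (hpow.eventually_gt_atTop B)))).exists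
  have htn : ‖(t : ℂ)‖ = t := by rw [Complex.norm_real, Real.norm_of_nonneg ht0]
  have ht : ((t : ℂ), x) ∉ K' := fun h => (hK' _ h).not_gt (by rwa [htn])
  refine ⟨ν.symm (t, x), ⟨hν.symm_notMem ht, ?_⟩, ?_⟩
  · rwa [hν.right_inv ht, htn]
  · rwa [modelPot, hν.right_inv ht, conePot, htn]

section Potential

variable [FiniteDimensional ℂ F] [FiniteDimensional ℂ E] [IsManifold 𝓘(ℂ, E) ω M] {f : M → ℝ}
  {U : Set M}

theorem sub_modelPot_eq (hν : IsModelAtInfinity a ΩD Ω X K K' ν) (ha : a ≠ 0) (hΩ : IsKahler Ω)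
    (hdim : Module.finrank ℂ F + 1 = Module.finrank ℂ E) (hf : ContMDiff 𝓘(ℝ, E) 𝓘(ℝ, ℝ) ∞ f)
    (hfX : ∀ q v, -Ω q (J E (X q)) v = diff f q v) (hU : IsOpen U) (hc : IsPreconnected U)
    (hUK : U ⊆ Kᶜ) {p q : M} (hp : p ∈ U) (hq : q ∈ U) :
    f p - modelPot a ν p = f q - modelPot a ν q := by
  have hz : ∀ y ∈ U, (ν y).1 ≠ 0 ∨ a = 1 := fun y hy => hν.fst_ne_zero_or hΩ hdim (hUK hy)
  refine sub_eq_sub_of_rdiff_eq hU hc (fun y _ => (hf y).mdifferentiableAt (by simp))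
    (fun y hy => hν.mdifferentiableAt_modelPot (hUK hy) (hz y hy)) (fun y hy => ?_) hp hq
  ext v
  rw [← hν.contract_eq_rdiff (hUK hy) (hz y hy) ha, hfX]
  rfl

theorem soliton_equation (hν : IsModelAtInfinity a ΩD Ω X K K' ν) (ha : a ≠ 0) (hΩ : IsKahler Ω)
    (hdim : Module.finrank ℂ F + 1 = Module.finrank ℂ E)
    (hU : IsOpen U) (hUK : U ⊆ Kᶜ) (hf : Set.EqOn f (modelPot a ν) U) {p : M} (hp : p ∈ U) :
    laplacian Ω f p + f p - diff f p (X p) / 2 = 0 := by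
  have hfp : f =ᶠ[𝓝 p] modelPot a ν := hf.eventuallyEq_of_mem (hU.mem_nhds hp)
  have hz := hν.fst_ne_zero_or hΩ hdim (hUK hp)
  have hdf : diff f p (X p) = conePot a (ν p).1 := by
    rw [← hν.rdiff_modelPot_field (hUK hp) hz ha, ← rdiff_congr hfp]
    rfl
  rw [hν.laplacian_eq_one hΩ hdim (hUK hp) hz hfp, hdf, hf hp, modelPot]
  ring

theorem noncompactSpace [ConnectedSpace D] (hν : IsModelAtInfinity a ΩD Ω X K K' ν) (ha : 0 < a)
    (hΩ : IsKahler Ω) (hdim : Module.finrank ℂ F + 1 = Module.finrank ℂ E)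
    (hf : ContMDiff 𝓘(ℝ, E) 𝓘(ℝ, ℝ) ∞ f) (hfX : ∀ q v, -Ω q (J E (X q)) v = diff f q v) :
    NoncompactSpace M := by
  refine not_compactSpace_iff.1 fun hcpt => ?_
  obtain ⟨B, hB⟩ := isCompact_univ.bddAbove_image hf.continuous.continuousOn
  obtain ⟨R, hR, hK'⟩ := hν.exists_norm_fst_le
  obtain ⟨p, hp, -⟩ := hν.exists_mem_modelEnd ha R 0
  obtain ⟨q, hq, hqB⟩ := hν.exists_mem_modelEnd ha R (B - (f p - modelPot a ν p))
  have hsub := hν.sub_modelPot_eq ha.ne' hΩ hdim hf hfX (hν.isOpen_modelEnd R)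
    (hν.isPreconnected_modelEnd hR hK') (fun _ h => h.1) hp hq
  have hfq : f q ≤ B := hB ⟨q, trivial, rfl⟩
  linarith

theorem exists_hamiltonian {n : ℕ} [MulAction (Fin n → ℂˣ) M] [Nonempty D] [T2Space M]
    (hν : IsModelAtInfinity a ΩD Ω X K K' ν) (ha : 0 < a)
    (hΩ : IsKahler Ω) (hdim : Module.finrank ℂ F + 1 = Module.finrank ℂ E) (hM : IsToric n E M)
    (hinv : TorusInvariantForm n Ω) (hX : InTorusLieAlgebra n (fun p => J E (X p))) :
    ∃ f : M → ℝ, ContMDiff 𝓘(ℝ, E) 𝓘(ℝ, ℝ) ∞ f ∧ TorusInvariant n f ∧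
      ∀ q v, -Ω q (J E (X q)) v = diff f q v := by
  obtain ⟨b, hb⟩ := hX
  obtain ⟨p₀, hopen, hdense⟩ := hM.dense_orbit
  obtain ⟨p₁, hp₁, -⟩ := hν.exists_mem_modelEnd ha 0 0
  obtain ⟨p, hpK, hp⟩ := hdense.inter_open_nonempty Kᶜ hν.isOpen_compl ⟨p₁, hp₁.1⟩
  rw [← MulAction.orbit_eq_iff.2 hp] at hopen hdense
  obtain ⟨f, hf, hfT, hfX⟩ := hM.exists_potential hΩ hinv hopen hdense
    (hν.torusField_orthogonal hM hΩ hinv ha.ne'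
      (fun _ h => hν.fst_ne_zero_or hΩ hdim h) hb hpK)
  refine ⟨f, hf, hfT, fun q v => ?_⟩
  rw [congrFun hb q]
  exact (DFunLike.congr_fun (hfX q) v).symm

variable [IsManifold 𝓘(ℂ, F) ω D] [T2Space D] [CompactSpace D] [T2Space M]
  [SecondCountableTopology M]

theorem tendsto_radius_cocompact (hν : IsModelAtInfinity a ΩD Ω X K K' ν) (ha : 0 < a)
    (hΩ : IsKahler Ω) (hΩD : IsKahler ΩD) (hcomplete : IsCompleteMetric Ω)
    (hdim : Module.finrank ℂ F + 1 = Module.finrank ℂ E) :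
    Tendsto (fun p => radius a (ν p)) (cocompact M) atTop :=
  (tendsto_rpow_atTop ha).comp <| tendsto_atTop.2 fun R =>
    (hν.eventually_mem_modelEnd ha hΩ hΩD hcomplete hdim R).mono fun _ h => h.2.le

theorem exists_isNormalisedPotential {n : ℕ} [MulAction (Fin n → ℂˣ) M] [ConnectedSpace D]
    (hν : IsModelAtInfinity a ΩD Ω X K K' ν) (ha : 0 < a) (hΩ : IsKahler Ω) (hΩD : IsKahler ΩD)
    (hcomplete : IsCompleteMetric Ω) (hdim : Module.finrank ℂ F + 1 = Module.finrank ℂ E)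
    (hM : IsToric n E M) (hinv : TorusInvariantForm n Ω)
    (hX : InTorusLieAlgebra n (fun p => J E (X p))) :
    ∃ f : M → ℝ, IsNormalisedPotential n a Ω X ν f := by
  obtain ⟨f, hf, hfT, hfX⟩ := hν.exists_hamiltonian ha hΩ hdim hM hinv hX
  obtain ⟨R, hR, hK'⟩ := hν.exists_norm_fst_le
  obtain ⟨p, hp, -⟩ := hν.exists_mem_modelEnd ha R 0
  refine ⟨fun q => f q - (f p - modelPot a ν p), hf.sub contMDiff_const, fun t q => ?_,
    fun q v => ?_, ?_⟩
  · rw [hfT]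
  · have hd : rdiff E ℝ (fun q => f q - (f p - modelPot a ν p)) q = rdiff E ℝ f q := by
      refine (mfderiv_sub ((hf q).mdifferentiableAt (by simp)) mdifferentiableAt_const).trans ?_
      rw [mfderiv_const]
      exact sub_zero _
    exact (hfX q v).trans (DFunLike.congr_fun hd v).symm
  · filter_upwards [hν.eventually_mem_modelEnd ha hΩ hΩD hcomplete hdim R] with q hq
    have hsub := hν.sub_modelPot_eq ha.ne' hΩ hdim hf hfX (hν.isOpen_modelEnd R)
      (hν.isPreconnected_modelEnd hR hK') (fun _ h => h.1) hq hp
    rw [← modelPot_eq, ← hsub]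
    exact sub_sub_cancel _ _

end Potential

end IsModelAtInfinity

end ModelEnd

section NormalisedPotential

open Filter

variable {F : Type*} [NormedAddCommGroup F] [NormedSpace ℂ F]
  {D : Type*} [TopologicalSpace D] [ChartedSpace F D]
  {E : Type*} [NormedAddCommGroup E] [NormedSpace ℂ E]
  {M : Type*} [TopologicalSpace M] [ChartedSpace E M]
  {n : ℕ} [MulAction (Fin n → ℂˣ) M]
  {a : ℝ} {ΩD : BilinField F D} {Ω : BilinField E M} {X : VField E M}
  {K : Set M} {K' : Set (ℂ × D)} {ν : OpenPartialHomeomorph M (ℂ × D)} {f f' : M → ℝ}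

namespace IsNormalisedPotential

theorem eventuallyEq_modelPot (hf : IsNormalisedPotential n a Ω X ν f) :
    f =ᶠ[cocompact M] modelPot a ν :=
  hf.at_infinity.mono fun p hp => hp.trans (modelPot_eq a ν p).symm

theorem unique [IsManifold 𝓘(ℂ, E) ω M] [PreconnectedSpace M] [NoncompactSpace M]
    (hf : IsNormalisedPotential n a Ω X ν f) (hf' : IsNormalisedPotential n a Ω X ν f') :
    f' = f := by
  obtain ⟨q, hq, hq'⟩ := (hf.eventuallyEq_modelPot.and hf'.eventuallyEq_modelPot).exists
  funext p
  have hsub : f' p - f p = f' q - f q := by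
    refine sub_eq_sub_of_rdiff_eq isOpen_univ isPreconnected_univ
      (fun y _ => (hf'.smooth y).mdifferentiableAt (by simp))
      (fun y _ => (hf.smooth y).mdifferentiableAt (by simp)) (fun y _ => ?_) trivial trivial
    ext v
    exact (hf'.hamiltonian y v).symm.trans (hf.hamiltonian y v)
  rwa [hq, hq', sub_self, sub_eq_zero] at hsub

theorem eqOn_modelPot [FiniteDimensional ℂ F] [FiniteDimensional ℂ E] [IsManifold 𝓘(ℂ, E) ω M]
    (hf : IsNormalisedPotential n a Ω X ν f) (hν : IsModelAtInfinity a ΩD Ω X K K' ν) (ha : a ≠ 0)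
    (hΩ : IsKahler Ω) (hdim : Module.finrank ℂ F + 1 = Module.finrank ℂ E) {U : Set M}
    (hU : IsOpen U) (hc : IsPreconnected U) (hUK : U ⊆ Kᶜ) (hUfar : ∃ᶠ p in cocompact M, p ∈ U) :
    Set.EqOn f (modelPot a ν) U := by
  obtain ⟨q, hqU, hq⟩ := (hUfar.and_eventually hf.eventuallyEq_modelPot).exists
  intro p hp
  have hsub := hν.sub_modelPot_eq ha hΩ hdim hf.smooth hf.hamiltonian hU hc hUK hp hqU
  rwa [hq, sub_self, sub_eq_zero] at hsub

theorem tendsto_cocompact (hf : IsNormalisedPotential n a Ω X ν f)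
    (h : Tendsto (fun p => radius a (ν p)) (cocompact M) atTop) : Tendsto f (cocompact M) atTop :=
  (tendsto_modelPot h).congr' hf.eventuallyEq_modelPot.symm

end IsNormalisedPotential

end NormalisedPotential

end KahlerToric

end

open KahlerToric Filter in
theorem lemma4p2 {n : ℕ}
    -- the compact connected Kähler manifold `(D, Ω_D)` of dimension `n - 1`
    {F : Type*} [NormedAddCommGroup F] [NormedSpace ℂ F] [FiniteDimensional ℂ F]
    {D : Type*} [TopologicalSpace D] [ChartedSpace F D] [IsManifold 𝓘(ℂ, F) ω D]
    [T2Space D] [CompactSpace D] [ConnectedSpace D] (hF : Module.finrank ℂ F + 1 = n)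
    (ΩD : BilinField F D) (hΩD : IsKahler ΩD)
    -- the toric manifold `M` of dimension `n`
    {E : Type*} [NormedAddCommGroup E] [NormedSpace ℂ E] [FiniteDimensional ℂ E]
    {M : Type*} [TopologicalSpace M] [ChartedSpace E M] [IsManifold 𝓘(ℂ, E) ω M]
    [T2Space M] [SecondCountableTopology M] [MulAction (Fin n → ℂˣ) M] (hM : IsToric n E M)
    -- the complete torus-invariant Kähler metric, the vector field and the model at infinity
    (Ω : BilinField E M) (hΩ : IsKahler Ω) (hcomplete : IsCompleteMetric Ω)
    (hinv : TorusInvariantForm n Ω)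
    (X : VField E M) (hX : InTorusLieAlgebra n (fun p => J E (X p)))
    (a : ℝ) (ha : 0 < a) (K : Set M) (K' : Set (ℂ × D)) (ν : OpenPartialHomeomorph M (ℂ × D))
    (hν : IsModelAtInfinity a ΩD Ω X K K' ν) :
    ∃ f : M → ℝ,
      IsNormalisedPotential n a Ω X ν f ∧
      (∀ f' : M → ℝ, IsNormalisedPotential n a Ω X ν f' → f' = f) ∧
      (∀ᶠ p in cocompact M, laplacian Ω f p + f p - diff f p (X p) / 2 = 0) ∧
      (IsConnected Kᶜ → ∀ p ∉ K, f p = radius a (ν p) ^ 2 / 2 - 1 ∧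
        laplacian Ω f p + f p - diff f p (X p) / 2 = 0) ∧
      Tendsto f (comap (fun p => radius a (ν p)) atTop ⊓ 𝓟 Kᶜ) atTop ∧
      Tendsto f (cocompact M) atTop ∧
      IsProperMap f := by
  have hdim : Module.finrank ℂ F + 1 = Module.finrank ℂ E := hF.trans hM.finrank_eq.symm
  obtain ⟨f, hf⟩ := hν.exists_isNormalisedPotential ha hΩ hΩD hcomplete hdim hM hinv hX
  have : PreconnectedSpace M := hM.preconnectedSpace
  have : NoncompactSpace M := hν.noncompactSpace ha hΩ hdim hf.smooth hf.hamiltonian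
  obtain ⟨R, hR, hK'⟩ := hν.exists_norm_fst_le
  have hfar := hν.eventually_mem_modelEnd ha hΩ hΩD hcomplete hdim R
  have hend : Set.EqOn f (modelPot a ν) (modelEnd K ν R) :=
    hf.eqOn_modelPot hν ha.ne' hΩ hdim (hν.isOpen_modelEnd R) (hν.isPreconnected_modelEnd hR hK')
      (fun _ h => h.1) hfar.frequently
  have htend : Tendsto f (cocompact M) atTop :=
    hf.tendsto_cocompact (hν.tendsto_radius_cocompact ha hΩ hΩD hcomplete hdim)
  refine ⟨f, hf, fun f' hf' => hf.unique hf', ?_, fun hconn p hp => ?_,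
    tendsto_of_eqOn_modelEnd ha.le hend, htend,
    isProperMap_iff_tendsto_cocompact.2 ⟨hf.smooth.continuous, htend.mono_right atTop_le_cocompact⟩⟩
  · exact hfar.mono fun p hp => hν.soliton_equation ha.ne' hΩ hdim (hν.isOpen_modelEnd R)
      (fun _ h => h.1) hend hp
  · have hcompl : Set.EqOn f (modelPot a ν) Kᶜ :=
      hf.eqOn_modelPot hν ha.ne' hΩ hdim hν.isOpen_compl hconn.isPreconnected subset_rfl
        (hfar.mono fun _ h => h.1).frequently
    exact ⟨(hcompl hp).trans (modelPot_eq a ν p),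
      hν.soliton_equation ha.ne' hΩ hdim hν.isOpen_compl subset_rfl hcompl hp⟩
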